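/- Let $1<\lambda<2$, let $$\Phi(\xi)=-\frac{2\sqrt{\pi}\,\Gamma\!\left(i\xi+1+\frac{\lambda}{2}\right)}{\Gamma\!\left(i\xi+\frac{\lambda+1}{2}\right)},\qquad \mathcal S=\left\{\xi\in\mathbb C:\ \tfrac32<\Im\xi<\tfrac{3+\lambda}{2}\right\},\qquad I=\left(\tfrac{2+\lambda}{2},\tfrac{3+\lambda}{2}\right).$$ For every $\beta\in I$ there is exactly one continuous logarithm $\log(-\Phi)$ of $-\Phi$ along the line $\Im\eta=\beta$ whose imaginary part tends to $\pi/4$ as $\Re\eta\to+\infty$; this branch is used below. Let $\beta_1\in I$ not be an odd multiple of $(\lambda-1)/4$. For $\beta_1-\frac{\lambda-1}{2}<\Im\xi<\beta_1$ the integral in $$\mathcal V(\xi)=\exp\left(\frac{2}{(\lambda-1)i}\int_{\Im\eta=\beta_1}\log(-\Phi(\eta))\left[\frac{1}{1-e^{\frac{4\pi}{\lambda-1}(\xi-\eta)}}-\frac{1}{1+e^{-\frac{4\pi}{\lambda-1}\eta}}\right]d\eta\right)$$ converges absolutely, and the function $\mathcal V$ so defined extends to a meromorphic function on $\mathbb C$,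 again denoted by $\mathcal V$, which is analytic and without zeros in $\mathcal S$ and has the following properties. 1. $\mathcal V(\eta)=-\mathcal V\left(\eta+\frac{\lambda-1}{2}i\right)\Phi\left(\eta+\frac{\lambda-1}{2}i\right)$ for $\frac32<\Im\eta<2$, and as an identity of meromorphic functions on $\mathbb C$. 2. For every $\delta>0$ there is $c>0$ such that $c\,e^{-\frac12\left(\frac{\pi}{\lambda-1}+\delta\right)|\xi|}\le|\mathcal V(\xi)|$ for all $\xi\in\mathcal S$; and for all $\delta>0$ and $r>0$ there is $C>0$ such that $|\mathcal V(\xi)|\le C\,e^{-\frac12\left(\frac{\pi}{\lambda-1}-\delta\right)|\xi|}$ for all $\xi\in\mathcal S$ with $|\xi-\frac32 i|\ge r$ and $|\xi-\frac{3+\lambda}{2}i|\ge r$. 3. For every $\beta\in I$ and all $\xi,y$ with $\Im\xi,\Im y\in\left(\beta-\frac{\lambda-1}{2},\beta\right)$, $$\frac{\mathcal V(\xi)}{\mathcal V(y)}=\exp\left[\frac{2}{(\lambda-1)i}\int_{\Im\eta=\beta}\log(-\Phi(\eta))\left(\frac{1}{1-e^{\frac{4\pi}{\lambda-1}(\xi-\eta)}}-\frac{1}{1-e^{\frac{4\pi}{\lambda-1}(y-\eta)}}\right)d\eta\right],$$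 the integral being absolutely convergent. 4. There is a function $\widehat G(t,\xi)$, $t>0$, analytic in $\xi\in\mathcal S$ for each $t$, such that for every $\beta_0\in(\frac32,2)$ and every $\xi\in\mathcal S$ with $\Im\xi>\beta_0$ $$\widehat G(t,\xi)=\frac{1}{2\pi i}\left(-\frac{\sqrt2}{\sqrt\pi\, i(\lambda-1)}\right)\int_{\Im y=\beta_0}\frac{\mathcal V(\xi)}{\mathcal V(y)}\,t^{\frac{2i(\xi-y)}{\lambda-1}}\,\Gamma\!\left(-\frac{2i(\xi-y)}{\lambda-1}\right)dy$$ with an absolutely convergent integral. It satisfies $$\frac{\partial\widehat G}{\partial t}(t,\xi)=\widehat G\left(t,\xi+\tfrac{\lambda-1}{2}i\right)\Phi\left(\xi+\tfrac{\lambda-1}{2}i\right)\quad\text{for } t>0,\ \tfrac32<\Im\xi<2,$$ and $\lim_{t\to0^+}\widehat G(t,\xi)=\frac{1}{\sqrt{2\pi}}$ for every $\xi\in\mathcal S$. -/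

import Mathlib

open Filter Topology

namespace WienerHopf

/-- The function `Φ(ξ) = -2√π Γ(iξ + 1 + λ/2) / Γ(iξ + (λ+1)/2)`.  (At the zeros of `Φ`, where the
denominator has a pole, Mathlib's conventions give the correct value `0`.) -/
noncomputable def Phi (lam : ℝ) (ξ : ℂ) : ℂ :=
  -(2 * (Real.sqrt Real.pi : ℂ) * Complex.Gamma (Complex.I * ξ + 1 + lam / 2) /
    Complex.Gamma (Complex.I * ξ + (lam + 1) / 2))

/-- The strip `S = {3/2 < Im ξ < (3+λ)/2}`. -/
def stripS (lam : ℝ) : Set ℂ := {ξ | 3 / 2 < ξ.im ∧ ξ.im < (3 + lam) / 2}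

/-- The point `x + iβ` of the horizontal line `Im = β`. -/
noncomputable def linePt (β x : ℝ) : ℂ := (x : ℂ) + (β : ℂ) * Complex.I

/-- `x ↦ f (x + iβ)` is absolutely integrable over `ℝ`. -/
def LineIntegrable (f : ℂ → ℂ) (β : ℝ) : Prop :=
  MeasureTheory.Integrable (fun x : ℝ => f (linePt β x))

/-- The integral `∫_{Im η = β} f(η) dη`, the line being traversed from left to right. -/
noncomputable def lineIntegral (f : ℂ → ℂ) (β : ℝ) : ℂ := ∫ x : ℝ, f (linePt β x)

/-- `L` is the continuous logarithm of `-Φ` along the line `Im η = β` (parametrised by `Re η`)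
whose imaginary part `arg(-Φ)` tends to `π/4` as `Re η → +∞`. -/
def IsLogBranch (lam β : ℝ) (L : ℝ → ℂ) : Prop :=
  Continuous L ∧ (∀ x : ℝ, Complex.exp (L x) = -Phi lam (linePt β x)) ∧
    Tendsto (fun x : ℝ => (L x).im) atTop (𝓝 (Real.pi / 4))

/-- `log(-Φ)` on the line `Im η = β`, as a function of `Re η`. The theorem asserts that
the branch exists and is unique on the lines where it is used. -/
noncomputable def logNegPhi (lam β : ℝ) : ℝ → ℂ := Classical.epsilon (IsLogBranch lam β)

/-- The integrand
`log(-Φ(η)) [1/(1 - e^{4π(ξ-η)/(λ-1)}) - 1/(1 + e^{-4πη/(λ-1)})]`, for `η` on the line `Im η = β`. -/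
noncomputable def cauchyIntegrand (lam β : ℝ) (ξ η : ℂ) : ℂ :=
  logNegPhi lam β η.re *
    (1 / (1 - Complex.exp (4 * Real.pi / (lam - 1) * (ξ - η)))
      - 1 / (1 + Complex.exp (-(4 * Real.pi / (lam - 1) * η))))

/-- The exponential of a Cauchy-type integral `V_{part,β}(ξ)`, meaningful for
`β - (λ-1)/2 < Im ξ < β`. -/
noncomputable def Vpart (lam β : ℝ) (ξ : ℂ) : ℂ :=
  Complex.exp (2 / ((lam - 1) * Complex.I) * lineIntegral (cauchyIntegrand lam β ξ) β)

/-- The integrand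
`log(-Φ(η)) [1/(1 - e^{4π(ξ-η)/(λ-1)}) - 1/(1 - e^{4π(y-η)/(λ-1)})]`, for `η` on the line `Im η = β`. -/
noncomputable def quotIntegrand (lam β : ℝ) (ξ y η : ℂ) : ℂ :=
  logNegPhi lam β η.re *
    (1 / (1 - Complex.exp (4 * Real.pi / (lam - 1) * (ξ - η)))
      - 1 / (1 - Complex.exp (4 * Real.pi / (lam - 1) * (y - η))))

/-- The integrand `(V(ξ)/V(y)) t^{2i(ξ-y)/(λ-1)} Γ(-2i(ξ-y)/(λ-1))`. -/
noncomputable def gammaIntegrand (lam : ℝ) (V : ℂ → ℂ) (t : ℝ) (ξ y : ℂ) : ℂ :=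
  V ξ / V y * (t : ℂ) ^ (2 * Complex.I * (ξ - y) / (lam - 1)) *
    Complex.Gamma (-(2 * Complex.I * (ξ - y) / (lam - 1)))

/-- The Gamma-kernel integral over `Im y = β₀`, with the normalisation
`-(1/(2πi)) √2/(√π i (λ-1)) = 1/(√2 π^{3/2} (λ-1))`. -/
noncomputable def gammaIntegral (lam : ℝ) (V : ℂ → ℂ) (β₀ t : ℝ) (ξ : ℂ) : ℂ :=
  1 / (2 * Real.pi * Complex.I) *
    (-((Real.sqrt 2 : ℂ) / ((Real.sqrt Real.pi : ℂ) * Complex.I * (lam - 1)))) *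
      lineIntegral (gammaIntegrand lam V t ξ) β₀

end WienerHopf

/-! ### Integrals over horizontal lines: shifting, residues, holomorphic dependence on a parameter.
-/

namespace WienerHopf
open MeasureTheory Set

/-! After taking logarithms the difference equation for V becomes additive, and a Cauchy integral of
log(-Φ) against the kernel 1/(1 - e^{c(ξ-η)}), c = 4π/(λ-1), solves it. The kernel has period
i(λ-1)/2 in ξ, so moving ξ by one period amounts to moving the contour across the single pole η = ξ,
and the residue there produces log(-Φ(ξ)) (`lineIntegral_cauchyF_sub`, `expCauchy_eq`).

The logarithm is explicit. With z = iη + (λ+1)/2 one has -Φ = 2√π Γ(z+1/2)/Γ(z). The recursion of Γ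
moves z by 2 into a right half plane, where Γ(w+1/2)²/(Γ(w)Γ(w+1)) stays in a disc about 1 of radius
less than 1, so that principal logarithms suffice (`norm_gammaQuot_sub_one_le`, `exp_logGammaRatio`,
`exp_ell`). Hence log(-Φ) is half a logarithm plus a remainder bounded on closed substrips, and its
imaginary part tends to ±π/4 at ±∞.

This determines the growth of V. The ξ-derivative of the Cauchy integral is -log(-Φ) averaged
against a kernel of total mass 1 concentrated near Re ξ, and log(-Φ) varies slowly; so the imaginary
part of the integral is -(π/4)|Re ξ| up to a small multiple of |Re ξ| (`exists_deriv_error`,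
`im_cauchyS_asymp`). Exponentiating gives both bounds in the middle of the strip; the difference
equation carries them to the edges, where the pole and the zero of Φ on the boundary matter
(`expCauchy_lower`, `expCauchy_upper`). Iterating the same equation extends V meromorphically
(`extCauchy_eq`).

In the Gamma-kernel integral the factor Γ decays faster than 1/V grows (`exists_norm_gkern_le`). The
identity Γ(1+s) = sΓ(s) turns the t-derivative into a shift of ξ by one period, and the equation for
V rewrites the shifted prefactor (`hasDerivAt_gkern`, `hasDerivAt_gsol`). Moving the contour above ξ
leaves an integral carrying a positive power of t, which vanishes as t → 0, and the residue at y =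
ξ, which is the constant limit (`gline_sub_eq`, `tendsto_gline_above`). -/

lemma linePt_re (b x : ℝ) : (linePt b x).re = x := by simp [linePt]

lemma linePt_im (b x : ℝ) : (linePt b x).im = b := by simp [linePt]

lemma linePt_re_im (z : ℂ) : linePt z.im z.re = z := by simp [linePt, Complex.re_add_im]

lemma continuous_linePt (b : ℝ) : Continuous (linePt b) := by
  unfold linePt; fun_prop

lemma integrable_exp_neg_mul_abs {m : ℝ} (hm : 0 < m) :
    Integrable (fun x : ℝ => Real.exp (-m * |x|)) := by
  rw [← integrableOn_univ, ← Iic_union_Ioi (a := (0 : ℝ)), integrableOn_union]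
  constructor
  · refine (integrableOn_exp_mul_Iic hm 0).congr_fun (fun x hx => ?_) measurableSet_Iic
    simp only [mem_Iic] at hx
    simp [abs_of_nonpos hx]
  · refine (integrableOn_exp_mul_Ioi (a := -m) (by linarith) 0).congr_fun (fun x hx => ?_)
      measurableSet_Ioi
    simp only [mem_Ioi] at hx
    simp [abs_of_pos hx]

lemma exists_abs_ge_exp_le {m C ε : ℝ} (hm : 0 < m) (hε : 0 < ε) :
    ∃ X : ℝ, ∀ x : ℝ, X ≤ |x| → C * Real.exp (-m * |x|) ≤ ε := by
  have h : Tendsto (fun y : ℝ => C * Real.exp (-m * y)) atTop (𝓝 (C * 0)) := by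
    refine Tendsto.const_mul _ (Real.tendsto_exp_atBot.comp ?_)
    exact tendsto_id.const_mul_atTop_of_neg (by linarith)
  rw [mul_zero] at h
  obtain ⟨X, hX⟩ := (h.eventually (ge_mem_nhds hε)).exists_forall_of_atTop
  exact ⟨X, fun x hx => hX _ hx⟩

/-- Two horizontal lines give the same integral when the function is holomorphic in between
and decays uniformly. -/
lemma lineIntegral_eq_of_differentiableAt {f : ℂ → ℂ} {b₁ b₂ : ℝ} (hb : b₁ ≤ b₂)
    (hf : ∀ z : ℂ, b₁ ≤ z.im → z.im ≤ b₂ → DifferentiableAt ℂ f z)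
    (h₁ : LineIntegrable f b₁) (h₂ : LineIntegrable f b₂)
    (hdec : ∀ ε : ℝ, 0 < ε → ∃ X : ℝ, ∀ x b : ℝ, X ≤ |x| → b₁ ≤ b → b ≤ b₂ →
      ‖f (linePt b x)‖ ≤ ε) :
    lineIntegral f b₁ = lineIntegral f b₂ := by
  have key : ∀ ε : ℝ, 0 < ε → ‖lineIntegral f b₁ - lineIntegral f b₂‖ ≤ ε := by
    intro ε hε
    -- The two vertical sides of a large rectangle contribute at most 2δ(b₂ - b₁) ≤ ε; the extra 1
    -- keeps the denominator positive when b₁ = b₂.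
    set δ := ε / (2 * (b₂ - b₁ + 1)) with hδ
    have hpos : 0 < b₂ - b₁ + 1 := by linarith
    have hδ0 : 0 < δ := by positivity
    obtain ⟨X, hX⟩ := hdec δ hδ0
    have l₁ := intervalIntegral_tendsto_integral h₁ tendsto_neg_atTop_atBot tendsto_id
    have l₂ := intervalIntegral_tendsto_integral h₂ tendsto_neg_atTop_atBot tendsto_id
    have l := (l₁.sub l₂).norm
    refine le_of_tendsto l ?_
    filter_upwards [eventually_ge_atTop (max X 0)] with T hT
    have hTX : X ≤ T := le_trans (le_max_left _ _) hT
    have hT0 : 0 ≤ T := le_trans (le_max_right _ _) hT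
    have hc := Complex.integral_boundary_rect_eq_zero_of_differentiableOn f
      (linePt b₁ (-T)) (linePt b₂ T) (by
        intro z hz
        simp only [linePt_re, linePt_im, Complex.mem_reProdIm, uIcc_of_le hb, mem_Icc] at hz
        exact (hf z hz.2.1 hz.2.2).differentiableWithinAt)
    simp only [linePt_re, linePt_im] at hc
    have hv : ∀ s : ℝ, |s| = T → ‖∫ y in b₁..b₂, f (s + y * Complex.I)‖ ≤ δ * |b₂ - b₁| := by
      intro s hs
      refine intervalIntegral.norm_integral_le_of_norm_le_const fun y hy => ?_
      rw [uIoc_of_le hb] at hy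
      exact hX s y (hs ▸ hTX) hy.1.le hy.2
    have v₁ := hv T (abs_of_nonneg hT0)
    have v₂ := hv (-T) (by rw [abs_neg, abs_of_nonneg hT0])
    rw [abs_of_nonneg (by linarith)] at v₁ v₂
    have e : (∫ x in -T..T, f (linePt b₁ x)) - ∫ x in -T..T, f (linePt b₂ x)
        = Complex.I • (∫ y in b₁..b₂, f (((-T : ℝ) : ℂ) + y * Complex.I))
          - Complex.I • (∫ y in b₁..b₂, f ((T : ℂ) + y * Complex.I)) := by
      unfold linePt
      linear_combination hc
    simp only [id]
    rw [e]
    refine (norm_sub_le _ _).trans ?_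
    rw [norm_smul, norm_smul, Complex.norm_I, one_mul, one_mul]
    have : δ * (2 * (b₂ - b₁ + 1)) = ε := by rw [hδ]; field_simp
    nlinarith
  have h0 : ‖lineIntegral f b₁ - lineIntegral f b₂‖ ≤ 0 := le_of_forall_pos_le_add (by simpa using key)
  exact sub_eq_zero.mp (norm_le_zero_iff.mp h0)

/-- A single simple pole is not integrable along a line; subtracting a second one improves the decay
to 1/x². -/
lemma integrable_inv_sub_inv {b d : ℝ} (hb : b ≠ 0) (hd : d ≠ 0) :
    Integrable (fun x : ℝ => ((x : ℂ) + b * Complex.I)⁻¹ - ((x : ℂ) + d * Complex.I)⁻¹) := by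
  have hne : ∀ (e : ℝ), e ≠ 0 → ∀ x : ℝ, (x : ℂ) + e * Complex.I ≠ 0 := by
    intro e he x h
    have := congrArg Complex.im h
    simp at this
    exact he this
  have hlow : ∀ (e : ℝ), e ≠ 0 → ∃ k : ℝ, 0 < k ∧ ∀ x : ℝ, k * (1 + x ^ 2) ≤ ‖(x : ℂ) + e * Complex.I‖ ^ 2 := by
    intro e he
    refine ⟨min 1 (e ^ 2), lt_min one_pos (by positivity), fun x => ?_⟩
    rw [← Complex.normSq_eq_norm_sq, Complex.normSq_add_mul_I]
    have h1 := min_le_left 1 (e ^ 2)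
    have h2 := min_le_right 1 (e ^ 2)
    nlinarith [sq_nonneg x]
  obtain ⟨k, hk, hk'⟩ := hlow b hb
  obtain ⟨l, hl, hl'⟩ := hlow d hd
  refine Integrable.mono' (integrable_inv_one_add_sq.const_mul (|d - b| * ((k * l) ^ (1 / 2 : ℝ))⁻¹)) ?_ ?_
  · have c1 : Continuous fun x : ℝ => ((x : ℂ) + b * Complex.I)⁻¹ :=
      Continuous.inv₀ (by fun_prop) (hne b hb)
    have c2 : Continuous fun x : ℝ => ((x : ℂ) + d * Complex.I)⁻¹ :=
      Continuous.inv₀ (by fun_prop) (hne d hd)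
    exact (c1.sub c2).aestronglyMeasurable
  · refine Eventually.of_forall fun x => ?_
    have e : ((x : ℂ) + b * Complex.I)⁻¹ - ((x : ℂ) + d * Complex.I)⁻¹
        = ((d - b : ℝ) : ℂ) * Complex.I * (((x : ℂ) + b * Complex.I) * ((x : ℂ) + d * Complex.I))⁻¹ := by
      rw [inv_sub_inv (hne b hb x) (hne d hd x), div_eq_mul_inv]
      congr 1
      push_cast
      ring
    rw [e, norm_mul, norm_mul, Complex.norm_I, mul_one, Complex.norm_real, norm_inv, norm_mul,
      Real.norm_eq_abs, mul_assoc, ← mul_inv]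
    have hp : 0 < ‖(x : ℂ) + b * Complex.I‖ * ‖(x : ℂ) + d * Complex.I‖ :=
      mul_pos (norm_pos_iff.mpr (hne b hb x)) (norm_pos_iff.mpr (hne d hd x))
    have hkl : 0 < (k * l) ^ (1 / 2 : ℝ) := by positivity
    refine mul_le_mul_of_nonneg_left (inv_anti₀ (by positivity) ?_) (abs_nonneg _)
    rw [← Real.sqrt_eq_rpow]
    refine le_of_sq_le_sq (a := Real.sqrt (k * l) * (1 + x ^ 2)) ?_ hp.le
    rw [mul_pow, mul_pow, Real.sq_sqrt (by positivity)]
    calc k * l * (1 + x ^ 2) ^ 2 = (k * (1 + x ^ 2)) * (l * (1 + x ^ 2)) := by ring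
      _ ≤ _ := mul_le_mul (hk' x) (hl' x) (by positivity) (by positivity)

lemma tendsto_log_ratio (b d : ℝ) (hb : b ≠ 0) (hd : d ≠ 0) {l : Filter ℝ}
    (hl : Tendsto (fun x : ℝ => x ^ 2) l atTop) :
    Tendsto (fun x : ℝ => (1 / 2) * (Real.log (x ^ 2 + b ^ 2) - Real.log (x ^ 2 + d ^ 2))) l (𝓝 0) := by
  have h1 : Tendsto (fun x : ℝ => 1 + (b ^ 2 - d ^ 2) / (x ^ 2 + d ^ 2)) l (𝓝 (1 + 0)) := by
    refine tendsto_const_nhds.add (Tendsto.div_atTop tendsto_const_nhds ?_)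
    exact tendsto_atTop_add_const_right _ _ hl
  rw [add_zero] at h1
  have h2 := ((Real.continuousAt_log one_ne_zero).tendsto.comp h1).const_mul (1 / 2)
  rw [Real.log_one, mul_zero] at h2
  refine h2.congr fun x => ?_
  have p1 : 0 < x ^ 2 + b ^ 2 := by positivity
  have p2 : 0 < x ^ 2 + d ^ 2 := by positivity
  rw [← Real.log_div p1.ne' p2.ne']
  simp only [Function.comp]
  congr 2
  field_simp
  ring

lemma tendsto_sq_atBot : Tendsto (fun x : ℝ => x ^ 2) atBot atTop :=
  (tendsto_pow_atTop two_ne_zero).comp tendsto_abs_atBot_atTop |>.congr fun x => by simp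

lemma tendsto_arctan_div_atTop_pos {b : ℝ} (hb : 0 < b) :
    Tendsto (fun x : ℝ => Real.arctan (x / b)) atTop (𝓝 (Real.pi / 2)) :=
  (tendsto_nhds_of_tendsto_nhdsWithin Real.tendsto_arctan_atTop).comp (tendsto_id.atTop_div_const hb)

lemma tendsto_arctan_div_atBot_pos {b : ℝ} (hb : 0 < b) :
    Tendsto (fun x : ℝ => Real.arctan (x / b)) atBot (𝓝 (-(Real.pi / 2))) :=
  (tendsto_nhds_of_tendsto_nhdsWithin Real.tendsto_arctan_atBot).comp (tendsto_id.atBot_div_const hb)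

lemma tendsto_arctan_div_atTop_neg {b : ℝ} (hb : b < 0) :
    Tendsto (fun x : ℝ => Real.arctan (x / b)) atTop (𝓝 (-(Real.pi / 2))) := by
  refine (tendsto_arctan_div_atTop_pos (neg_pos.mpr hb)).neg.congr fun x => ?_
  rw [← Real.arctan_neg]; congr 1; rw [div_neg, neg_neg]

lemma tendsto_arctan_div_atBot_neg {b : ℝ} (hb : b < 0) :
    Tendsto (fun x : ℝ => Real.arctan (x / b)) atBot (𝓝 (Real.pi / 2)) := by
  have := (tendsto_arctan_div_atBot_pos (neg_pos.mpr hb)).neg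
  rw [neg_neg] at this
  refine this.congr fun x => ?_
  rw [← Real.arctan_neg]; congr 1; rw [div_neg, neg_neg]

/-- An antiderivative is half a logarithm of a ratio minus i times a difference of arctangents. The
logarithm vanishes at both ends, so only the arctangents contribute. -/
lemma integral_inv_sub_inv_of_limits {b d p q : ℝ} (hb : b ≠ 0) (hd : d ≠ 0)
    (htop : Tendsto (fun x : ℝ => Real.arctan (x / b) - Real.arctan (x / d)) atTop (𝓝 p))
    (hbot : Tendsto (fun x : ℝ => Real.arctan (x / b) - Real.arctan (x / d)) atBot (𝓝 q)) :
    ∫ x : ℝ, (((x : ℂ) + b * Complex.I)⁻¹ - ((x : ℂ) + d * Complex.I)⁻¹)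
      = -Complex.I * (p - q) := by
  have H : ∀ {l : Filter ℝ} {r : ℝ}, Tendsto (fun x : ℝ => x ^ 2) l atTop →
      Tendsto (fun x : ℝ => Real.arctan (x / b) - Real.arctan (x / d)) l (𝓝 r) →
      Tendsto (fun x : ℝ => (((1 / 2) * (Real.log (x ^ 2 + b ^ 2) - Real.log (x ^ 2 + d ^ 2)) : ℝ) : ℂ)
        - Complex.I * ((Real.arctan (x / b) - Real.arctan (x / d) : ℝ) : ℂ)) l
        (𝓝 (((0 : ℝ) : ℂ) - Complex.I * (r : ℂ))) := by
    intro l r h1 h2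
    exact ((Complex.continuous_ofReal.tendsto _).comp (tendsto_log_ratio b d hb hd h1)).sub
      (((Complex.continuous_ofReal.tendsto _).comp h2).const_mul _)
  rw [integral_of_hasDerivAt_of_tendsto (fun x => ?_) (integrable_inv_sub_inv hb hd)
    (H tendsto_sq_atBot hbot) (H (tendsto_pow_atTop two_ne_zero) htop)]
  · push_cast; ring
  · have hD : ∀ e : ℝ, e ≠ 0 → HasDerivAt (fun x : ℝ => (1 / 2) * Real.log (x ^ 2 + e ^ 2))
        (x / (x ^ 2 + e ^ 2)) x := by
      intro e he
      have p1 : x ^ 2 + e ^ 2 ≠ 0 := by positivity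
      have := (((hasDerivAt_pow 2 x).add_const (e ^ 2)).log p1).const_mul (1 / 2)
      convert! this using 1
      simp; ring
    have hA : ∀ e : ℝ, e ≠ 0 → HasDerivAt (fun x : ℝ => Real.arctan (x / e))
        (e / (x ^ 2 + e ^ 2)) x := by
      intro e he
      have := ((hasDerivAt_id x).div_const e).arctan
      convert! this using 1
      simp only [id]
      have p1 : x ^ 2 + e ^ 2 ≠ 0 := by positivity
      have p2 : 1 + (x / e) ^ 2 ≠ 0 := by positivity
      field_simp
      ring
    have h1 := ((hD b hb).sub (hD d hd)).ofReal_comp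
    have h2 := (((hA b hb).sub (hA d hd)).ofReal_comp).const_mul Complex.I
    have h3 := h1.sub h2
    convert! h3 using 1
    · funext x
      simp only [Pi.sub_apply]
      push_cast
      ring
    · have inv : ∀ e : ℝ, e ≠ 0 → ((x : ℂ) + e * Complex.I)⁻¹
          = ((x / (x ^ 2 + e ^ 2) : ℝ) : ℂ) - Complex.I * ((e / (x ^ 2 + e ^ 2) : ℝ) : ℂ) := by
        intro e he
        have p : (x : ℂ) ^ 2 + (e : ℂ) ^ 2 ≠ 0 := by
          exact_mod_cast (by positivity : x ^ 2 + e ^ 2 ≠ 0)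
        refine inv_eq_of_mul_eq_one_right ?_
        push_cast
        field_simp
        linear_combination -(e : ℂ) ^ 2 * Complex.I_sq
      rw [inv b hb, inv d hd]
      push_cast
      ring

lemma integral_inv_sub_inv_neg_neg {b d : ℝ} (hb : b < 0) (hd : d < 0) :
    ∫ x : ℝ, (((x : ℂ) + b * Complex.I)⁻¹ - ((x : ℂ) + d * Complex.I)⁻¹) = 0 := by
  rw [integral_inv_sub_inv_of_limits hb.ne hd.ne
    ((tendsto_arctan_div_atTop_neg hb).sub (tendsto_arctan_div_atTop_neg hd))
    ((tendsto_arctan_div_atBot_neg hb).sub (tendsto_arctan_div_atBot_neg hd))]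
  push_cast; ring

lemma integral_inv_sub_inv_pos_neg {b d : ℝ} (hb : 0 < b) (hd : d < 0) :
    ∫ x : ℝ, (((x : ℂ) + b * Complex.I)⁻¹ - ((x : ℂ) + d * Complex.I)⁻¹)
      = -(2 * Real.pi * Complex.I) := by
  rw [integral_inv_sub_inv_of_limits hb.ne' hd.ne
    ((tendsto_arctan_div_atTop_pos hb).sub (tendsto_arctan_div_atTop_neg hd))
    ((tendsto_arctan_div_atBot_pos hb).sub (tendsto_arctan_div_atBot_neg hd))]
  push_cast; ring

/-- Moving a horizontal line across a simple pole. -/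
lemma lineIntegral_sub_eq_residue {f : ℂ → ℂ} {b₁ b₂ : ℝ} {ξ r : ℂ} (h1 : b₁ < ξ.im) (h2 : ξ.im < b₂)
    {e : ℝ} (he : 0 < e)
    (hf : ∀ z : ℂ, b₁ - e < z.im → z.im < b₂ + e → z ≠ ξ → DifferentiableAt ℂ f z)
    (hr : Tendsto (fun z => (z - ξ) * f z) (𝓝[≠] ξ) (𝓝 r))
    (i₁ : LineIntegrable f b₁) (i₂ : LineIntegrable f b₂)
    (hdec : ∀ ε : ℝ, 0 < ε → ∃ X : ℝ, ∀ x b : ℝ, X ≤ |x| → b₁ ≤ b → b ≤ b₂ →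
      ‖f (linePt b x)‖ ≤ ε) :
    lineIntegral f b₁ - lineIntegral f b₂ = 2 * Real.pi * Complex.I * r := by
  -- The comparison function `g` has residue 1 at ξ and an auxiliary pole at height b₂ + e + 1,
  -- above the enlarged strip; the second pole only serves to make `g` integrable on lines.
  set K : ℝ := b₂ - ξ.im + e + 1 with hK
  set g : ℂ → ℂ := fun z => (z - ξ)⁻¹ - (z - ξ - K * Complex.I)⁻¹ with hg
  set h : ℂ → ℂ := fun z => f z - r * g z with hh
  set s : Set ℂ := {z | b₁ - e < z.im ∧ z.im < b₂ + e} with hs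
  have so : IsOpen s := (isOpen_lt continuous_const Complex.continuous_im).inter
    (isOpen_lt Complex.continuous_im continuous_const)
  have hξs : ξ ∈ s := ⟨by linarith, by linarith⟩
  have hKne : ∀ z ∈ s, z - ξ - K * Complex.I ≠ 0 := by
    intro z hz h0
    have := congrArg Complex.im h0
    simp at this
    have := hz.2
    linarith
  have hd : DifferentiableOn ℂ h (s \ {ξ}) := by
    intro z hz
    have d1 := hf z hz.1.1 hz.1.2 hz.2
    have n1 : z - ξ ≠ 0 := sub_ne_zero.mpr hz.2
    have n2 := hKne z hz.1
    refine (d1.sub (DifferentiableAt.const_mul (DifferentiableAt.sub ?_ ?_) r)).differentiableWithinAt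
    · exact (differentiableAt_id.sub_const ξ).inv n1
    · exact ((differentiableAt_id.sub_const ξ).sub_const _).inv n2
  have hlim : Tendsto (fun z => (z - ξ) * h z) (𝓝[≠] ξ) (𝓝 0) := by
    have t1 : Tendsto (fun z => r * (1 - (z - ξ) * (z - ξ - K * Complex.I)⁻¹)) (𝓝[≠] ξ) (𝓝 (r * (1 - 0))) := by
      refine Tendsto.const_mul _ (Tendsto.const_sub _ ?_)
      have : ContinuousAt (fun z : ℂ => (z - ξ) * (z - ξ - K * Complex.I)⁻¹) ξ := by
        refine ContinuousAt.mul (by fun_prop) (ContinuousAt.inv₀ (by fun_prop) (hKne ξ hξs))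
      have := this.tendsto
      simp only [sub_self, zero_mul] at this
      exact this.mono_left nhdsWithin_le_nhds
    have t2 := hr.sub t1
    rw [sub_zero, mul_one, sub_self] at t2
    refine t2.congr' ?_
    filter_upwards [self_mem_nhdsWithin] with z hz
    have n1 : z - ξ ≠ 0 := sub_ne_zero.mpr hz
    simp only [hh, hg]
    field_simp
  have ho : (fun z => h z - h ξ) =o[𝓝[≠] ξ] fun z => (z - ξ)⁻¹ := by
    rw [Asymptotics.isLittleO_iff_tendsto']
    · have t3 : Tendsto (fun z => (z - ξ) * h ξ) (𝓝[≠] ξ) (𝓝 0) := by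
        have : ContinuousAt (fun z : ℂ => (z - ξ) * h ξ) ξ := by fun_prop
        have := this.tendsto
        simp only [sub_self, zero_mul] at this
        exact this.mono_left nhdsWithin_le_nhds
      have := hlim.sub t3
      rw [sub_zero] at this
      refine this.congr fun z => ?_
      rw [div_inv_eq_mul]; ring
    · filter_upwards [self_mem_nhdsWithin] with z hz hz0
      exact absurd (inv_eq_zero.mp hz0) (sub_ne_zero.mpr hz)
  -- Subtracting r·g cancels the pole, so the singularity is removable and Cauchy's theorem on the
  -- strip applies to the corrected function `H`.
  have hu := Complex.differentiableOn_update_limUnder_of_isLittleO (so.mem_nhds hξs) hd ho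
  set H := Function.update h ξ (limUnder (𝓝[≠] ξ) h) with hH
  have hline : ∀ b x : ℝ, b ≠ ξ.im → H (linePt b x) = h (linePt b x) := by
    intro b x hb
    rw [hH, Function.update_of_ne]
    intro h0
    exact hb (by rw [← h0, linePt_im])
  have hgl : ∀ b x : ℝ, g (linePt b x) = (((x - ξ.re : ℝ) : ℂ) + (b - ξ.im : ℝ) * Complex.I)⁻¹
      - (((x - ξ.re : ℝ) : ℂ) + (b - ξ.im - K : ℝ) * Complex.I)⁻¹ := by
    intro b x
    simp only [hg, linePt]
    congr 2
    · apply Complex.ext <;> simp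
    · apply Complex.ext <;> simp
  have hgi : ∀ b : ℝ, b - ξ.im ≠ 0 → b - ξ.im - K ≠ 0 → LineIntegrable g b := by
    intro b hb hb'
    refine ((integrable_inv_sub_inv hb hb').comp_sub_right ξ.re).congr (Eventually.of_forall fun x => ?_)
    simp only [hgl]
  have hgint : ∀ b : ℝ, lineIntegral g b = ∫ x : ℝ, (((x : ℂ) + (b - ξ.im : ℝ) * Complex.I)⁻¹
      - ((x : ℂ) + (b - ξ.im - K : ℝ) * Complex.I)⁻¹) := by
    intro b
    rw [← integral_sub_right_eq_self _ ξ.re]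
    simp only [lineIntegral, hgl]
  have g1 : lineIntegral g b₁ = 0 := by
    rw [hgint, integral_inv_sub_inv_neg_neg (by linarith) (by linarith)]
  have g2 : lineIntegral g b₂ = -(2 * Real.pi * Complex.I) := by
    rw [hgint, integral_inv_sub_inv_pos_neg (by linarith) (by linarith)]
  have gi1 := hgi b₁ (by linarith) (by linarith)
  have gi2 := hgi b₂ (by linarith) (by linarith)
  have hHi : ∀ b : ℝ, b ≠ ξ.im → LineIntegrable f b → LineIntegrable g b → LineIntegrable H b ∧
      lineIntegral H b = lineIntegral f b - r * lineIntegral g b := by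
    intro b hb fi gi
    have e : (fun x => H (linePt b x)) = fun x => f (linePt b x) - r * g (linePt b x) := by
      funext x; rw [hline b x hb]
    refine ⟨?_, ?_⟩
    · unfold LineIntegrable; rw [e]; exact Integrable.sub fi (Integrable.const_mul gi r)
    · unfold lineIntegral
      rw [e, integral_sub fi (Integrable.const_mul gi r), integral_const_mul]
  obtain ⟨I1, E1⟩ := hHi b₁ h1.ne i₁ gi1
  obtain ⟨I2, E2⟩ := hHi b₂ h2.ne' i₂ gi2
  have fin := lineIntegral_eq_of_differentiableAt (f := H) (h1.trans h2).le
    (fun z z1 z2 => hu.differentiableAt (so.mem_nhds ⟨by linarith, by linarith⟩)) I1 I2 ?_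
  · rw [E1, E2, g1, g2] at fin
    linear_combination fin
  · intro ε hε
    obtain ⟨X, hX⟩ := hdec (ε / 2) (by positivity)
    set M := 4 * (‖r‖ + 1) / ε with hM
    have hM0 : 0 < M := by positivity
    refine ⟨max X (|ξ.re| + M), fun x b hx hb1 hb2 => ?_⟩
    have hx1 : X ≤ |x| := (le_max_left _ _).trans hx
    have hx2 : M ≤ |x - ξ.re| := by
      have := (le_max_right _ _).trans hx
      have := abs_sub_abs_le_abs_sub x ξ.re
      linarith
    have hne : linePt b x ≠ ξ := by
      intro h0
      have : x = ξ.re := by rw [← h0, linePt_re]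
      rw [this, sub_self, abs_zero] at hx2
      linarith
    rw [hH, Function.update_of_ne hne]
    have inv_le : ∀ d : ℝ, ‖(((x - ξ.re : ℝ) : ℂ) + (d : ℝ) * Complex.I)⁻¹‖ ≤ M⁻¹ := by
      intro d
      rw [norm_inv]
      refine inv_anti₀ hM0 (hx2.trans ?_)
      have := Complex.abs_re_le_norm (((x - ξ.re : ℝ) : ℂ) + (d : ℝ) * Complex.I)
      simpa using this
    have hgb : ‖g (linePt b x)‖ ≤ 2 * M⁻¹ := by
      rw [hgl]
      refine (norm_sub_le _ _).trans ?_
      linarith [inv_le (b - ξ.im), inv_le (b - ξ.im - K)]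
    calc ‖h (linePt b x)‖ ≤ ‖f (linePt b x)‖ + ‖r * g (linePt b x)‖ := norm_sub_le _ _
      _ ≤ ε / 2 + ‖r‖ * (2 * M⁻¹) := by
          rw [norm_mul]; gcongr; exact hX x b hx1 hb1 hb2
      _ ≤ ε := by
          have : ‖r‖ * (2 * M⁻¹) = ε / 2 * (‖r‖ / (‖r‖ + 1)) := by
            rw [hM]; field_simp; ring
          have h1 : ‖r‖ / (‖r‖ + 1) ≤ 1 := (div_le_one (by positivity)).mpr (by linarith)
          rw [this]
          nlinarith

/-- Differentiation under the integral sign for a holomorphic integrand with an integrable bound. -/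
lemma hasDerivAt_integral_of_norm_le {F : ℂ → ℝ → ℂ} {z₀ : ℂ} {r : ℝ} (hr : 0 < r) {g : ℝ → ℝ}
    (hg : Integrable g) (hm : ∀ z ∈ Metric.ball z₀ r, AEStronglyMeasurable (F z))
    (hd : ∀ x, DifferentiableOn ℂ (F · x) (Metric.ball z₀ r))
    (hb : ∀ z ∈ Metric.ball z₀ r, ∀ x, ‖F z x‖ ≤ g x) :
    Integrable (fun x => deriv (F · x) z₀) ∧
      HasDerivAt (fun z => ∫ x, F z x) (∫ x, deriv (F · x) z₀) z₀ := by
  have hda : ∀ x, ∀ z ∈ Metric.ball z₀ r, HasDerivAt (F · x) (deriv (F · x) z) z :=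
    fun x z hz => ((hd x).differentiableAt (Metric.isOpen_ball.mem_nhds hz)).hasDerivAt
  have hsub : Metric.ball z₀ (r / 2) ⊆ Metric.ball z₀ r := Metric.ball_subset_ball (by linarith)
  refine hasDerivAt_integral_of_dominated_loc_of_deriv_le (F' := fun z x => deriv (F · x) z)
    (bound := fun x => g x / (r / 4)) (Metric.ball_mem_nhds z₀ (half_pos hr))
    ?_ ?_ ?_ ?_ (hg.div_const _) (Eventually.of_forall fun x z hz => hda x z (hsub hz))
  · filter_upwards [Metric.ball_mem_nhds z₀ hr] with z hz using hm z hz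
  · exact hg.mono' (hm z₀ (Metric.mem_ball_self hr))
      (Eventually.of_forall fun x => hb z₀ (Metric.mem_ball_self hr) x)
  -- Measurability of the derivative in x: it is the pointwise limit of difference quotients along a
  -- sequence of increments that stay in the ball.
  · set u : ℕ → ℂ := fun n => ((r / (2 * ((n : ℝ) + 1)) : ℝ) : ℂ) with hu
    have hupos : ∀ n : ℕ, 0 < r / (2 * ((n : ℝ) + 1)) := fun n => by positivity
    have hune : ∀ n, u n ≠ 0 := fun n => by
      simp only [hu]; exact Complex.ofReal_ne_zero.mpr (hupos n).ne'
    have hu0 : Tendsto u atTop (𝓝 0) := by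
      have : Tendsto (fun n : ℕ => (r / 2) * (1 / ((n : ℝ) + 1))) atTop (𝓝 ((r / 2) * 0)) :=
        tendsto_one_div_add_atTop_nhds_zero_nat.const_mul _
      rw [mul_zero] at this
      have := (Complex.continuous_ofReal.tendsto 0).comp this
      simp only [Complex.ofReal_zero] at this
      refine this.congr fun n => ?_
      simp only [Function.comp, hu]
      congr 1
      field_simp
    have hball : ∀ n, z₀ + u n ∈ Metric.ball z₀ r := fun n => by
      rw [Metric.mem_ball, dist_eq_norm, add_sub_cancel_left, hu, Complex.norm_real,
        Real.norm_of_nonneg (hupos n).le, div_lt_iff₀ (by positivity)]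
      nlinarith [(Nat.cast_nonneg n : (0 : ℝ) ≤ n)]
    refine aestronglyMeasurable_of_tendsto_ae atTop
      (f := fun n x => (u n)⁻¹ * (F (z₀ + u n) x - F z₀ x)) (fun n => ?_) ?_
    · exact ((hm _ (hball n)).sub (hm z₀ (Metric.mem_ball_self hr))).const_mul _
    · refine Eventually.of_forall fun x => ?_
      have h := (hda x z₀ (Metric.mem_ball_self hr)).tendsto_slope_zero
      have hu' : Tendsto u atTop (𝓝[≠] 0) := tendsto_nhdsWithin_iff.mpr
        ⟨hu0, Eventually.of_forall fun n => hune n⟩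
      simpa [smul_eq_mul, Function.comp_def] using h.comp hu'
  · refine Eventually.of_forall fun x z hz => ?_
    -- Cauchy's estimate on a circle of radius r/4 about a point at distance less than r/2 from the
    -- centre; the circle stays inside the ball of radius r.
    refine Complex.norm_deriv_le_of_forall_mem_sphere_norm_le (by positivity) ?_ fun w hw => ?_
    · refine DifferentiableOn.diffContOnCl ((hd x).mono ?_)
      refine Metric.closure_ball_subset_closedBall.trans fun w hw => ?_
      rw [Metric.mem_ball] at hz ⊢
      rw [Metric.mem_closedBall] at hw
      linarith [dist_triangle w z z₀]
    · refine hb w ?_ x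
      rw [Metric.mem_ball] at hz ⊢
      rw [Metric.mem_sphere] at hw
      linarith [dist_triangle w z z₀]

end WienerHopf

/-! ### The quotient Γ(w+1/2)/Γ(w) and its logarithm. -/

namespace WienerHopf
open MeasureTheory Set

/-- The quotient `Γ(w+1/2)² / (Γ(w) Γ(w+1))`. -/
noncomputable def gammaQuot (w : ℂ) : ℂ :=
  Complex.Gamma (w + 1 / 2) ^ 2 / (Complex.Gamma w * Complex.Gamma (w + 1))

/-- In Gauss's limit formula the factorials and powers of n cancel, because 2(w + 1/2) = w + (w +
1). What remains are the factors (w+j)(w+1+j)/(w+1/2+j)². -/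
lemma tendsto_prod_gammaQuot {w : ℂ} (hw : 0 < w.re) :
    Tendsto (fun n : ℕ => ∏ j ∈ Finset.range (n + 1), (1 + -(1 / (4 * (w + 1 / 2 + j) ^ 2))))
      atTop (𝓝 (gammaQuot w)) := by
  have hG : Complex.Gamma w ≠ 0 := Complex.Gamma_ne_zero_of_re_pos hw
  have hG1 : Complex.Gamma (w + 1) ≠ 0 := Complex.Gamma_ne_zero_of_re_pos (by simp; linarith)
  have h := ((Complex.GammaSeq_tendsto_Gamma (w + 1 / 2)).pow 2).div
    ((Complex.GammaSeq_tendsto_Gamma w).mul (Complex.GammaSeq_tendsto_Gamma (w + 1)))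
    (mul_ne_zero hG hG1)
  refine h.congr' ?_
  filter_upwards [eventually_ne_atTop 0] with n hn
  have hne : ∀ (e : ℂ) (j : ℕ), 0 ≤ e.re → w + e + j ≠ 0 := by
    intro e j he h0
    have := congrArg Complex.re h0
    simp at this
    have : (0 : ℝ) ≤ j := Nat.cast_nonneg j
    linarith
  have hp : ∀ e : ℂ, 0 ≤ e.re → ∏ j ∈ Finset.range (n + 1), (w + e + j) ≠ 0 :=
    fun e he => Finset.prod_ne_zero_iff.mpr fun j _ => hne e j he
  have p0 := hp 0 (by simp)
  have p1 := hp 1 (by simp)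
  have p2 := hp (1 / 2) (by norm_num)
  simp only [add_zero] at p0
  have hn' : (n : ℂ) ≠ 0 := Nat.cast_ne_zero.mpr hn
  have hf : ((n.factorial : ℕ) : ℂ) ≠ 0 := Nat.cast_ne_zero.mpr n.factorial_ne_zero
  have hpow : ((n : ℂ) ^ (w + 1 / 2)) ^ 2 = (n : ℂ) ^ w * (n : ℂ) ^ (w + 1) := by
    rw [sq, ← Complex.cpow_add _ _ hn', ← Complex.cpow_add _ _ hn']
    congr 1; ring
  have hc1 : (n : ℂ) ^ w ≠ 0 := by simp [Complex.cpow_eq_zero_iff, hn']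
  have hc2 : (n : ℂ) ^ (w + 1) ≠ 0 := by simp [Complex.cpow_eq_zero_iff, hn']
  have e : ∏ j ∈ Finset.range (n + 1), (1 + -(1 / (4 * (w + 1 / 2 + j) ^ 2)))
      = (∏ j ∈ Finset.range (n + 1), (w + j)) * (∏ j ∈ Finset.range (n + 1), (w + 1 + j))
        / (∏ j ∈ Finset.range (n + 1), (w + 1 / 2 + j)) ^ 2 := by
    rw [← Finset.prod_mul_distrib, ← Finset.prod_pow, ← Finset.prod_div_distrib]
    refine Finset.prod_congr rfl fun j _ => ?_
    have := hne (1 / 2) j (by norm_num)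
    rw [eq_div_iff (pow_ne_zero 2 this)]
    have key : ∀ u : ℂ, u ≠ 0 → 1 / (4 * u ^ 2) * u ^ 2 = 1 / 4 := fun u hu => by field_simp
    linear_combination -key _ this
  simp only [Pi.div_apply, Complex.GammaSeq]
  rw [e, div_pow, mul_pow, hpow]
  field_simp

/-- A product of factors 1 + a_j differs from 1 by at most exp(Σ|a_j|) - 1. The hypothesis bounds
the sum by a telescoping one, since 1/((j+t)(j+t+1)) = 1/(j+t) - 1/(j+t+1). -/
lemma norm_gammaQuot_sub_one_le_of_lower {w : ℂ} (hw : 0 < w.re) {k t : ℝ} (hk : 0 < k) (ht : 0 < t)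
    (h : ∀ j : ℕ, k * ((j + t) * (j + t + 1)) ≤ ‖w + 1 / 2 + j‖ ^ 2) :
    ‖gammaQuot w - 1‖ ≤ Real.exp (1 / (4 * k * t)) - 1 := by
  refine le_of_tendsto ((tendsto_prod_gammaQuot hw).sub_const 1).norm (Eventually.of_forall fun n => ?_)
  refine (Finset.norm_prod_one_add_sub_one_le _ _).trans ?_
  gcongr
  have hs : ∀ m : ℕ, ∑ j ∈ Finset.range m, ‖-(1 / (4 * (w + 1 / 2 + (j : ℂ)) ^ 2))‖
      ≤ 1 / (4 * k) * (1 / t - 1 / (m + t)) := by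
    intro m
    induction m with
    | zero => simp
    | succ m ih =>
      rw [Finset.sum_range_succ]
      have hm : (0 : ℝ) ≤ m := Nat.cast_nonneg m
      have hpos : 0 < k * ((m + t) * (m + t + 1)) := by positivity
      have b : ‖-(1 / (4 * (w + 1 / 2 + (m : ℂ)) ^ 2))‖ ≤ 1 / (4 * (k * ((m + t) * (m + t + 1)))) := by
        rw [norm_neg, norm_div, norm_one, norm_mul, norm_pow]
        have n4 : ‖(4 : ℂ)‖ = 4 := by norm_num
        rw [n4]
        exact one_div_le_one_div_of_le (by positivity) (by have := h m; linarith)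
      refine (add_le_add ih b).trans (le_of_eq ?_)
      push_cast
      have : (m : ℝ) + t ≠ 0 := by positivity
      have : (m : ℝ) + 1 + t ≠ 0 := by positivity
      have : (m : ℝ) + t + 1 ≠ 0 := by positivity
      field_simp
      ring
  refine (hs (n + 1)).trans ?_
  have : 0 < 1 / (((n + 1 : ℕ) : ℝ) + t) := by positivity
  calc 1 / (4 * k) * (1 / t - 1 / (((n + 1 : ℕ) : ℝ) + t)) ≤ 1 / (4 * k) * (1 / t) := by
        gcongr; linarith
    _ = 1 / (4 * k * t) := by field_simp

/-- The telescoping bound with k = 1, t = 1/2 gives e^{1/2} - 1 < 13/20. Being below 1, this keeps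
the quotient in the right half plane, where the principal logarithm is holomorphic. -/
lemma norm_gammaQuot_sub_one_le {w : ℂ} (hw : 1 / 2 < w.re) :
    ‖gammaQuot w - 1‖ ≤ 13 / 20 := by
  refine (norm_gammaQuot_sub_one_le_of_lower (by linarith) one_pos (t := 1 / 2) (by norm_num)
    fun j => ?_).trans ?_
  · have h := Complex.abs_re_le_norm (w + 1 / 2 + j)
    have hj : (0 : ℝ) ≤ j := Nat.cast_nonneg j
    have e : (w + 1 / 2 + j).re = w.re + 1 / 2 + j := by simp
    rw [e, abs_of_pos (by linarith)] at h
    nlinarith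
  · have h1 := Real.exp_one_lt_d9
    have h2 : Real.exp (1 / 2) ^ 2 = Real.exp 1 := by rw [← Real.exp_nat_mul]; norm_num
    have h3 := Real.exp_pos (1 / 2)
    norm_num
    nlinarith

/-- The telescoping bound with k = 1/2, t = |Im w|: the quotient tends to 1 far from the real axis.
-/
lemma norm_gammaQuot_sub_one_le_im {w : ℂ} (hw : 1 / 2 < w.re) (hy : w.im ≠ 0) :
    ‖gammaQuot w - 1‖ ≤ Real.exp (1 / (2 * |w.im|)) - 1 := by
  have hy' : 0 < |w.im| := abs_pos.mpr hy
  refine (norm_gammaQuot_sub_one_le_of_lower (by linarith) (k := 1 / 2) (by norm_num) hy'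
    fun j => ?_).trans (le_of_eq (by congr 2; ring))
  rw [← Complex.normSq_eq_norm_sq, Complex.normSq_apply]
  have hj : (0 : ℝ) ≤ j := Nat.cast_nonneg j
  have e : (w + 1 / 2 + j).re = w.re + 1 / 2 + j := by simp
  have e' : (w + 1 / 2 + j).im = w.im := by simp
  rw [e, e']
  have hs : w.im * w.im = |w.im| * |w.im| := (abs_mul_abs_self _).symm
  rw [hs]
  nlinarith [sq_nonneg ((j : ℝ) + 1 - |w.im|)]

lemma differentiableAt_gammaQuot {w : ℂ} (hw : 0 < w.re) : DifferentiableAt ℂ gammaQuot w := by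
  have hd : ∀ s : ℂ, 0 < s.re → DifferentiableAt ℂ Complex.Gamma s := by
    intro s hs
    refine Complex.differentiableAt_Gamma s fun m h0 => ?_
    rw [h0] at hs
    simp at hs
    linarith [(Nat.cast_nonneg m : (0 : ℝ) ≤ m)]
  have r1 : 0 < (w + 1 / 2).re := by simp; linarith
  have r2 : 0 < (w + 1).re := by simp; linarith
  have d1 : DifferentiableAt ℂ (fun w => Complex.Gamma (w + 1 / 2)) w :=
    (hd _ r1).comp w (by fun_prop)
  have d2 : DifferentiableAt ℂ (fun w => Complex.Gamma (w + 1)) w :=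
    (hd _ r2).comp w (by fun_prop)
  exact (d1.pow 2).div ((hd w hw).mul d2) (mul_ne_zero (Complex.Gamma_ne_zero_of_re_pos hw)
    (Complex.Gamma_ne_zero_of_re_pos r2))

lemma gammaQuot_re_pos {w : ℂ} (hw : 1 / 2 < w.re) : 0 < (gammaQuot w).re := by
  have h := norm_gammaQuot_sub_one_le hw
  have h2 := (Complex.abs_re_le_norm (gammaQuot w - 1)).trans h
  rw [abs_le] at h2
  simp at h2
  linarith [h2.1]

/-- `log (Γ(w+1/2)/Γ(w))` on a right half plane. -/
noncomputable def logGammaRatio (w : ℂ) : ℂ :=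
  1 / 2 * Complex.log w + 1 / 2 * Complex.log (gammaQuot w)

lemma mem_slitPlane_of_re_pos {w : ℂ} (hw : 0 < w.re) : w ∈ Complex.slitPlane := Or.inl hw

lemma differentiableAt_logGammaRatio {w : ℂ} (hw : 1 / 2 < w.re) :
    DifferentiableAt ℂ logGammaRatio w := by
  have h0 : 0 < w.re := by linarith
  exact ((Complex.differentiableAt_log (mem_slitPlane_of_re_pos h0)).const_mul _).add
    (((differentiableAt_gammaQuot h0).clog (mem_slitPlane_of_re_pos (gammaQuot_re_pos hw))).const_mul _)

/-- Both sides are continuous and have equal squares, by Γ(w+1) = wΓ(w). On a connected half plane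
two such functions agree as soon as they agree at one point; at w = 1 both are the positive root. -/
lemma exp_logGammaRatio {w : ℂ} (hw : 1 / 2 < w.re) :
    Complex.exp (logGammaRatio w) = Complex.Gamma (w + 1 / 2) / Complex.Gamma w := by
  have hS : IsPreconnected {w : ℂ | 1 / 2 < w.re} :=
    (convex_halfSpace_re_gt (1 / 2)).isPreconnected
  have hsq : ∀ w : ℂ, 1 / 2 < w.re →
      Complex.exp (logGammaRatio w) ^ 2 = (Complex.Gamma (w + 1 / 2) / Complex.Gamma w) ^ 2 := by
    intro w hw
    have h0 : 0 < w.re := by linarith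
    have hw0 : w ≠ 0 := fun h => by rw [h] at h0; simp at h0
    have hq0 : gammaQuot w ≠ 0 := fun h => by have := gammaQuot_re_pos hw; rw [h] at this; simp at this
    rw [← Complex.exp_nat_mul]
    have : ((2 : ℕ) : ℂ) * logGammaRatio w = Complex.log w + Complex.log (gammaQuot w) := by
      unfold logGammaRatio; push_cast; ring
    rw [this, Complex.exp_add, Complex.exp_log hw0, Complex.exp_log hq0, gammaQuot,
      Complex.Gamma_add_one w hw0]
    have := Complex.Gamma_ne_zero_of_re_pos h0
    field_simp
  have hval : Complex.exp (logGammaRatio 1) = Complex.Gamma (1 + 1 / 2) / Complex.Gamma 1 := by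
    have e1 : Complex.Gamma (1 + 1 / 2) / Complex.Gamma 1 = ((Real.Gamma (3 / 2) : ℝ) : ℂ) := by
      rw [Complex.Gamma_one, div_one, ← Complex.Gamma_ofReal]; congr 1; push_cast; norm_num
    have hg : 0 < Real.Gamma (3 / 2) := Real.Gamma_pos_of_pos (by norm_num)
    have e2 : gammaQuot 1 = ((Real.Gamma (3 / 2) ^ 2 : ℝ) : ℂ) := by
      rw [gammaQuot, Complex.Gamma_add_one 1 one_ne_zero, Complex.Gamma_one]
      rw [Complex.Gamma_one, div_one] at e1
      rw [e1]; push_cast; ring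
    rw [e1, logGammaRatio, e2, Complex.log_one, mul_zero, zero_add, ← Complex.ofReal_log (by positivity),
      Real.log_pow]
    have : (1 / 2 : ℂ) * (((2 : ℕ) * Real.log (Real.Gamma (3 / 2)) : ℝ) : ℂ)
        = ((Real.log (Real.Gamma (3 / 2)) : ℝ) : ℂ) := by push_cast; ring
    rw [this, ← Complex.ofReal_exp, Real.exp_log hg]
  have hc : ContinuousOn (fun w => Complex.exp (logGammaRatio w)) {w : ℂ | 1 / 2 < w.re} :=
    fun w hw => (differentiableAt_logGammaRatio hw).continuousAt.cexp.continuousWithinAt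
  have hd : ∀ s : ℂ, 0 < s.re → DifferentiableAt ℂ Complex.Gamma s := by
    intro s hs
    refine Complex.differentiableAt_Gamma s fun m h0 => ?_
    rw [h0] at hs
    simp at hs
    linarith [(Nat.cast_nonneg m : (0 : ℝ) ≤ m)]
  have hc2 : ContinuousOn (fun w => Complex.Gamma (w + 1 / 2) / Complex.Gamma w)
      {w : ℂ | 1 / 2 < w.re} := by
    intro w hw
    have h0 : 0 < w.re := by simp only [mem_ofPred_eq] at hw; linarith
    have r1 : 0 < (w + 1 / 2).re := by simp; linarith
    exact (ContinuousAt.div ((hd _ r1).continuousAt.comp (f := fun w => w + 1 / 2) (by fun_prop))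
      (hd w h0).continuousAt (Complex.Gamma_ne_zero_of_re_pos h0)).continuousWithinAt
  refine hS.eq_of_sq_eq hc hc2 (fun w hw => hsq w hw) (fun {w} hw => ?_) (y := 1) (by simp; norm_num)
    hval hw
  have h0 : 0 < w.re := by simp only [mem_ofPred_eq] at hw; linarith
  exact div_ne_zero (Complex.Gamma_ne_zero_of_re_pos (by simp; linarith))
    (Complex.Gamma_ne_zero_of_re_pos h0)

lemma norm_log_gammaQuot_le {w : ℂ} (hw : 1 / 2 < w.re) : ‖Complex.log (gammaQuot w)‖ ≤ 2 := by
  have h := norm_gammaQuot_sub_one_le hw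
  have h2 := Complex.norm_log_one_add_le (z := gammaQuot w - 1) (by linarith)
  rw [add_sub_cancel] at h2
  refine h2.trans ?_
  set u := ‖gammaQuot w - 1‖
  have hu : 0 ≤ u := norm_nonneg _
  have h3 : (1 - u)⁻¹ ≤ (7 / 20)⁻¹ := inv_anti₀ (by norm_num) (by linarith)
  have h4 : u ^ 2 ≤ 1 / 2 := by nlinarith
  have h5 : 0 ≤ (1 - u)⁻¹ := inv_nonneg.mpr (by linarith)
  have h6 : u ^ 2 * (1 - u)⁻¹ ≤ 1 / 2 * (7 / 20)⁻¹ := mul_le_mul h4 h3 h5 (by norm_num)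
  norm_num at h6 ⊢
  linarith

end WienerHopf

/-! ### The logarithm of -Φ: formula, size, slow variation, uniqueness of the branch. -/

namespace WienerHopf
open MeasureTheory Set

/-- The variable `z = iη + (λ+1)/2`, in which `-Φ(η) = 2√π Γ(z+1/2)/Γ(z)`. -/
noncomputable def gammaVar (lam : ℝ) (η : ℂ) : ℂ := Complex.I * η + (lam + 1) / 2

lemma gammaVar_re (lam : ℝ) (η : ℂ) : (gammaVar lam η).re = (lam + 1) / 2 - η.im := by
  simp [gammaVar]; ring

lemma gammaVar_im (lam : ℝ) (η : ℂ) : (gammaVar lam η).im = η.re := by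
  simp [gammaVar]

/-- The bounded part of the logarithm of `-Φ`. -/
noncomputable def ellRem (lam : ℝ) (η : ℂ) : ℂ :=
  (Real.log (2 * Real.sqrt Real.pi) : ℂ) + 1 / 2 * Complex.log (gammaQuot (gammaVar lam η + 2))
    + Complex.log ((gammaVar lam η + 1) / (gammaVar lam η + 3 / 2))
    + Complex.log (gammaVar lam η / (gammaVar lam η + 1 / 2))

/-- The holomorphic logarithm of `-Φ` on the strip `(2+λ)/2 < Im η < (3+λ)/2`. -/
noncomputable def ell (lam : ℝ) (η : ℂ) : ℂ :=
  1 / 2 * Complex.log (gammaVar lam η + 2) + ellRem lam η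

/-- The strip on which the contours lie. -/
def stripU (lam : ℝ) : Set ℂ := {η | (2 + lam) / 2 < η.im ∧ η.im < (3 + lam) / 2}

lemma div_re_pos {p q : ℂ} (h : 0 < p.re * q.re) (h' : 0 ≤ p.im * q.im) : 0 < (p / q).re := by
  have hq : q ≠ 0 := fun h0 => by rw [h0] at h; simp at h
  rw [Complex.div_re, ← add_div]
  exact div_pos (by linarith) (Complex.normSq_pos.mpr hq)

lemma gammaVar_re_bounds {lam : ℝ} {η : ℂ} (h : η ∈ stripU lam) :
    -1 < (gammaVar lam η).re ∧ (gammaVar lam η).re < -(1 / 2) := by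
  rw [gammaVar_re]
  constructor <;> linarith [h.1, h.2]

/-- Numerator and denominator have the same imaginary part and real parts of the same sign. The
linear factors are paired in this way so that each quotient avoids the cut of the logarithm. -/
lemma first_quot_re_pos {lam : ℝ} {η : ℂ} (h : η ∈ stripU lam) :
    0 < ((gammaVar lam η + 1) / (gammaVar lam η + 3 / 2)).re := by
  obtain ⟨h1, h2⟩ := gammaVar_re_bounds h
  refine div_re_pos ?_ ?_
  · simp only [Complex.add_re, Complex.one_re, Complex.div_ofNat_re, Complex.re_ofNat]
    apply mul_pos <;> linarith
  · simp only [Complex.add_im, Complex.one_im, Complex.div_ofNat_im, Complex.im_ofNat]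
    nlinarith [sq_nonneg (gammaVar lam η).im]

lemma second_quot_re_pos {lam : ℝ} {η : ℂ} (h : η ∈ stripU lam) :
    0 < (gammaVar lam η / (gammaVar lam η + 1 / 2)).re := by
  obtain ⟨h1, h2⟩ := gammaVar_re_bounds h
  refine div_re_pos ?_ ?_
  · simp only [Complex.add_re, Complex.one_re, Complex.div_ofNat_re]
    apply mul_pos_of_neg_of_neg <;> linarith
  · simp only [Complex.add_im, Complex.one_im, Complex.div_ofNat_im]
    nlinarith [sq_nonneg (gammaVar lam η).im]

lemma gammaVar_add_ne_zero {lam : ℝ} {η : ℂ} {t : ℝ} (h : (gammaVar lam η).re + t ≠ 0) :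
    gammaVar lam η + t ≠ 0 := by
  intro h0
  have := congrArg Complex.re h0
  simp at this
  exact h this

lemma gammaVar_factors_ne_zero {lam : ℝ} {η : ℂ} (h : η ∈ stripU lam) :
    gammaVar lam η ≠ 0 ∧ gammaVar lam η + 1 / 2 ≠ 0 ∧ gammaVar lam η + 1 ≠ 0 ∧
      gammaVar lam η + 3 / 2 ≠ 0 := by
  obtain ⟨h1, h2⟩ := gammaVar_re_bounds h
  refine ⟨?_, ?_, ?_, ?_⟩
  · simpa using gammaVar_add_ne_zero (t := 0) (by linarith)
  · simpa using gammaVar_add_ne_zero (t := 1 / 2) (by linarith)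
  · simpa using gammaVar_add_ne_zero (t := 1) (by linarith)
  · simpa using gammaVar_add_ne_zero (lam := lam) (η := η) (t := 3 / 2) (by linarith)

lemma gammaVar_add_two_re {lam : ℝ} {η : ℂ} (h : η ∈ stripU lam) :
    1 / 2 < (gammaVar lam η + 2).re := by
  have := (gammaVar_re_bounds h).1
  simp only [Complex.add_re, Complex.re_ofNat]
  linarith

lemma differentiable_gammaVar (lam : ℝ) : Differentiable ℂ (gammaVar lam) := by
  unfold gammaVar; fun_prop

lemma differentiableAt_ell {lam : ℝ} {η : ℂ} (h : η ∈ stripU lam) :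
    DifferentiableAt ℂ (ell lam) η := by
  obtain ⟨n1, n2, n3, n4⟩ := gammaVar_factors_ne_zero h
  have hg := differentiable_gammaVar lam η
  have hw := gammaVar_add_two_re h
  have d1 : DifferentiableAt ℂ (fun η => Complex.log (gammaVar lam η + 2)) η :=
    (hg.add_const _).clog (mem_slitPlane_of_re_pos (by linarith))
  have d2 : DifferentiableAt ℂ (fun η => Complex.log (gammaQuot (gammaVar lam η + 2))) η :=
    (DifferentiableAt.comp η (f := fun η => gammaVar lam η + 2) (g := gammaQuot)
      (differentiableAt_gammaQuot (by linarith)) (hg.add_const 2)).clog (mem_slitPlane_of_re_pos (gammaQuot_re_pos hw))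
  have d3 : DifferentiableAt ℂ
      (fun η => Complex.log ((gammaVar lam η + 1) / (gammaVar lam η + 3 / 2))) η :=
    ((hg.add_const _).div (hg.add_const _) n4).clog (mem_slitPlane_of_re_pos (first_quot_re_pos h))
  have d4 : DifferentiableAt ℂ
      (fun η => Complex.log (gammaVar lam η / (gammaVar lam η + 1 / 2))) η :=
    (hg.div (hg.add_const _) n2).clog (mem_slitPlane_of_re_pos (second_quot_re_pos h))
  exact (d1.const_mul _).add ((((d2.const_mul _).const_add _).add d3).add d4)

lemma Phi_eq_gammaVar (lam : ℝ) (η : ℂ) : -Phi lam η = 2 * (Real.sqrt Real.pi : ℂ) *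
    (Complex.Gamma (gammaVar lam η + 1 / 2) / Complex.Gamma (gammaVar lam η)) := by
  rw [Phi, neg_neg, gammaVar, mul_div_assoc]
  congr 3
  ring

lemma gamma_ratio_shift {z : ℂ} (n1 : z ≠ 0) (n2 : z + 1 / 2 ≠ 0) (n3 : z + 1 ≠ 0)
    (n4 : z + 3 / 2 ≠ 0) :
    Complex.Gamma (z + 1 / 2) / Complex.Gamma z
      = Complex.Gamma (z + 2 + 1 / 2) / Complex.Gamma (z + 2) * ((z + 1) / (z + 3 / 2))
        * (z / (z + 1 / 2)) := by
  have e1 : Complex.Gamma (z + 2 + 1 / 2) = (z + 3 / 2) * ((z + 1 / 2) * Complex.Gamma (z + 1 / 2)) := by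
    rw [← Complex.Gamma_add_one _ n2, show z + 1 / 2 + 1 = z + 3 / 2 by ring,
      ← Complex.Gamma_add_one _ n4]
    congr 1; ring
  have e2 : Complex.Gamma (z + 2) = (z + 1) * (z * Complex.Gamma z) := by
    rw [← Complex.Gamma_add_one _ n1, ← Complex.Gamma_add_one _ n3]
    congr 1; ring
  rw [e1, e2]
  -- The hypotheses do not exclude the poles z = -2, -3, …, where `Complex.Gamma` takes the value 0;
  -- there both sides vanish by division by zero.
  by_cases hz : Complex.Gamma z = 0
  · simp [hz]
  · generalize Complex.Gamma (z + 1 / 2) = A at *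
    generalize hu : z + 1 / 2 = u at *
    generalize hv : z + 3 / 2 = v at *
    field_simp

lemma Phi_eq_shift {lam : ℝ} {η : ℂ} (h : η ∈ stripU lam) :
    -Phi lam η = 2 * (Real.sqrt Real.pi : ℂ) * (Complex.exp (logGammaRatio (gammaVar lam η + 2)) *
      ((gammaVar lam η + 1) / (gammaVar lam η + 3 / 2))
        * (gammaVar lam η / (gammaVar lam η + 1 / 2))) := by
  obtain ⟨n1, n2, n3, n4⟩ := gammaVar_factors_ne_zero h
  rw [Phi_eq_gammaVar, gamma_ratio_shift n1 n2 n3 n4, exp_logGammaRatio (gammaVar_add_two_re h)]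

lemma exp_ell {lam : ℝ} {η : ℂ} (h : η ∈ stripU lam) : Complex.exp (ell lam η) = -Phi lam η := by
  obtain ⟨n1, n2, n3, n4⟩ := gammaVar_factors_ne_zero h
  have hp : 0 < 2 * Real.sqrt Real.pi := by positivity
  have e : ell lam η = (Real.log (2 * Real.sqrt Real.pi) : ℂ)
      + logGammaRatio (gammaVar lam η + 2)
      + Complex.log ((gammaVar lam η + 1) / (gammaVar lam η + 3 / 2))
      + Complex.log (gammaVar lam η / (gammaVar lam η + 1 / 2)) := by
    unfold ell ellRem logGammaRatio; ring
  rw [e, Complex.exp_add, Complex.exp_add, Complex.exp_add, Complex.exp_log (div_ne_zero n1 n2),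
    Complex.exp_log (div_ne_zero n3 n4), Phi_eq_shift h, ← Complex.ofReal_exp, Real.exp_log hp]
  push_cast
  ring

lemma Phi_ne_zero {lam : ℝ} {η : ℂ} (h : η ∈ stripU lam) : Phi lam η ≠ 0 := by
  intro h0
  have := exp_ell h
  rw [h0, neg_zero] at this
  exact Complex.exp_ne_zero _ this

lemma linePt_mem_stripU {lam b : ℝ} (hb : b ∈ Ioo ((2 + lam) / 2) ((3 + lam) / 2)) (x : ℝ) :
    linePt b x ∈ stripU lam := by
  simpa [stripU, linePt_im] using hb

lemma norm_log_le_of_norm_le {p : ℂ} (hp : p ≠ 0) {M : ℝ} (h1 : ‖p‖ ≤ M) (h2 : ‖p‖⁻¹ ≤ M) :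
    ‖Complex.log p‖ ≤ Real.log M + Real.pi := by
  have hp' : 0 < ‖p‖ := norm_pos_iff.mpr hp
  refine (Complex.norm_le_abs_re_add_abs_im _).trans ?_
  rw [Complex.log_re, Complex.log_im]
  refine add_le_add (abs_le.mpr ⟨?_, Real.log_le_log hp' h1⟩) (Complex.abs_arg_le_pi _)
  have := Real.log_le_log (inv_pos.mpr hp') h2
  rw [Real.log_inv] at this
  linarith

/-- Only two factors can degenerate: z + 1/2 at the lower edge of the strip, the pole of Φ, and z +
1 at the upper edge, its zero. `d₁` and `d₂` are the distances to these edges. -/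
lemma exists_norm_ellRem_le {lam b₁ b₂ : ℝ} (h1 : (2 + lam) / 2 < b₁) (h2 : b₂ < (3 + lam) / 2) :
    ∃ C : ℝ, 0 ≤ C ∧ ∀ b x : ℝ, b₁ ≤ b → b ≤ b₂ → ‖ellRem lam (linePt b x)‖ ≤ C := by
  set d₁ := b₁ - (2 + lam) / 2 with hd1
  set d₂ := (3 + lam) / 2 - b₂ with hd2
  have d1 : 0 < d₁ := by linarith
  have d2 : 0 < d₂ := by linarith
  set M₁ := max (1 + 1 / 2 / d₁) 2
  set M₂ := max (1 + 1 / 2 / d₂) 2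
  refine ⟨|Real.log (2 * Real.sqrt Real.pi)| + 1 / 2 * 2 + |Real.log M₂ + Real.pi| +
    |Real.log M₁ + Real.pi|, by positivity, fun b x hb1 hb2 => ?_⟩
  have hU : linePt b x ∈ stripU lam := linePt_mem_stripU ⟨by linarith, by linarith⟩ x
  obtain ⟨n1, n2, n3, n4⟩ := gammaVar_factors_ne_zero hU
  have hre : (gammaVar lam (linePt b x)).re = (lam + 1) / 2 - b := by rw [gammaVar_re, linePt_im]
  have hw := gammaVar_add_two_re hU
  have hq1 := first_quot_re_pos hU
  have hq2 := second_quot_re_pos hU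
  unfold ellRem
  set z := gammaVar lam (linePt b x) with hz
  have hre' : ∀ t : ℝ, |(lam + 1) / 2 - b + t| ≤ ‖z + t‖ := by
    intro t
    have := Complex.abs_re_le_norm (z + t)
    rwa [Complex.add_re, Complex.ofReal_re, hre] at this
  have l1 : d₁ ≤ ‖z + 1 / 2‖ := by
    have := hre' (1 / 2)
    push_cast at this
    rw [abs_of_neg (by linarith)] at this
    linarith
  have l2 : d₂ ≤ ‖z + 1‖ := by
    have := hre' 1
    push_cast at this
    rw [abs_of_pos (by linarith)] at this
    linarith
  have l3 : 1 / 2 ≤ ‖z + 3 / 2‖ := by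
    have := hre' (3 / 2)
    push_cast at this
    rw [abs_of_pos (by linarith)] at this
    linarith
  have l4 : 1 / 2 ≤ ‖z‖ := by
    have := hre' 0
    push_cast at this
    rw [add_zero, add_zero, abs_of_neg (by linarith)] at this
    linarith
  have key : ∀ (p q : ℂ) (d M : ℝ), p ≠ 0 → q ≠ 0 → p - q = 1 / 2 ∨ p - q = -(1 / 2) → 0 < d → d ≤ ‖q‖ →
      1 + 1 / 2 / d ≤ M → ‖p / q‖ ≤ M := by
    intro p q d M hp hq hpq hd hdq hM
    have e : p / q = 1 + (p - q) / q := by field_simp; ring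
    have hn : ‖p - q‖ = 1 / 2 := by rcases hpq with h | h <;> rw [h] <;> norm_num
    rw [e]
    refine (norm_add_le _ _).trans ?_
    rw [norm_one, norm_div, hn]
    have : 1 / 2 / ‖q‖ ≤ 1 / 2 / d := by gcongr
    linarith
  have b1 : ‖Complex.log ((z + 1) / (z + 3 / 2))‖ ≤ Real.log M₂ + Real.pi := by
    refine norm_log_le_of_norm_le (div_ne_zero n3 n4) ?_ ?_
    · exact key _ _ (1 / 2) M₂ n3 n4 (Or.inr (by ring)) (by norm_num) l3
        (le_trans (by norm_num) (le_max_right _ _))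
    · rw [← norm_inv, inv_div]
      exact key _ _ d₂ M₂ n4 n3 (Or.inl (by ring)) d2 l2 (le_max_left _ _)
  have b2 : ‖Complex.log (z / (z + 1 / 2))‖ ≤ Real.log M₁ + Real.pi := by
    refine norm_log_le_of_norm_le (div_ne_zero n1 n2) ?_ ?_
    · exact key _ _ d₁ M₁ n1 n2 (Or.inr (by ring)) d1 l1 (le_max_left _ _)
    · rw [← norm_inv, inv_div]
      exact key _ _ (1 / 2) M₁ n2 n1 (Or.inl (by ring)) (by norm_num) l4
        (le_trans (by norm_num) (le_max_right _ _))
  have b3 := norm_log_gammaQuot_le hw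
  have c1 : ‖(1 / 2 : ℂ) * Complex.log (gammaQuot (z + 2))‖ ≤ 1 / 2 * 2 := by
    rw [norm_mul]; norm_num at b3 ⊢; linarith
  refine (norm_add_le _ _).trans (add_le_add ((norm_add_le _ _).trans (add_le_add
    ((norm_add_le _ _).trans (add_le_add ?_ c1)) (b1.trans (le_abs_self _)))) (b2.trans (le_abs_self _)))
  rw [Complex.norm_real, Real.norm_eq_abs]

/-- The three quotients tend to 1, so the limit is real: the argument of -Φ at infinity comes
entirely from ½ log(z+2). -/
lemma tendsto_ellRem {lam b : ℝ} (hb : b ∈ Ioo ((2 + lam) / 2) ((3 + lam) / 2)) {l : Filter ℝ}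
    (hl : Tendsto (fun x : ℝ => |x|) l atTop) :
    Tendsto (fun x => ellRem lam (linePt b x)) l (𝓝 (Real.log (2 * Real.sqrt Real.pi) : ℂ)) := by
  set z : ℝ → ℂ := fun x => gammaVar lam (linePt b x) with hz
  have him : ∀ x, (z x).im = x := fun x => by simp [hz, gammaVar_im, linePt_re]
  have hinv : ∀ t : ℝ, Tendsto (fun x => (z x + t)⁻¹) l (𝓝 0) := by
    intro t
    refine tendsto_inv₀_cobounded.comp ?_
    rw [tendsto_norm_atTop_iff_cobounded.symm]
    refine tendsto_atTop_mono (fun x => ?_) hl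
    have := Complex.abs_im_le_norm (z x + t)
    simpa [him] using this
  have hfac := fun x => gammaVar_factors_ne_zero (linePt_mem_stripU hb x)
  have l1 : Tendsto (fun x => Complex.log ((z x + 1) / (z x + 3 / 2))) l (𝓝 0) := by
    have h : Tendsto (fun x => 1 - 1 / 2 * (z x + ((3 / 2 : ℝ) : ℂ))⁻¹) l (𝓝 (1 - 1 / 2 * 0)) :=
      ((hinv (3 / 2)).const_mul _).const_sub _
    rw [mul_zero, sub_zero] at h
    have h2 := ((continuousAt_clog (x := 1) (by simp)).tendsto.comp h)
    rw [Complex.log_one] at h2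
    refine h2.congr fun x => ?_
    have := (hfac x).2.2.2
    simp only [Function.comp]
    congr 1
    push_cast
    rw [eq_div_iff this, sub_mul, mul_assoc, inv_mul_cancel₀ this]
    ring
  have l2 : Tendsto (fun x => Complex.log (z x / (z x + 1 / 2))) l (𝓝 0) := by
    have h : Tendsto (fun x => 1 - 1 / 2 * (z x + ((1 / 2 : ℝ) : ℂ))⁻¹) l (𝓝 (1 - 1 / 2 * 0)) :=
      ((hinv (1 / 2)).const_mul _).const_sub _
    rw [mul_zero, sub_zero] at h
    have h2 := ((continuousAt_clog (x := 1) (by simp)).tendsto.comp h)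
    rw [Complex.log_one] at h2
    refine h2.congr fun x => ?_
    have := (hfac x).2.1
    simp only [Function.comp]
    congr 1
    push_cast
    rw [eq_div_iff this, sub_mul, mul_assoc, inv_mul_cancel₀ this]
    ring
  have l3 : Tendsto (fun x => Complex.log (gammaQuot (z x + 2))) l (𝓝 0) := by
    have h : Tendsto (fun x => gammaQuot (z x + 2)) l (𝓝 1) := by
      rw [tendsto_iff_norm_sub_tendsto_zero]
      have hb' : Tendsto (fun x : ℝ => Real.exp (1 / (2 * |x|)) - 1) l (𝓝 (Real.exp 0 - 1)) := by
        refine Tendsto.sub_const ((Real.continuous_exp.tendsto 0).comp ?_) 1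
        exact Tendsto.div_atTop tendsto_const_nhds (hl.const_mul_atTop (by norm_num))
      rw [Real.exp_zero, sub_self] at hb'
      refine tendsto_of_tendsto_of_tendsto_of_le_of_le' tendsto_const_nhds hb'
        (Eventually.of_forall fun x => norm_nonneg _) ?_
      filter_upwards [hl.eventually_gt_atTop 0] with x hx
      have e : (z x + 2).im = x := by simp [him]
      have := norm_gammaQuot_sub_one_le_im (w := z x + 2) (gammaVar_add_two_re (linePt_mem_stripU hb x))
        (by rw [e]; exact abs_pos.mp hx)
      rwa [e] at this
    have h2 := ((continuousAt_clog (x := 1) (by simp)).tendsto.comp h)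
    rwa [Complex.log_one] at h2
  have := ((tendsto_const_nhds (x := (Real.log (2 * Real.sqrt Real.pi) : ℂ)) (f := l)).add
    (l3.const_mul (1 / 2))).add l1 |>.add l2
  simpa [ellRem] using this

lemma log_line_eq (lam b x : ℝ) :
    gammaVar lam (linePt b x) + 2 = (((lam + 5) / 2 - b : ℝ) : ℂ) + x * Complex.I := by
  apply Complex.ext
  · simp [gammaVar_re, linePt_im]; ring
  · simp [gammaVar_im, linePt_re]

lemma norm_log_line_sub_le {σ k p q : ℝ} (hσ : 0 < σ) (hk : 0 < k)
    (h : ∀ v ∈ uIcc p q, k ≤ ‖(σ : ℂ) + v * Complex.I‖) :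
    ‖Complex.log ((σ : ℂ) + q * Complex.I) - Complex.log ((σ : ℂ) + p * Complex.I)‖
      ≤ |q - p| / k := by
  have hd : ∀ v ∈ uIcc p q, HasDerivWithinAt (fun v : ℝ => Complex.log ((σ : ℂ) + v * Complex.I))
      (Complex.I / ((σ : ℂ) + v * Complex.I)) (uIcc p q) v := by
    intro v _
    have h1 : HasDerivAt (fun w : ℂ => (σ : ℂ) + w * Complex.I) Complex.I (v : ℂ) := by
      simpa using ((hasDerivAt_id (v : ℂ)).mul_const Complex.I).const_add (σ : ℂ)
    exact (h1.clog (mem_slitPlane_of_re_pos (by simpa using hσ))).comp_ofReal.hasDerivWithinAt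
  have := Convex.norm_image_sub_le_of_norm_hasDerivWithin_le (C := 1 / k) hd (fun v hv => ?_)
    (convex_uIcc p q) left_mem_uIcc right_mem_uIcc
  · rw [Real.norm_eq_abs] at this
    refine this.trans (le_of_eq (by ring))
  · rw [norm_div, Complex.norm_I]
    exact one_div_le_one_div_of_le hk (h v hv)

lemma le_norm_line (σ v : ℝ) : |v| ≤ ‖(σ : ℂ) + v * Complex.I‖ ∧ |σ| ≤ ‖(σ : ℂ) + v * Complex.I‖ := by
  have h1 := Complex.abs_im_le_norm ((σ : ℂ) + v * Complex.I)
  have h2 := Complex.abs_re_le_norm ((σ : ℂ) + v * Complex.I)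
  simp at h1 h2
  exact ⟨h1, h2⟩

lemma exists_norm_ell_sub_le {lam b : ℝ} (hb : b ∈ Ioo ((2 + lam) / 2) ((3 + lam) / 2)) :
    ∃ C : ℝ, 0 ≤ C ∧ ∀ x s : ℝ, ‖ell lam (linePt b x) - ell lam (linePt b s)‖ ≤ C * (1 + |x - s|) := by
  obtain ⟨C, hC0, hC⟩ := exists_norm_ellRem_le (lam := lam) hb.1 hb.2
  have hσ : 1 ≤ (lam + 5) / 2 - b := by linarith [hb.2]
  refine ⟨2 * C + 1, by linarith, fun x s => ?_⟩
  have h1 := norm_log_line_sub_le (p := s) (q := x) (k := 1) (σ := (lam + 5) / 2 - b) (by linarith) one_pos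
    (fun v _ => (hσ.trans (le_abs_self _)).trans (le_norm_line _ v).2)
  have e : ell lam (linePt b x) - ell lam (linePt b s)
      = 1 / 2 * (Complex.log ((((lam + 5) / 2 - b : ℝ) : ℂ) + x * Complex.I)
          - Complex.log ((((lam + 5) / 2 - b : ℝ) : ℂ) + s * Complex.I))
        + (ellRem lam (linePt b x) - ellRem lam (linePt b s)) := by
    simp only [ell, log_line_eq]; ring
  rw [e]
  refine (norm_add_le _ _).trans ?_
  have h2 := (norm_sub_le (ellRem lam (linePt b x)) (ellRem lam (linePt b s))).trans
    (add_le_add (hC b x le_rfl le_rfl) (hC b s le_rfl le_rfl))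
  rw [norm_mul]
  have : ‖(1 / 2 : ℂ)‖ = 1 / 2 := by norm_num
  rw [this]
  have := abs_nonneg (x - s)
  rw [div_one] at h1
  nlinarith

lemma exists_norm_ell_le {lam b₁ b₂ : ℝ} (h1 : (2 + lam) / 2 < b₁) (h2 : b₂ < (3 + lam) / 2) :
    ∃ C : ℝ, 0 ≤ C ∧ ∀ b x : ℝ, b₁ ≤ b → b ≤ b₂ → ‖ell lam (linePt b x)‖ ≤ C * (1 + |x|) := by
  obtain ⟨C, hC0, hC⟩ := exists_norm_ellRem_le h1 h2
  refine ⟨C + 3, by linarith, fun b x hb1 hb2 => ?_⟩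
  have s1 : 1 ≤ (lam + 5) / 2 - b := by linarith
  have s2 : (lam + 5) / 2 - b ≤ 2 := by linarith
  have h1 := norm_log_line_sub_le (p := 0) (q := x) (k := 1) (σ := (lam + 5) / 2 - b) (by linarith) one_pos
    (fun v _ => (s1.trans (le_abs_self _)).trans (le_norm_line _ v).2)
  have h0 : ‖Complex.log ((((lam + 5) / 2 - b : ℝ) : ℂ) + (0 : ℝ) * Complex.I)‖ ≤ 2 := by
    rw [Complex.ofReal_zero, zero_mul, add_zero, ← Complex.ofReal_log (by linarith), Complex.norm_real,
      Real.norm_of_nonneg (Real.log_nonneg s1)]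
    linarith [Real.log_le_sub_one_of_pos (show 0 < (lam + 5) / 2 - b by linarith)]
  rw [ell, log_line_eq]
  refine (norm_add_le _ _).trans ?_
  have h3 := hC b x hb1 hb2
  rw [norm_mul]
  have : ‖(1 / 2 : ℂ)‖ = 1 / 2 := by norm_num
  rw [this]
  rw [sub_zero, div_one] at h1
  have h4 := norm_sub_norm_le (Complex.log ((((lam + 5) / 2 - b : ℝ) : ℂ) + x * Complex.I))
    (Complex.log ((((lam + 5) / 2 - b : ℝ) : ℂ) + (0 : ℝ) * Complex.I))
  have := abs_nonneg x
  nlinarith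

/-- The logarithmic part has derivative O(1/|s|) and the remainder has a limit. This slow variation
is what lets an average of log(-Φ) be replaced by its value at one point. -/
lemma tendsto_ell_shift_sub {lam b : ℝ} (hb : b ∈ Ioo ((2 + lam) / 2) ((3 + lam) / 2)) (u : ℝ)
    {l : Filter ℝ} (hl : Tendsto (fun x : ℝ => |x|) l atTop) :
    Tendsto (fun s => ell lam (linePt b (s + u)) - ell lam (linePt b s)) l (𝓝 0) := by
  have hσ : 1 ≤ (lam + 5) / 2 - b := by linarith [hb.2]
  have hl' : Tendsto (fun x : ℝ => |x + u|) l atTop := by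
    refine tendsto_atTop_mono (fun x => ?_) (tendsto_atTop_add_const_right _ (-|u|) hl)
    have := abs_sub_abs_le_abs_sub x (-u)
    rw [abs_neg, sub_neg_eq_add] at this
    linarith
  have l1 : Tendsto (fun s : ℝ => Complex.log ((((lam + 5) / 2 - b : ℝ) : ℂ) + (s + u : ℝ) * Complex.I)
          - Complex.log ((((lam + 5) / 2 - b : ℝ) : ℂ) + s * Complex.I)) l (𝓝 0) := by
    have hz : Tendsto (fun s : ℝ => |u| / (|s| - |u|)) l (𝓝 0) :=
      Tendsto.div_atTop tendsto_const_nhds (tendsto_atTop_add_const_right _ (-|u|) hl)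
    refine squeeze_zero_norm' ?_ hz
    filter_upwards [hl.eventually_gt_atTop |u|] with s hs
    have := norm_log_line_sub_le (p := s) (q := s + u) (k := |s| - |u|) (σ := (lam + 5) / 2 - b)
      (by linarith) (by linarith) (fun v hv => le_trans ?_ (le_norm_line _ v).1)
    · rwa [add_sub_cancel_left] at this
    · have h1 := abs_sub_left_of_mem_uIcc hv
      rw [add_sub_cancel_left] at h1
      have := abs_sub_abs_le_abs_sub s v
      rw [abs_sub_comm] at this
      linarith
  have l2 := (tendsto_ellRem hb (l := map (fun s => s + u) l) (tendsto_map'_iff.mpr hl')).comp tendsto_map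
  have l3 := (l1.const_mul (1 / 2)).add (l2.sub (tendsto_ellRem hb hl))
  rw [mul_zero, sub_self, add_zero] at l3
  refine l3.congr fun s => ?_
  simp only [ell, log_line_eq, Function.comp]
  ring

lemma tendsto_arg_line_atTop {σ : ℝ} :
    Tendsto (fun x : ℝ => Complex.arg ((σ : ℂ) + x * Complex.I)) atTop (𝓝 (Real.pi / 2)) := by
  have h : Tendsto (fun x : ℝ => ((σ / x : ℝ) : ℂ) + Complex.I) atTop (𝓝 (((0 : ℝ) : ℂ) + Complex.I)) :=
    ((Complex.continuous_ofReal.tendsto 0).comp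
      (Tendsto.div_atTop tendsto_const_nhds tendsto_id)).add_const _
  rw [Complex.ofReal_zero, zero_add] at h
  have h2 := (Complex.continuousAt_arg (x := Complex.I) (Or.inr (by simp))).tendsto.comp h
  rw [Complex.arg_I] at h2
  refine h2.congr' ?_
  filter_upwards [eventually_gt_atTop 0] with x hx
  simp only [Function.comp]
  rw [← Complex.arg_real_mul _ hx]
  congr 1
  have : (x : ℂ) ≠ 0 := Complex.ofReal_ne_zero.mpr hx.ne'
  push_cast
  field_simp

lemma tendsto_arg_line_atBot {σ : ℝ} :
    Tendsto (fun x : ℝ => Complex.arg ((σ : ℂ) + x * Complex.I)) atBot (𝓝 (-(Real.pi / 2))) := by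
  have h : Tendsto (fun x : ℝ => ((σ / (-x) : ℝ) : ℂ) + -Complex.I) atBot (𝓝 (((0 : ℝ) : ℂ) + -Complex.I)) :=
    ((Complex.continuous_ofReal.tendsto 0).comp
      (Tendsto.div_atTop tendsto_const_nhds tendsto_neg_atBot_atTop)).add_const _
  rw [Complex.ofReal_zero, zero_add] at h
  have h2 := (Complex.continuousAt_arg (x := -Complex.I) (Or.inr (by simp))).tendsto.comp h
  rw [Complex.arg_neg_I] at h2
  refine h2.congr' ?_
  filter_upwards [eventually_lt_atBot 0] with x hx
  simp only [Function.comp]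
  rw [← Complex.arg_real_mul _ (neg_pos.mpr hx)]
  congr 1
  have : (x : ℂ) ≠ 0 := Complex.ofReal_ne_zero.mpr hx.ne
  push_cast
  field_simp
  ring

lemma tendsto_im_ell_atTop {lam b : ℝ} (hb : b ∈ Ioo ((2 + lam) / 2) ((3 + lam) / 2)) :
    Tendsto (fun x => (ell lam (linePt b x)).im) atTop (𝓝 (Real.pi / 4)) := by
  have h1 := (Complex.continuous_im.tendsto _).comp (tendsto_ellRem hb tendsto_abs_atTop_atTop)
  have h2 := ((tendsto_arg_line_atTop (σ := (lam + 5) / 2 - b)).const_mul (1 / 2)).add h1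
  rw [Complex.ofReal_im, add_zero, show 1 / 2 * (Real.pi / 2) = Real.pi / 4 by ring] at h2
  refine h2.congr fun x => ?_
  simp [ell, log_line_eq, Complex.log_im]

/-- The branch is normalised at +∞ only; the opposite limit at -∞ is a consequence, and it makes V
decay in both directions. -/
lemma tendsto_im_ell_atBot {lam b : ℝ} (hb : b ∈ Ioo ((2 + lam) / 2) ((3 + lam) / 2)) :
    Tendsto (fun x => (ell lam (linePt b x)).im) atBot (𝓝 (-(Real.pi / 4))) := by
  have h1 := (Complex.continuous_im.tendsto _).comp (tendsto_ellRem hb tendsto_abs_atBot_atTop)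
  have h2 := ((tendsto_arg_line_atBot (σ := (lam + 5) / 2 - b)).const_mul (1 / 2)).add h1
  rw [Complex.ofReal_im, add_zero, show 1 / 2 * (-(Real.pi / 2)) = -(Real.pi / 4) by ring] at h2
  refine h2.congr fun x => ?_
  simp [ell, log_line_eq, Complex.log_im]

/-- Two branches differ by elements of 2πiℤ, so they coincide wherever their imaginary parts differ
by less than 1. This makes the coincidence set open as well as closed, and the limit at +∞ makes it
nonempty. -/
lemma IsLogBranch.unique {lam b : ℝ} {L L' : ℝ → ℂ} (h : IsLogBranch lam b L)
    (h' : IsLogBranch lam b L') : L = L' := by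
  have hn : ∀ x, ∃ n : ℤ, L x - L' x = n * (2 * Real.pi * Complex.I) := by
    intro x
    rw [← Complex.exp_eq_one_iff, Complex.exp_sub, h.2.1 x, ← h'.2.1 x, div_self (Complex.exp_ne_zero _)]
  have hz : ∀ x, |(L x - L' x).im| < 1 → L x = L' x := by
    intro x hx
    obtain ⟨n, hn⟩ := hn x
    have him : (L x - L' x).im = n * (2 * Real.pi) := by rw [hn]; simp
    rw [him, abs_mul, abs_of_pos (by positivity : 0 < 2 * Real.pi)] at hx
    have h3 := Real.pi_gt_three
    have hn0 : |(n : ℝ)| < 1 := by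
      by_contra hc
      push Not at hc
      nlinarith
    have : n = 0 := Int.abs_lt_one_iff.mp (by exact_mod_cast hn0)
    rw [this] at hn
    simpa [sub_eq_zero] using hn
  have hcl : IsClopen {x | L x = L' x} := by
    refine ⟨isClosed_eq h.1 h'.1, ?_⟩
    have : {x | L x = L' x} = {x | |(L x - L' x).im| < 1} := by
      ext x
      refine ⟨fun hx => ?_, fun hx => hz x hx⟩
      have hx' : L x = L' x := hx
      simp [hx']
    rw [this]
    exact isOpen_lt (Complex.continuous_im.comp (h.1.sub h'.1)).abs continuous_const
  have hne : {x | L x = L' x}.Nonempty := by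
    have ht := (h.2.2.sub h'.2.2).abs
    rw [sub_self, abs_zero] at ht
    obtain ⟨x, hx⟩ := (ht.eventually_lt_const one_pos).exists
    exact ⟨x, hz x (by simpa using hx)⟩
  have := hcl.eq_univ hne
  funext x
  have hx : x ∈ {x | L x = L' x} := this ▸ mem_univ x
  exact hx

lemma isLogBranch_ell {lam b : ℝ} (hb : b ∈ Ioo ((2 + lam) / 2) ((3 + lam) / 2)) :
    IsLogBranch lam b (fun x => ell lam (linePt b x)) := by
  refine ⟨?_, fun x => exp_ell (linePt_mem_stripU hb x), tendsto_im_ell_atTop hb⟩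
  exact continuous_iff_continuousAt.mpr fun x =>
    (differentiableAt_ell (linePt_mem_stripU hb x)).continuousAt.comp (continuous_linePt b).continuousAt

lemma existsUnique_isLogBranch {lam b : ℝ} (hb : b ∈ Ioo ((2 + lam) / 2) ((3 + lam) / 2)) :
    ∃! L : ℝ → ℂ, IsLogBranch lam b L :=
  ⟨_, isLogBranch_ell hb, fun _ h => h.unique (isLogBranch_ell hb)⟩

lemma logNegPhi_eq {lam b : ℝ} (hb : b ∈ Ioo ((2 + lam) / 2) ((3 + lam) / 2)) (x : ℝ) :
    logNegPhi lam b x = ell lam (linePt b x) := by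
  have h : IsLogBranch lam b (logNegPhi lam b) := Classical.epsilon_spec (existsUnique_isLogBranch hb).exists
  exact congrFun (h.unique (isLogBranch_ell hb)) x

end WienerHopf

/-! ### The periodic Cauchy kernel and the regularised Cauchy integral. -/

namespace WienerHopf
open MeasureTheory Set

/-- The periodic Cauchy kernel `1/(1 - e^{cw})`. -/
noncomputable def kern (c : ℝ) (w : ℂ) : ℂ := 1 / (1 - Complex.exp (c * w))

/-- The derivative of `kern`. -/
noncomputable def kernDeriv (c : ℝ) (w : ℂ) : ℂ :=
  c * Complex.exp (c * w) / (1 - Complex.exp (c * w)) ^ 2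

lemma hasDerivAt_kern {c : ℝ} {w : ℂ} (h : 1 - Complex.exp (c * w) ≠ 0) :
    HasDerivAt (kern c) (kernDeriv c w) w := by
  have h1 : HasDerivAt (fun w => 1 - Complex.exp (c * w)) (-(Complex.exp (c * w) * c)) w := by
    simpa using (((hasDerivAt_id w).const_mul (c : ℂ)).cexp).const_sub 1
  have h2 := h1.inv h
  have e : kern c = fun w => (1 - Complex.exp (c * w))⁻¹ := by
    funext w; rw [kern, one_div]
  rw [e]
  convert! h2 using 1
  rw [kernDeriv]; ring

/-- With E = e^{Re ω} and m = sin²(Im ω/2), the difference of the squares of the two sides is (1 -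
m)(1 - E)² ≥ 0. -/
lemma norm_one_sub_exp_ge (ω : ℂ) :
    |Real.sin (ω.im / 2)| * (1 + Real.exp ω.re) ≤ ‖1 - Complex.exp ω‖ := by
  refine le_of_sq_le_sq (a := |Real.sin (ω.im / 2)| * (1 + Real.exp ω.re)) ?_ (norm_nonneg _)
  rw [mul_pow, sq_abs, ← Complex.normSq_eq_norm_sq, Complex.normSq_apply]
  simp only [Complex.sub_re, Complex.sub_im, Complex.one_re, Complex.one_im, Complex.exp_re,
    Complex.exp_im]
  have h1 : Real.cos ω.im = 1 - 2 * Real.sin (ω.im / 2) ^ 2 := by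
    have := Real.cos_two_mul (ω.im / 2)
    rw [mul_div_cancel₀ _ (two_ne_zero' ℝ)] at this
    have h := Real.sin_sq_add_cos_sq (ω.im / 2)
    linarith
  have h2 := Real.sin_sq_add_cos_sq ω.im
  have h3 := Real.sin_sq_le_one (ω.im / 2)
  set m := Real.sin (ω.im / 2) ^ 2
  set E := Real.exp ω.re
  have e : (1 - E * Real.cos ω.im) * (1 - E * Real.cos ω.im)
      + (0 - E * Real.sin ω.im) * (0 - E * Real.sin ω.im) = 1 - 2 * E * Real.cos ω.im + E ^ 2 := by
    linear_combination E ^ 2 * h2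
  rw [e, h1]
  nlinarith [mul_nonneg (sub_nonneg.mpr h3) (sq_nonneg (1 - E))]

/-- Substitute for the sine bound that does not depend on Im ω; needed when a family of contours
passes through the height of the pole. -/
lemma norm_one_sub_exp_ge_of_one_le_abs {ω : ℂ} (h : 1 ≤ |ω.re|) :
    1 / 4 * (1 + Real.exp ω.re) ≤ ‖1 - Complex.exp ω‖ := by
  have h0 := abs_norm_sub_norm_le 1 (Complex.exp ω)
  rw [norm_one, Complex.norm_exp] at h0
  have he := Real.exp_one_gt_d9
  rcases le_abs.mp h with h1 | h1
  · have h2 : Real.exp 1 ≤ Real.exp ω.re := Real.exp_le_exp.mpr h1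
    have := (neg_abs_le (1 - Real.exp ω.re))
    linarith
  · have h2 : Real.exp ω.re ≤ Real.exp (-1) := Real.exp_le_exp.mpr (by linarith)
    have h3 : Real.exp (-1) * Real.exp 1 = 1 := by rw [← Real.exp_add]; simp
    have h4 := Real.exp_pos (-1)
    have := (le_abs_self (1 - Real.exp ω.re))
    nlinarith

/-- The true rates are e^{-c|Re w|}. They are weakened to rate 1, using c ≥ 1, so that kernels of
different frequencies can be compared. -/
lemma kern_bounds {c s : ℝ} (hc : 1 ≤ c) (hs : 0 < s) {w : ℂ}
    (h : s * (1 + Real.exp (c * w.re)) ≤ ‖1 - Complex.exp (c * w)‖) :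
    ‖kern c w‖ ≤ s⁻¹ * Real.exp (-w.re) ∧ ‖kern c w - 1‖ ≤ s⁻¹ * Real.exp w.re ∧
      ‖kernDeriv c w‖ ≤ c * s⁻¹ ^ 2 * Real.exp (-|w.re|) := by
  set P := c * w.re with hP
  have hE := Real.exp_pos P
  have hpos : 0 < s * (1 + Real.exp P) := by positivity
  have hD : 0 < ‖1 - Complex.exp (c * w)‖ := hpos.trans_le h
  have hne : 1 - Complex.exp (c * w) ≠ 0 := norm_pos_iff.mp hD
  have hre : ((c : ℂ) * w).re = P := by simp [hP]
  have e1 : 1 ≤ (1 + Real.exp P) * Real.exp (-w.re) := by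
    rcases le_total 0 w.re with h0 | h0
    · have : Real.exp w.re ≤ Real.exp P := Real.exp_le_exp.mpr (by nlinarith)
      have h3 : Real.exp w.re * Real.exp (-w.re) = 1 := by rw [← Real.exp_add]; simp
      have h4 := Real.exp_pos (-w.re)
      nlinarith
    · have : 1 ≤ Real.exp (-w.re) := Real.one_le_exp (by linarith)
      nlinarith
  have e2 : Real.exp P ≤ (1 + Real.exp P) * Real.exp w.re := by
    rcases le_total 0 w.re with h0 | h0
    · have : 1 ≤ Real.exp w.re := Real.one_le_exp (by linarith)
      nlinarith
    · have : Real.exp P ≤ Real.exp w.re := Real.exp_le_exp.mpr (by nlinarith)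
      have h4 := Real.exp_pos w.re
      nlinarith
  have e3 : Real.exp P ≤ (1 + Real.exp P) ^ 2 * Real.exp (-|w.re|) := by
    rcases le_total 0 w.re with h0 | h0
    · rw [abs_of_nonneg h0]
      nlinarith
    · rw [abs_of_nonpos h0, neg_neg]
      nlinarith [Real.exp_pos w.re]
  refine ⟨?_, ?_, ?_⟩
  · rw [kern, norm_div, norm_one, div_le_iff₀ hD]
    calc 1 ≤ (1 + Real.exp P) * Real.exp (-w.re) := e1
      _ = s⁻¹ * Real.exp (-w.re) * (s * (1 + Real.exp P)) := by field_simp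
      _ ≤ _ := by gcongr
  · have : kern c w - 1 = Complex.exp (c * w) / (1 - Complex.exp (c * w)) := by
      rw [kern]; field_simp; ring
    rw [this, norm_div, Complex.norm_exp, hre, div_le_iff₀ hD]
    calc Real.exp P ≤ (1 + Real.exp P) * Real.exp w.re := e2
      _ = s⁻¹ * Real.exp w.re * (s * (1 + Real.exp P)) := by field_simp
      _ ≤ _ := by gcongr
  · rw [kernDeriv, norm_div, norm_mul, Complex.norm_exp, hre, norm_pow, div_le_iff₀ (by positivity),
      Complex.norm_real, Real.norm_of_nonneg (by linarith)]
    calc c * Real.exp P ≤ c * ((1 + Real.exp P) ^ 2 * Real.exp (-|w.re|)) := by gcongr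
      _ = c * s⁻¹ ^ 2 * Real.exp (-|w.re|) * (s * (1 + Real.exp P)) ^ 2 := by field_simp
      _ ≤ _ := by gcongr

lemma kern_lower_of_sin {c s : ℝ} {w : ℂ} (h : s ≤ |Real.sin (c * w.im / 2)|) :
    s * (1 + Real.exp (c * w.re)) ≤ ‖1 - Complex.exp (c * w)‖ := by
  have := norm_one_sub_exp_ge (c * w)
  rw [Complex.re_ofReal_mul, Complex.im_ofReal_mul] at this
  refine le_trans ?_ this
  gcongr

lemma one_sub_exp_ne_zero_of_sin {c : ℝ} {w : ℂ} (h : Real.sin (c * w.im / 2) ≠ 0) :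
    1 - Complex.exp (c * w) ≠ 0 := by
  have h1 := kern_lower_of_sin (c := c) (w := w) le_rfl
  have h2 : 0 < |Real.sin (c * w.im / 2)| * (1 + Real.exp (c * w.re)) :=
    mul_pos (abs_pos.mpr h) (by positivity)
  exact norm_pos_iff.mp (h2.trans_le h1)

/-- Along a line every such kernel tends to 0 on the left and to 1 on the right, whatever its
frequency. Hence differences decay at both ends, which is the reason for a normalising term. -/
lemma norm_kern_sub_kern_le {c c' s s' : ℝ} (hc : 1 ≤ c) (hc' : 1 ≤ c') (hs : 0 < s) (hs' : 0 < s')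
    {p p' : ℂ} {b x : ℝ}
    (h : s * (1 + Real.exp (c * (p - linePt b x).re)) ≤ ‖1 - Complex.exp (c * (p - linePt b x))‖)
    (h' : s' * (1 + Real.exp (c' * (p' - linePt b x).re)) ≤
      ‖1 - Complex.exp (c' * (p' - linePt b x))‖) :
    ‖kern c (p - linePt b x) - kern c' (p' - linePt b x)‖
      ≤ (s⁻¹ * Real.exp |p.re| + s'⁻¹ * Real.exp |p'.re|) * Real.exp (-|x|) := by
  obtain ⟨a1, a2, -⟩ := kern_bounds hc hs h
  obtain ⟨b1, b2, -⟩ := kern_bounds hc' hs' h'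
  simp only [Complex.sub_re, linePt_re] at a1 a2 b1 b2
  rw [add_mul, mul_assoc, mul_assoc, ← Real.exp_add, ← Real.exp_add]
  have i1 := inv_pos.mpr hs
  have i2 := inv_pos.mpr hs'
  rcases le_total 0 x with hx | hx
  · have e : kern c (p - linePt b x) - kern c' (p' - linePt b x)
        = (kern c (p - linePt b x) - 1) - (kern c' (p' - linePt b x) - 1) := by ring
    rw [e, abs_of_nonneg hx]
    refine (norm_sub_le _ _).trans (add_le_add (a2.trans ?_) (b2.trans ?_))
    · gcongr; linarith [le_abs_self p.re]
    · gcongr; linarith [le_abs_self p'.re]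
  · rw [abs_of_nonpos hx]
    refine (norm_sub_le _ _).trans (add_le_add (a1.trans ?_) (b1.trans ?_))
    · gcongr; linarith [neg_abs_le p.re]
    · gcongr; linarith [neg_abs_le p'.re]

/-- Half of the exponential decay absorbs the linear growth. -/
lemma norm_mul_le_exp {f k : ℂ} {x C A : ℝ} (hf : ‖f‖ ≤ C * (1 + |x|))
    (hk : ‖k‖ ≤ A * Real.exp (-|x|)) : ‖f * k‖ ≤ 2 * C * A * Real.exp (-(1 / 2) * |x|) := by
  rw [norm_mul]
  have h1 : 1 + |x| ≤ 2 * Real.exp (1 / 2 * |x|) := by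
    have := Real.add_one_le_exp (1 / 2 * |x|)
    have := abs_nonneg x
    linarith
  have hC : 0 ≤ C := by
    have := (norm_nonneg f).trans hf
    have h2 : 0 < 1 + |x| := by positivity
    nlinarith
  have hA : 0 ≤ A := by
    have := (norm_nonneg k).trans hk
    have h2 := Real.exp_pos (-|x|)
    nlinarith
  calc ‖f‖ * ‖k‖ ≤ (C * (2 * Real.exp (1 / 2 * |x|))) * (A * Real.exp (-|x|)) := by
        refine mul_le_mul (hf.trans ?_) hk (norm_nonneg _) (by positivity)
        gcongr
    _ = 2 * C * A * (Real.exp (1 / 2 * |x|) * Real.exp (-|x|)) := by ring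
    _ = _ := by rw [← Real.exp_add]; ring_nf

lemma continuous_kern_line {c : ℝ} {p : ℂ} {b : ℝ} (h : Real.sin (c * (p.im - b) / 2) ≠ 0) :
    Continuous (fun x => kern c (p - linePt b x)) := by
  have hl := continuous_linePt b
  refine Continuous.div continuous_const (by fun_prop) fun x => one_sub_exp_ne_zero_of_sin ?_
  simpa [linePt_im] using h

lemma continuous_ell_line {lam b : ℝ} (hb : b ∈ Ioo ((2 + lam) / 2) ((3 + lam) / 2)) :
    Continuous (fun x => ell lam (linePt b x)) := (isLogBranch_ell hb).1

/-- The difference of two kernels, integrated against `log(-Φ)`. -/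
lemma integrable_ell_mul_kern_sub {lam b c c' : ℝ} (hb : b ∈ Ioo ((2 + lam) / 2) ((3 + lam) / 2))
    (hc : 1 ≤ c) (hc' : 1 ≤ c') {p p' : ℂ} (h : Real.sin (c * (p.im - b) / 2) ≠ 0)
    (h' : Real.sin (c' * (p'.im - b) / 2) ≠ 0) :
    Integrable (fun x => ell lam (linePt b x) *
      (kern c (p - linePt b x) - kern c' (p' - linePt b x))) := by
  obtain ⟨C, -, hC⟩ := exists_norm_ell_le hb.1 hb.2
  refine Integrable.mono' ((integrable_exp_neg_mul_abs (m := 1 / 2) (by norm_num)).const_mul _)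
    ((continuous_ell_line hb).mul
      ((continuous_kern_line h).sub (continuous_kern_line h'))).aestronglyMeasurable
    (Eventually.of_forall fun x => norm_mul_le_exp (hC b x le_rfl le_rfl)
      (norm_kern_sub_kern_le hc hc' (abs_pos.mpr h) (abs_pos.mpr h') (kern_lower_of_sin ?_)
        (kern_lower_of_sin ?_)))
  · simp [linePt_im]
  · simp [linePt_im]

/-- The point with `kern 1 (refPt - η) = 1/(1 + e^{-(η - 2i)})`. -/
noncomputable def refPt : ℂ := ((Real.pi + 2 : ℝ) : ℂ) * Complex.I

lemma refPt_re : refPt.re = 0 := by simp [refPt]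

lemma refPt_im : refPt.im = Real.pi + 2 := by simp [refPt]

/-- The sine equals cos(1 - b/2), with 1 - b/2 small. The reference kernel thus has no pole near any
admissible contour, unlike the normalising term of the statement, and contours can be moved freely.
-/
lemma sin_refPt {b : ℝ} (h1 : 3 / 2 < b) (h2 : b < 5 / 2) :
    1 / 2 ≤ |Real.sin (1 * (refPt.im - b) / 2)| := by
  have e : 1 * (refPt.im - b) / 2 = (1 - b / 2) + Real.pi / 2 := by rw [refPt_im]; ring
  rw [e, Real.sin_add_pi_div_two]
  have := Real.one_sub_sq_div_two_le_cos (x := 1 - b / 2)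
  refine le_trans ?_ (le_abs_self _)
  nlinarith

/-- The frequency `4π/(λ-1)` of the kernel. -/
noncomputable def freq (lam : ℝ) : ℝ := 4 * Real.pi / (lam - 1)

lemma freq_mul {lam : ℝ} (h1 : 1 < lam) (t : ℝ) : freq lam * t / 2 = Real.pi * (t / ((lam - 1) / 2)) := by
  have : lam - 1 ≠ 0 := by linarith
  rw [freq]; field_simp; ring

lemma kern_add_period {lam : ℝ} (h1 : 1 < lam) (w : ℂ) :
    kern (freq lam) (w + (lam - 1) / 2 * Complex.I) = kern (freq lam) w := by
  have hne : (lam : ℂ) - 1 ≠ 0 := by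
    intro h0
    have : lam = 1 := by exact_mod_cast sub_eq_zero.mp h0
    linarith
  have e : (freq lam : ℂ) * (w + (lam - 1) / 2 * Complex.I)
      = freq lam * w + 2 * Real.pi * Complex.I := by
    rw [freq]; push_cast; field_simp; ring
  rw [kern, e, Complex.exp_periodic]
  rfl

section
variable {lam : ℝ} (h1 : 1 < lam) (h2 : lam < 2)
include h1 h2

lemma one_le_freq : 1 ≤ freq lam := by
  rw [freq, le_div_iff₀ (by linarith)]
  linarith [Real.pi_gt_three]

omit h2 in
-- For these t the argument of the sine stays in a compact part of (-π, 0); the bound keeps contours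
-- uniformly away from the poles.
lemma exists_sin_lower {u v : ℝ} (hu : -((lam - 1) / 2) < u) (hv : v < 0) :
    ∃ s : ℝ, 0 < s ∧ ∀ t : ℝ, u ≤ t → t ≤ v → s ≤ |Real.sin (freq lam * t / 2)| := by
  rcases lt_or_ge v u with huv | huv
  · exact ⟨1, one_pos, fun t ht1 ht2 => by linarith⟩
  have hc : ContinuousOn (fun t => |Real.sin (freq lam * t / 2)|) (Icc u v) := by fun_prop
  obtain ⟨t₀, ht₀, hmin⟩ := isCompact_Icc.exists_isMinOn (nonempty_Icc.mpr huv) hc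
  refine ⟨_, ?_, fun t ht1 ht2 => hmin ⟨ht1, ht2⟩⟩
  have ha : 0 < (lam - 1) / 2 := by linarith
  have hneg : Real.sin (freq lam * t₀ / 2) < 0 := by
    rw [freq_mul h1]
    have hpi := Real.pi_pos
    apply Real.sin_neg_of_neg_of_neg_pi_lt
    · exact mul_neg_of_pos_of_neg hpi (div_neg_of_neg_of_pos (by linarith [ht₀.2]) ha)
    · have : -1 < t₀ / ((lam - 1) / 2) := by rw [lt_div_iff₀ ha]; linarith [ht₀.1]
      nlinarith
  exact abs_pos.mpr hneg.ne

omit h2 in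
lemma sin_freq_ne_zero {t : ℝ} (hu : -((lam - 1) / 2) < t) (hv : t < 0) :
    Real.sin (freq lam * t / 2) ≠ 0 := by
  obtain ⟨s, hs, h⟩ := exists_sin_lower h1 hu hv
  exact abs_pos.mp (hs.trans_le (h t le_rfl le_rfl))

end

/-- The regularised Cauchy integrand. -/
noncomputable def cauchyF (lam : ℝ) (ξ η : ℂ) : ℂ :=
  ell lam η * (kern (freq lam) (ξ - η) - kern 1 (refPt - η))

/-- The contours `Im η = b` admissible for the point `ξ`. -/
def Adm (lam b : ℝ) (ξ : ℂ) : Prop :=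
  b ∈ Ioo ((2 + lam) / 2) ((3 + lam) / 2) ∧ b - (lam - 1) / 2 < ξ.im ∧ ξ.im < b

section
variable {lam : ℝ} (h1 : 1 < lam) (h2 : lam < 2)
include h1 h2

omit h2 in
lemma Adm.sin_ne_zero {b : ℝ} {ξ : ℂ} (h : Adm lam b ξ) :
    Real.sin (freq lam * (ξ.im - b) / 2) ≠ 0 :=
  sin_freq_ne_zero h1 (by linarith [h.2.1]) (by linarith [h.2.2])

lemma sin_refPt_ne_zero {b : ℝ} (hb : b ∈ Ioo ((2 + lam) / 2) ((3 + lam) / 2)) :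
    Real.sin (1 * (refPt.im - b) / 2) ≠ 0 :=
  abs_pos.mp (lt_of_lt_of_le (by norm_num) (sin_refPt (by linarith [hb.1]) (by linarith [hb.2])))

lemma lineIntegrable_cauchyF_of_sin {b : ℝ} {ξ : ℂ} (hb : b ∈ Ioo ((2 + lam) / 2) ((3 + lam) / 2))
    (h : Real.sin (freq lam * (ξ.im - b) / 2) ≠ 0) :
    LineIntegrable (cauchyF lam ξ) b :=
  integrable_ell_mul_kern_sub hb (one_le_freq h1 h2) le_rfl h (sin_refPt_ne_zero h1 h2 hb)

lemma norm_cauchyF_le {b x C s : ℝ} {ξ : ℂ} (hb : b ∈ Ioo ((2 + lam) / 2) ((3 + lam) / 2))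
    (hC : ‖ell lam (linePt b x)‖ ≤ C * (1 + |x|)) (hs : 0 < s)
    (h : s * (1 + Real.exp (freq lam * (ξ - linePt b x).re))
      ≤ ‖1 - Complex.exp (freq lam * (ξ - linePt b x))‖) :
    ‖cauchyF lam ξ (linePt b x)‖ ≤ 2 * C * (s⁻¹ * Real.exp |ξ.re| + 2) * Real.exp (-(1 / 2) * |x|) := by
  refine norm_mul_le_exp hC ?_
  have := norm_kern_sub_kern_le (one_le_freq h1 h2) le_rfl hs (s' := 1 / 2) (by norm_num) h
    (kern_lower_of_sin (w := refPt - linePt b x) (by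
      simpa [linePt_im] using sin_refPt (b := b) (by linarith [hb.1]) (by linarith [hb.2])))
  rw [refPt_re, abs_zero, Real.exp_zero] at this
  norm_num at this ⊢
  exact this

lemma differentiableAt_cauchyF {ξ η : ℂ} (hη : η ∈ stripU lam)
    (h : 1 - Complex.exp (freq lam * (ξ - η)) ≠ 0) : DifferentiableAt ℂ (cauchyF lam ξ) η := by
  have hr : Real.sin (1 * (refPt - η).im / 2) ≠ 0 := by
    have := sin_refPt_ne_zero h1 h2 (b := η.im) hη
    rwa [Complex.sub_im]
  have e1 : DifferentiableAt ℂ (fun η => kern (freq lam) (ξ - η)) η :=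
    DifferentiableAt.comp η (g := kern (freq lam)) (f := fun η => ξ - η) (hasDerivAt_kern h).differentiableAt (differentiableAt_id.const_sub ξ)
  have e2 : DifferentiableAt ℂ (fun η => kern 1 (refPt - η)) η :=
    DifferentiableAt.comp η (g := kern 1) (f := fun η => refPt - η) (hasDerivAt_kern (one_sub_exp_ne_zero_of_sin hr)).differentiableAt
      (differentiableAt_id.const_sub refPt)
  exact (differentiableAt_ell hη).mul (e1.sub e2)

/-- Independence of the contour. -/
lemma lineIntegral_cauchyF_eq_of_le {b b' : ℝ} {ξ : ℂ} (hbb : b ≤ b') (hb : Adm lam b ξ)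
    (hb' : Adm lam b' ξ) : lineIntegral (cauchyF lam ξ) b = lineIntegral (cauchyF lam ξ) b' := by
  obtain ⟨s, hs, hs'⟩ := exists_sin_lower h1 (u := ξ.im - b') (v := ξ.im - b)
    (by linarith [hb'.2.1]) (by linarith [hb.2.2])
  obtain ⟨C, -, hC⟩ := exists_norm_ell_le hb.1.1 hb'.1.2
  refine lineIntegral_eq_of_differentiableAt hbb (fun z hz1 hz2 => ?_)
    (lineIntegrable_cauchyF_of_sin h1 h2 hb.1 (hb.sin_ne_zero h1))
    (lineIntegrable_cauchyF_of_sin h1 h2 hb'.1 (hb'.sin_ne_zero h1)) (fun ε hε => ?_)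
  · refine differentiableAt_cauchyF h1 h2 ⟨by linarith [hb.1.1], by linarith [hb'.1.2]⟩
      (one_sub_exp_ne_zero_of_sin (abs_pos.mp (hs.trans_le ?_)))
    rw [Complex.sub_im]
    exact hs' _ (by linarith) (by linarith)
  · obtain ⟨X, hX⟩ := exists_abs_ge_exp_le (m := 1 / 2) (C := 2 * C * (s⁻¹ * Real.exp |ξ.re| + 2))
      (by norm_num) hε
    refine ⟨X, fun x d hx hd1 hd2 => (norm_cauchyF_le h1 h2
      ⟨by linarith [hb.1.1], by linarith [hb'.1.2]⟩ (hC d x hd1 hd2) hs ?_).trans (hX x hx)⟩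
    refine kern_lower_of_sin ?_
    rw [Complex.sub_im, linePt_im]
    exact hs' _ (by linarith) (by linarith)

lemma lineIntegral_cauchyF_eq {b b' : ℝ} {ξ : ℂ} (hb : Adm lam b ξ)
    (hb' : Adm lam b' ξ) : lineIntegral (cauchyF lam ξ) b = lineIntegral (cauchyF lam ξ) b' := by
  rcases le_total b b' with h | h
  · exact lineIntegral_cauchyF_eq_of_le h1 h2 h hb hb'
  · exact (lineIntegral_cauchyF_eq_of_le h1 h2 h hb' hb).symm

/-- Crossing the pole `η = ξ` of the kernel. -/
lemma lineIntegral_cauchyF_sub {b b' : ℝ} {ξ : ℂ} (hb : b ∈ Ioo ((2 + lam) / 2) ((3 + lam) / 2))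
    (hb' : b' ∈ Ioo ((2 + lam) / 2) ((3 + lam) / 2)) (hξ : b < ξ.im) (hξ' : ξ.im < b')
    (hd : b' - b < (lam - 1) / 2) :
    lineIntegral (cauchyF lam ξ) b - lineIntegral (cauchyF lam ξ) b'
      = (lam - 1) / 2 * Complex.I * ell lam ξ := by
  have hU : ξ ∈ stripU lam := ⟨by linarith [hb.1], by linarith [hb'.2]⟩
  have hsin : ∀ t : ℝ, -((lam - 1) / 2) < t → t < (lam - 1) / 2 → t ≠ 0 →
      Real.sin (freq lam * t / 2) ≠ 0 := by
    intro t ht1 ht2 ht0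
    rcases lt_or_gt_of_ne ht0 with h | h
    · exact sin_freq_ne_zero h1 ht1 h
    · have := sin_freq_ne_zero h1 (t := -t) (by linarith) (by linarith)
      rw [mul_neg, neg_div, Real.sin_neg] at this
      exact neg_ne_zero.mp this
  -- Half the available slack: the strip enlarged by e still lies where log(-Φ) is holomorphic, and
  -- it contains no translate of the pole ξ by a nonzero period.
  set e : ℝ := min (min (b - (2 + lam) / 2) ((3 + lam) / 2 - b')) ((lam - 1) / 2 - (b' - b)) / 2 with he
  have he0 : 0 < e := by
    have : 0 < min (min (b - (2 + lam) / 2) ((3 + lam) / 2 - b')) ((lam - 1) / 2 - (b' - b)) :=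
      lt_min (lt_min (by linarith [hb.1]) (by linarith [hb'.2])) (by linarith)
    linarith
  have m1 := min_le_left (min (b - (2 + lam) / 2) ((3 + lam) / 2 - b')) ((lam - 1) / 2 - (b' - b))
  have m2 := min_le_right (min (b - (2 + lam) / 2) ((3 + lam) / 2 - b')) ((lam - 1) / 2 - (b' - b))
  have m3 := min_le_left (b - (2 + lam) / 2) ((3 + lam) / 2 - b')
  have m4 := min_le_right (b - (2 + lam) / 2) ((3 + lam) / 2 - b')
  have hfne : (freq lam : ℂ) ≠ 0 := by
    have := one_le_freq h1 h2
    exact Complex.ofReal_ne_zero.mpr (by linarith)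
  have hexp : ∀ z ∈ stripU lam, z ≠ ξ → |ξ.im - z.im| < (lam - 1) / 2 →
      1 - Complex.exp (freq lam * (ξ - z)) ≠ 0 := by
    intro z hz hzne hzi
    by_cases him : ξ.im = z.im
    · intro h0
      have hre : ξ.re - z.re ≠ 0 := fun h => hzne (Complex.ext (by linarith) him.symm)
      have h3 : Complex.exp (freq lam * (ξ - z)) = 1 := (sub_eq_zero.mp h0).symm
      have h4 := congrArg norm h3
      rw [Complex.norm_exp, norm_one, Real.exp_eq_one_iff, Complex.re_ofReal_mul, Complex.sub_re] at h4
      have := one_le_freq h1 h2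
      rcases mul_eq_zero.mp h4 with h | h
      · linarith
      · exact hre h
    · rw [abs_lt] at hzi
      refine one_sub_exp_ne_zero_of_sin ?_
      rw [Complex.sub_im]
      exact hsin _ hzi.1 hzi.2 (sub_ne_zero.mpr him)
  obtain ⟨C, hC0, hC⟩ := exists_norm_ell_le hb.1 hb'.2
  have hres : Tendsto (fun z => (z - ξ) * cauchyF lam ξ z) (𝓝[≠] ξ) (𝓝 (ell lam ξ * (freq lam : ℂ)⁻¹)) := by
    -- The product is the reciprocal of the difference quotient of z ↦ -e^{c(ξ-z)} at ξ, whose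
    -- derivative there is c.
    have hk : Tendsto (fun z => (z - ξ) * kern (freq lam) (ξ - z)) (𝓝[≠] ξ) (𝓝 (freq lam : ℂ)⁻¹) := by
      have hder : HasDerivAt (fun z => -Complex.exp (freq lam * (ξ - z))) (freq lam : ℂ) ξ := by
        have := ((((hasDerivAt_id ξ).const_sub ξ).const_mul (freq lam : ℂ)).cexp).neg
        simpa using! this
      have ht := (hasDerivAt_iff_tendsto_slope.mp hder).inv₀ hfne
      refine ht.congr' ?_
      filter_upwards [self_mem_nhdsWithin] with z hz
      rw [slope_def_field, inv_div, kern, sub_self, mul_zero, Complex.exp_zero]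
      rw [mul_one_div]
      congr 1
      ring
    have hl : Tendsto (ell lam) (𝓝[≠] ξ) (𝓝 (ell lam ξ)) :=
      (differentiableAt_ell hU).continuousAt.tendsto.mono_left nhdsWithin_le_nhds
    have hchi : Tendsto (fun z => (z - ξ) * kern 1 (refPt - z)) (𝓝[≠] ξ) (𝓝 0) := by
      have hr : Real.sin (1 * (refPt - ξ).im / 2) ≠ 0 := by
        have := sin_refPt_ne_zero h1 h2 (b := ξ.im) hU
        rwa [Complex.sub_im]
      have c1 : ContinuousAt (fun z => kern 1 (refPt - z)) ξ :=
        ContinuousAt.comp (g := kern 1) (f := fun z => refPt - z)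
          (hasDerivAt_kern (one_sub_exp_ne_zero_of_sin hr)).continuousAt (by fun_prop)
      have c2 : ContinuousAt (fun z => (z - ξ) * kern 1 (refPt - z)) ξ :=
        ContinuousAt.mul (by fun_prop) c1
      have := c2.tendsto
      simp only [sub_self, zero_mul] at this
      exact this.mono_left nhdsWithin_le_nhds
    have := hl.mul (hk.sub hchi)
    rw [sub_zero] at this
    refine this.congr fun z => ?_
    rw [cauchyF]; ring
  have hfin := lineIntegral_sub_eq_residue hξ hξ' he0 (f := cauchyF lam ξ) (fun z hz1 hz2 hzne => ?_) hres
    (lineIntegrable_cauchyF_of_sin h1 h2 hb (hsin _ (by linarith) (by linarith) (by linarith)))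
    (lineIntegrable_cauchyF_of_sin h1 h2 hb' (hsin _ (by linarith) (by linarith) (by linarith))) ?_
  · rw [hfin, freq]
    have hne : (lam : ℂ) - 1 ≠ 0 := by
      intro h0
      have : lam = 1 := by exact_mod_cast sub_eq_zero.mp h0
      linarith
    have hpi : (Real.pi : ℂ) ≠ 0 := Complex.ofReal_ne_zero.mpr Real.pi_ne_zero
    push_cast
    field_simp
    ring
  · have hzU : z ∈ stripU lam := ⟨by linarith, by linarith⟩
    refine differentiableAt_cauchyF h1 h2 hzU (hexp z hzU hzne ?_)
    rw [abs_lt]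
    constructor <;> linarith
  · intro ε hε
    obtain ⟨X, hX⟩ := exists_abs_ge_exp_le (m := 1 / 2) (C := 2 * C * ((1 / 4)⁻¹ * Real.exp |ξ.re| + 2))
      (by norm_num) hε
    -- The contours sweep across the height of ξ, where the sine bound degenerates; distance 1 in
    -- the real direction replaces it.
    refine ⟨max X (|ξ.re| + 1), fun x d hx hd1 hd2 => (norm_cauchyF_le h1 h2
      ⟨by linarith [hb.1], by linarith [hb'.2]⟩ (hC d x hd1 hd2) (s := 1 / 4) (by norm_num) ?_).trans
        (hX x ((le_max_left _ _).trans hx))⟩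
    have hx2 := (le_max_right _ _).trans hx
    have hre : 1 ≤ |((freq lam : ℂ) * (ξ - linePt d x)).re| := by
      rw [Complex.re_ofReal_mul, Complex.sub_re, linePt_re, abs_mul,
        abs_of_pos (by linarith [one_le_freq h1 h2])]
      have h3 := abs_sub_abs_le_abs_sub x ξ.re
      rw [abs_sub_comm] at h3
      nlinarith [one_le_freq h1 h2]
    have := norm_one_sub_exp_ge_of_one_le_abs hre
    rwa [Complex.re_ofReal_mul] at this

/-- The Cauchy integral is holomorphic in `ξ`. -/
lemma hasDerivAt_lineIntegral_cauchyF {b : ℝ} {ξ : ℂ} (h : Adm lam b ξ) :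
    Integrable (fun x => ell lam (linePt b x) * kernDeriv (freq lam) (ξ - linePt b x)) ∧
    HasDerivAt (fun ξ => lineIntegral (cauchyF lam ξ) b)
      (∫ x, ell lam (linePt b x) * kernDeriv (freq lam) (ξ - linePt b x)) ξ := by
  set r : ℝ := min (ξ.im - (b - (lam - 1) / 2)) (b - ξ.im) / 2 with hr
  have m1 := min_le_left (ξ.im - (b - (lam - 1) / 2)) (b - ξ.im)
  have m2 := min_le_right (ξ.im - (b - (lam - 1) / 2)) (b - ξ.im)
  have hr0 : 0 < r := by
    have : 0 < min (ξ.im - (b - (lam - 1) / 2)) (b - ξ.im) :=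
      lt_min (by linarith [h.2.1]) (by linarith [h.2.2])
    linarith
  have hball : ∀ z ∈ Metric.ball ξ r, ξ.im - r ≤ z.im ∧ z.im ≤ ξ.im + r ∧ |z.re| ≤ |ξ.re| + r := by
    intro z hz
    rw [Metric.mem_ball, dist_eq_norm] at hz
    have i1 := (Complex.abs_im_le_norm (z - ξ)).trans hz.le
    have i2 := (Complex.abs_re_le_norm (z - ξ)).trans hz.le
    rw [Complex.sub_im, abs_le] at i1
    rw [Complex.sub_re] at i2
    have := abs_sub_abs_le_abs_sub z.re ξ.re
    exact ⟨by linarith, by linarith, by linarith⟩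
  have hadm : ∀ z ∈ Metric.ball ξ r, Adm lam b z := fun z hz =>
    ⟨h.1, by linarith [(hball z hz).1, h.2.1], by linarith [(hball z hz).2.1, h.2.2]⟩
  obtain ⟨s, hs, hs'⟩ := exists_sin_lower h1 (u := ξ.im - r - b) (v := ξ.im + r - b)
    (by linarith [h.2.1]) (by linarith [h.2.2])
  obtain ⟨C, hC0, hC⟩ := exists_norm_ell_le h.1.1 h.1.2
  have hda : ∀ z ∈ Metric.ball ξ r, ∀ x, HasDerivAt (fun z => cauchyF lam z (linePt b x))
      (ell lam (linePt b x) * kernDeriv (freq lam) (z - linePt b x)) z := by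
    intro z hz x
    have hne : 1 - Complex.exp (freq lam * (z - linePt b x)) ≠ 0 :=
      one_sub_exp_ne_zero_of_sin (by
        rw [Complex.sub_im, linePt_im]; exact (hadm z hz).sin_ne_zero h1)
    have := HasDerivAt.comp z (hasDerivAt_kern hne) ((hasDerivAt_id z).sub_const (linePt b x))
    rw [mul_one] at this
    exact (this.sub_const _).const_mul _
  have key := hasDerivAt_integral_of_norm_le (F := fun z x => cauchyF lam z (linePt b x)) hr0
    ((integrable_exp_neg_mul_abs (m := 1 / 2) (by norm_num)).const_mul
      (2 * C * (s⁻¹ * Real.exp (|ξ.re| + r) + 2)))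
    (fun z hz => (lineIntegrable_cauchyF_of_sin h1 h2 h.1
      ((hadm z hz).sin_ne_zero h1)).aestronglyMeasurable)
    (fun x z hz => (hda z hz x).differentiableAt.differentiableWithinAt)
    (fun z hz x => ?_)
  · have e : (fun x => deriv (fun z => cauchyF lam z (linePt b x)) ξ)
        = fun x => ell lam (linePt b x) * kernDeriv (freq lam) (ξ - linePt b x) :=
      funext fun x => (hda ξ (Metric.mem_ball_self hr0) x).deriv
    rw [e] at key
    exact key
  · refine (norm_cauchyF_le h1 h2 h.1 (hC b x le_rfl le_rfl) hs (kern_lower_of_sin ?_)).trans ?_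
    · rw [Complex.sub_im, linePt_im]
      exact hs' _ (by linarith [(hball z hz).1]) (by linarith [(hball z hz).2.1])
    · have := (hball z hz).2.2
      gcongr

end

end WienerHopf

/-! ### The Cauchy integral on the whole strip: difference equation and asymptotics. -/

namespace WienerHopf
open MeasureTheory Set

/-- An admissible contour for `ξ`. -/
noncomputable def contour (lam : ℝ) (ξ : ℂ) : ℝ :=
  (max ξ.im ((2 + lam) / 2) + min (ξ.im + (lam - 1) / 2) ((3 + lam) / 2)) / 2

/-- The Cauchy integral, as a function on the whole strip `stripS`. -/
noncomputable def cauchyS (lam : ℝ) (ξ : ℂ) : ℂ := lineIntegral (cauchyF lam ξ) (contour lam ξ)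

/-- The exponential of the Cauchy integral. -/
noncomputable def expCauchy (lam : ℝ) (ξ : ℂ) : ℂ :=
  Complex.exp (2 / ((lam - 1) * Complex.I) * cauchyS lam ξ)

lemma isOpen_stripS (lam : ℝ) : IsOpen (stripS lam) :=
  (isOpen_lt continuous_const Complex.continuous_im).inter
    (isOpen_lt Complex.continuous_im continuous_const)

lemma Adm.mem_stripS {lam b : ℝ} {ξ : ℂ} (h : Adm lam b ξ) : ξ ∈ stripS lam :=
  ⟨by linarith [h.1.1, h.2.1], by linarith [h.1.2, h.2.2]⟩

lemma adm_contour {lam : ℝ} (h1 : 1 < lam) {ξ : ℂ} (h : ξ ∈ stripS lam) :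
    Adm lam (contour lam ξ) ξ := by
  have hlt : max ξ.im ((2 + lam) / 2) < min (ξ.im + (lam - 1) / 2) ((3 + lam) / 2) := by
    refine max_lt (lt_min ?_ ?_) (lt_min ?_ ?_) <;> linarith [h.1, h.2]
  have m1 := le_max_left ξ.im ((2 + lam) / 2)
  have m2 := le_max_right ξ.im ((2 + lam) / 2)
  have m3 := min_le_left (ξ.im + (lam - 1) / 2) ((3 + lam) / 2)
  have m4 := min_le_right (ξ.im + (lam - 1) / 2) ((3 + lam) / 2)
  unfold contour
  refine ⟨⟨?_, ?_⟩, ?_, ?_⟩ <;> linarith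

lemma Adm.eventually {lam b : ℝ} {ξ : ℂ} (h : Adm lam b ξ) : ∀ᶠ z in 𝓝 ξ, Adm lam b z := by
  have o : IsOpen {z : ℂ | b - (lam - 1) / 2 < z.im ∧ z.im < b} :=
    (isOpen_lt continuous_const Complex.continuous_im).inter
      (isOpen_lt Complex.continuous_im continuous_const)
  filter_upwards [o.mem_nhds h.2] with z hz using ⟨h.1, hz⟩

lemma lam_sub_one_ne_zero {lam : ℝ} (h1 : 1 < lam) : (lam : ℂ) - 1 ≠ 0 := by
  intro h0
  have : lam = 1 := by exact_mod_cast sub_eq_zero.mp h0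
  linarith

lemma expCauchy_ne_zero (lam : ℝ) (ξ : ℂ) : expCauchy lam ξ ≠ 0 := Complex.exp_ne_zero _

lemma norm_expCauchy (lam : ℝ) (ξ : ℂ) :
    ‖expCauchy lam ξ‖ = Real.exp (2 / (lam - 1) * (cauchyS lam ξ).im) := by
  rw [expCauchy, Complex.norm_exp]
  congr 1
  have : (2 : ℂ) / ((lam - 1) * Complex.I) = ((2 / (lam - 1) : ℝ) : ℂ) * (-Complex.I) := by
    rw [div_mul_eq_div_div, Complex.div_I]; push_cast; ring
  rw [this, mul_assoc, Complex.re_ofReal_mul]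
  congr 1
  simp

section
variable {lam : ℝ} (h1 : 1 < lam) (h2 : lam < 2)
include h1 h2

lemma cauchyS_eq {b : ℝ} {ξ : ℂ} (h : Adm lam b ξ) :
    cauchyS lam ξ = lineIntegral (cauchyF lam ξ) b :=
  lineIntegral_cauchyF_eq h1 h2 (adm_contour h1 h.mem_stripS) h

lemma hasDerivAt_cauchyS {b : ℝ} {ξ : ℂ} (h : Adm lam b ξ) :
    HasDerivAt (cauchyS lam)
      (∫ x, ell lam (linePt b x) * kernDeriv (freq lam) (ξ - linePt b x)) ξ :=
  (hasDerivAt_lineIntegral_cauchyF h1 h2 h).2.congr_of_eventuallyEq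
    (h.eventually.mono fun _ hz => cauchyS_eq h1 h2 hz)

lemma differentiableAt_cauchyS {ξ : ℂ} (h : ξ ∈ stripS lam) : DifferentiableAt ℂ (cauchyS lam) ξ :=
  (hasDerivAt_cauchyS h1 h2 (adm_contour h1 h)).differentiableAt

lemma differentiableAt_expCauchy {ξ : ℂ} (h : ξ ∈ stripS lam) :
    DifferentiableAt ℂ (expCauchy lam) ξ :=
  ((differentiableAt_cauchyS h1 h2 h).const_mul _).cexp

/-- By periodicity η and ξ = η + i(λ-1)/2 have the same integrand. Their admissible contours lie on
opposite sides of ξ, so the two Cauchy integrals differ by the residue at ξ. -/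
lemma expCauchy_eq {η : ℂ} (hη : 3 / 2 < η.im) (hη' : η.im < 2) :
    expCauchy lam η = -expCauchy lam (η + (lam - 1) / 2 * Complex.I) *
      Phi lam (η + (lam - 1) / 2 * Complex.I) := by
  set ξ := η + (lam - 1) / 2 * Complex.I with hξ
  have him : ξ.im = η.im + (lam - 1) / 2 := by simp [hξ]
  have hU : ξ ∈ stripU lam := ⟨by linarith, by linarith⟩
  -- `b` lies between η and ξ and serves η; `b'` lies above ξ and serves ξ. They are less than one
  -- period apart, so no other pole is crossed.
  set b := (max ((2 + lam) / 2) η.im + ξ.im) / 2 with hb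
  have m1 := le_max_left ((2 + lam) / 2) η.im
  have m2 := le_max_right ((2 + lam) / 2) η.im
  have m3 : max ((2 + lam) / 2) η.im < ξ.im := max_lt hU.1 (by linarith)
  set b' := (ξ.im + min ((3 + lam) / 2) (b + (lam - 1) / 2)) / 2 with hb'
  have m4 := min_le_left ((3 + lam) / 2) (b + (lam - 1) / 2)
  have m5 := min_le_right ((3 + lam) / 2) (b + (lam - 1) / 2)
  have m6 : ξ.im < min ((3 + lam) / 2) (b + (lam - 1) / 2) := lt_min hU.2 (by linarith)
  have a1 : Adm lam b η := ⟨⟨by linarith, by linarith [hU.2]⟩, by linarith, by linarith⟩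
  have a2 : Adm lam b' ξ := ⟨⟨by linarith [hU.1], by linarith⟩, by linarith, by linarith⟩
  have hF : cauchyF lam ξ = cauchyF lam η := by
    funext z
    rw [cauchyF, cauchyF, hξ, show η + (lam - 1) / 2 * Complex.I - z
      = η - z + (lam - 1) / 2 * Complex.I by ring, kern_add_period h1]
  have key := lineIntegral_cauchyF_sub h1 h2 (ξ := ξ) a1.1 a2.1 (by linarith) (by linarith) (by linarith)
  rw [← cauchyS_eq h1 h2 a2, hF, ← cauchyS_eq h1 h2 a1] at key
  have e : expCauchy lam η = expCauchy lam ξ * Complex.exp (ell lam ξ) := by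
    rw [expCauchy, expCauchy, ← Complex.exp_add]
    congr 1
    have := lam_sub_one_ne_zero h1
    have hI := Complex.I_ne_zero
    have hk : cauchyS lam η = cauchyS lam ξ + (lam - 1) / 2 * Complex.I * ell lam ξ := by
      linear_combination key
    rw [hk]
    field_simp
  rw [e, exp_ell hU]
  ring

/-- Along the contour the kernel rises from 0 to 1, and its derivative in x is minus `kernDeriv`. -/
lemma integral_kernDeriv {b s : ℝ} {ξ : ℂ} (hs : 0 < s)
    (h : s ≤ |Real.sin (freq lam * (ξ.im - b) / 2)|) :
    Integrable (fun x => kernDeriv (freq lam) (ξ - linePt b x)) ∧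
      ∫ x, kernDeriv (freq lam) (ξ - linePt b x) = -1 := by
  have hf := one_le_freq h1 h2
  have hb : ∀ x, _ := fun x => kern_bounds (w := ξ - linePt b x) hf hs
    (kern_lower_of_sin (by rwa [Complex.sub_im, linePt_im]))
  have hne : ∀ x, 1 - Complex.exp (freq lam * (ξ - linePt b x)) ≠ 0 := fun x =>
    one_sub_exp_ne_zero_of_sin (abs_pos.mp (hs.trans_le (by rwa [Complex.sub_im, linePt_im])))
  have hl := continuous_linePt b
  have hi : Integrable (fun x => kernDeriv (freq lam) (ξ - linePt b x)) := by
    have hint := ((integrable_exp_neg_mul_abs one_pos).comp_sub_right ξ.re).const_mul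
      (freq lam * s⁻¹ ^ 2)
    refine hint.mono' ?_ (Eventually.of_forall fun x => ?_)
    · refine Continuous.aestronglyMeasurable ?_
      unfold kernDeriv
      exact Continuous.div (by fun_prop) (by fun_prop) fun x => pow_ne_zero 2 (hne x)
    · have := (hb x).2.2
      rwa [Complex.sub_re, linePt_re, abs_sub_comm, ← neg_one_mul |x - ξ.re|] at this
  refine ⟨hi, ?_⟩
  have hd : ∀ x : ℝ, HasDerivAt (fun x => kern (freq lam) (ξ - linePt b x))
      (-kernDeriv (freq lam) (ξ - linePt b x)) x := by
    intro x
    have d1 : HasDerivAt (fun w : ℂ => ξ - (w + b * Complex.I)) (-1) (x : ℂ) := by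
      simpa using ((hasDerivAt_id (x : ℂ)).add_const ((b : ℂ) * Complex.I)).const_sub ξ
    have d2 := (HasDerivAt.comp (x : ℂ) (h₂ := kern (freq lam))
      (h := fun w : ℂ => ξ - (w + b * Complex.I)) (hasDerivAt_kern (hne x)) d1).comp_ofReal
    rw [mul_neg_one] at d2
    exact d2
  have t0 : Tendsto (fun x : ℝ => kern (freq lam) (ξ - linePt b x)) atBot (𝓝 0) := by
    refine squeeze_zero_norm (a := fun x => s⁻¹ * Real.exp (x - ξ.re)) (fun x => ?_) ?_
    · have := (hb x).1
      rwa [Complex.sub_re, linePt_re, neg_sub] at this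
    · have := (Real.tendsto_exp_atBot.comp
        (tendsto_atBot_add_const_right atBot (-ξ.re) tendsto_id)).const_mul s⁻¹
      rw [mul_zero] at this
      exact this
  have t1 : Tendsto (fun x : ℝ => kern (freq lam) (ξ - linePt b x)) atTop (𝓝 1) := by
    rw [tendsto_iff_norm_sub_tendsto_zero]
    refine squeeze_zero (g := fun x => s⁻¹ * Real.exp (ξ.re - x)) (fun x => norm_nonneg _) (fun x => ?_) ?_
    · have := (hb x).2.1
      rwa [Complex.sub_re, linePt_re] at this
    · have := (Real.tendsto_exp_atBot.comp
        (tendsto_atBot_add_const_left atTop ξ.re tendsto_neg_atTop_atBot)).const_mul s⁻¹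
      rw [mul_zero] at this
      exact this
  have := integral_of_hasDerivAt_of_tendsto hd hi.neg t0 t1
  rw [integral_neg, sub_zero] at this
  rw [← this, neg_neg]

/-- The derivative of the Cauchy integral is asymptotic to `-log(-Φ)`. -/
lemma exists_deriv_error {b d₁ d₂ : ℝ} (hb : b ∈ Ioo ((2 + lam) / 2) ((3 + lam) / 2))
    (hd₁ : b - (lam - 1) / 2 < d₁) (hd₂ : d₂ < b) :
    ∃ m : ℝ → ℝ, Tendsto m atTop (𝓝 0) ∧ Tendsto m atBot (𝓝 0) ∧
      ∀ ξ : ℂ, d₁ ≤ ξ.im → ξ.im ≤ d₂ →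
        ‖(∫ x, ell lam (linePt b x) * kernDeriv (freq lam) (ξ - linePt b x))
          + ell lam (linePt b ξ.re)‖ ≤ m ξ.re := by
  obtain ⟨s, hs, hs'⟩ := exists_sin_lower h1 (u := d₁ - b) (v := d₂ - b)
    (by linarith) (by linarith)
  obtain ⟨C, hC0, hC⟩ := exists_norm_ell_sub_le hb
  set A := freq lam * s⁻¹ ^ 2 with hA
  have hA0 : 0 ≤ A := by have := one_le_freq h1 h2; positivity
  have hbd : ∀ r u : ℝ, ‖ell lam (linePt b (r + u)) - ell lam (linePt b r)‖ * (A * Real.exp (-|u|))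
      ≤ 2 * C * A * Real.exp (-(1 / 2) * |u|) := by
    intro r u
    have h3 := hC (r + u) r
    rw [add_sub_cancel_left] at h3
    have h4 := norm_mul_le_exp (k := ((A * Real.exp (-|u|) : ℝ) : ℂ)) (A := A) h3 (by
      rw [Complex.norm_real, Real.norm_of_nonneg (by positivity)])
    rwa [norm_mul, Complex.norm_real, Real.norm_of_nonneg (by positivity)] at h4
  have hcont : ∀ r : ℝ, Continuous fun u : ℝ =>
      ‖ell lam (linePt b (r + u)) - ell lam (linePt b r)‖ * (A * Real.exp (-|u|)) := by
    intro r
    have := (continuous_ell_line hb).comp (continuous_const.add continuous_id : Continuous fun u : ℝ => r + u)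
    have h3 : Continuous fun u : ℝ => ell lam (linePt b (r + u)) := this
    fun_prop
  have hgint := (integrable_exp_neg_mul_abs (m := 1 / 2) (by norm_num)).const_mul (2 * C * A)
  -- An average of the oscillation of log(-Φ) around r. It tends to 0 by slow variation, with
  -- dominated convergence supplied by the linear bound on increments.
  set m : ℝ → ℝ := fun r => ∫ u : ℝ,
    ‖ell lam (linePt b (r + u)) - ell lam (linePt b r)‖ * (A * Real.exp (-|u|)) with hm
  have hlim : ∀ l : Filter ℝ, l.IsCountablyGenerated → Tendsto (fun x : ℝ => |x|) l atTop →
      Tendsto m l (𝓝 0) := by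
    intro l _ hl
    have := tendsto_integral_filter_of_dominated_convergence (μ := volume) (l := l)
      (F := fun r u => ‖ell lam (linePt b (r + u)) - ell lam (linePt b r)‖ * (A * Real.exp (-|u|)))
      (f := fun _ => (0 : ℝ)) (fun u => 2 * C * A * Real.exp (-(1 / 2) * |u|))
      (Eventually.of_forall fun r => (hcont r).aestronglyMeasurable)
      (Eventually.of_forall fun r => Eventually.of_forall fun u => by
        rw [Real.norm_of_nonneg (by positivity)]; exact hbd r u)
      hgint
      (Eventually.of_forall fun u => by
        have := (tendsto_ell_shift_sub hb u hl).norm.mul_const (A * Real.exp (-|u|))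
        rwa [norm_zero, zero_mul] at this)
    rwa [integral_zero] at this
  refine ⟨m, hlim _ inferInstance tendsto_abs_atTop_atTop, hlim _ inferInstance tendsto_abs_atBot_atTop,
    fun ξ hξ1 hξ2 => ?_⟩
  have hsin := hs' (ξ.im - b) (by linarith) (by linarith)
  obtain ⟨ki, kv⟩ := integral_kernDeriv h1 h2 hs hsin
  have hadm : Adm lam b ξ := ⟨hb, by linarith, by linarith⟩
  have hi := (hasDerivAt_lineIntegral_cauchyF h1 h2 hadm).1
  -- Since the kernel derivative has integral -1, adding log(-Φ) at Re ξ subtracts a constant under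
  -- the integral.
  have e : (∫ x, ell lam (linePt b x) * kernDeriv (freq lam) (ξ - linePt b x)) + ell lam (linePt b ξ.re)
      = ∫ x, (ell lam (linePt b x) - ell lam (linePt b ξ.re)) * kernDeriv (freq lam) (ξ - linePt b x) := by
    simp only [sub_mul]
    rw [integral_sub hi (ki.const_mul _), integral_const_mul, kv]
    ring
  rw [e, ← integral_add_left_eq_self _ ξ.re]
  refine norm_integral_le_of_norm_le (hgint.mono' (hcont ξ.re).aestronglyMeasurable
    (Eventually.of_forall fun u => ?_)) (Eventually.of_forall fun u => ?_)
  · rw [Real.norm_of_nonneg (by positivity)]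
    exact hbd _ u
  · rw [norm_mul]
    have h3 := (kern_bounds (w := ξ - linePt b (ξ.re + u)) (one_le_freq h1 h2) hs
      (kern_lower_of_sin (by rwa [Complex.sub_im, linePt_im]))).2.2
    rw [Complex.sub_re, linePt_re, sub_add_cancel_left, abs_neg] at h3
    gcongr

end

/-- Mean value inequality for φ + qs on the right ray and φ - qs on the left ray, starting from the
bound K on [-X, X]. -/
lemma abs_add_mul_abs_le {φ φ' : ℝ → ℝ} {q δ K X : ℝ} (hq : 0 ≤ q) (hδ : 0 ≤ δ) (hX : 0 ≤ X)
    (hφ : ∀ s, HasDerivAt φ (φ' s) s) (hK : ∀ s, |s| ≤ X → |φ s| ≤ K)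
    (htop : ∀ s, X ≤ s → |φ' s + q| ≤ δ) (hbot : ∀ s, s ≤ -X → |φ' s - q| ≤ δ) (s : ℝ) :
    |(φ s + q * |s|)| ≤ δ * |s| + (K + q * X) := by
  have hqX : 0 ≤ q * X := by positivity
  rcases le_or_gt |s| X with h | h
  · have h3 := hK s h
    have h4 : q * |s| ≤ q * X := by gcongr
    have h5 : 0 ≤ q * |s| := by positivity
    have h6 : 0 ≤ δ * |s| := by positivity
    rw [abs_le] at h3 ⊢
    constructor <;> linarith
  · rcases lt_abs.mp h with h | h
    · have hd : ∀ t ∈ Ici X, HasDerivWithinAt (fun t => φ t + q * t) (φ' t + q) (Ici X) t := by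
        intro t _
        have := (hφ t).add ((hasDerivAt_id t).const_mul q)
        rw [mul_one] at this
        exact this.hasDerivWithinAt
      have := Convex.norm_image_sub_le_of_norm_hasDerivWithin_le hd
        (fun t ht => htop t ht) (convex_Ici X) self_mem_Ici h.le
      simp only [Real.norm_eq_abs] at this
      rw [abs_of_pos (by linarith : 0 < s - X)] at this
      have h3 := hK X (abs_of_nonneg hX).le
      rw [abs_of_pos (by linarith : 0 < s)]
      have h6 : 0 ≤ δ * X := by positivity
      rw [abs_le] at h3 this ⊢
      constructor <;> nlinarith
    · have hd : ∀ t ∈ Iic (-X), HasDerivWithinAt (fun t => φ t - q * t) (φ' t - q) (Iic (-X)) t := by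
        intro t _
        have := (hφ t).sub ((hasDerivAt_id t).const_mul q)
        rw [mul_one] at this
        exact this.hasDerivWithinAt
      have := Convex.norm_image_sub_le_of_norm_hasDerivWithin_le hd
        (fun t ht => hbot t ht) (convex_Iic (-X)) self_mem_Iic (by simp only [mem_Iic]; linarith : s ∈ Iic (-X))
      simp only [Real.norm_eq_abs] at this
      rw [abs_of_neg (by linarith : s - -X < 0)] at this
      have h3 := hK (-X) (by rw [abs_neg, abs_of_nonneg hX])
      rw [abs_of_neg (by linarith : s < 0)]
      have h6 : 0 ≤ δ * X := by positivity
      rw [abs_le] at h3 this ⊢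
      constructor <;> nlinarith

section
variable {lam : ℝ} (h1 : 1 < lam) (h2 : lam < 2)
include h1 h2

lemma im_cauchyS_asymp_line {b d₁ d₂ δ : ℝ} (hb : b ∈ Ioo ((2 + lam) / 2) ((3 + lam) / 2))
    (hd₁ : b - (lam - 1) / 2 < d₁) (hd₂ : d₂ < b) (hδ : 0 < δ) :
    ∃ C : ℝ, ∀ ξ : ℂ, d₁ ≤ ξ.im → ξ.im ≤ d₂ →
      |((cauchyS lam ξ).im + Real.pi / 4 * |ξ.re|)| ≤ δ * |ξ.re| + C := by
  obtain ⟨m, mt, mb, hm⟩ := exists_deriv_error h1 h2 hb hd₁ hd₂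
  -- Half of δ covers the error of the derivative, the other half the distance of the argument of -Φ
  -- from ±π/4.
  have et := (mt.eventually_le_const (half_pos hδ)).and
    ((tendsto_im_ell_atTop hb).eventually (Metric.closedBall_mem_nhds _ (half_pos hδ)))
  have eb := (mb.eventually_le_const (half_pos hδ)).and
    ((tendsto_im_ell_atBot hb).eventually (Metric.closedBall_mem_nhds _ (half_pos hδ)))
  obtain ⟨X₁, hX₁⟩ := eventually_atTop.mp et
  obtain ⟨X₂, hX₂⟩ := eventually_atBot.mp eb
  set X := max (max X₁ (-X₂)) 0 with hX
  have x0 : 0 ≤ X := le_max_right _ _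
  have x1 : X₁ ≤ X := (le_max_left _ _).trans (le_max_left _ _)
  have x2 : -X₂ ≤ X := (le_max_right _ _).trans (le_max_left _ _)
  have hcpt : IsCompact (Icc (-X) X ×ℂ Icc d₁ d₂) := isCompact_Icc.reProdIm isCompact_Icc
  have hadm : ∀ ξ : ℂ, d₁ ≤ ξ.im → ξ.im ≤ d₂ → Adm lam b ξ := fun ξ k1 k2 =>
    ⟨hb, by linarith, by linarith⟩
  -- The rectangle covers all heights in [d₁, d₂] at once, so the constant is uniform in Im ξ.
  obtain ⟨K, hK⟩ := hcpt.exists_bound_of_continuousOn (f := cauchyS lam) fun ξ hξ =>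
    (hasDerivAt_cauchyS h1 h2 (hadm ξ hξ.2.1 hξ.2.2)).continuousAt.continuousWithinAt
  refine ⟨K + Real.pi / 4 * X, fun ξ k1 k2 => ?_⟩
  set D : ℝ → ℂ := fun s => ∫ x, ell lam (linePt b x) * kernDeriv (freq lam) (linePt ξ.im s - linePt b x)
  have hline : ∀ s, Adm lam b (linePt ξ.im s) := fun s =>
    hadm _ (by rwa [linePt_im]) (by rwa [linePt_im])
  have herr : ∀ s, |(D s).im + (ell lam (linePt b s)).im| ≤ m s := by
    intro s
    have := hm (linePt ξ.im s) (by rwa [linePt_im]) (by rwa [linePt_im])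
    rw [linePt_re] at this
    refine le_trans ?_ this
    rw [← Complex.add_im]
    exact Complex.abs_im_le_norm _
  have key := abs_add_mul_abs_le (φ := fun s => (cauchyS lam (linePt ξ.im s)).im) (φ' := fun s => (D s).im)
    (q := Real.pi / 4) (δ := δ) (K := K) (X := X) (by positivity) hδ.le x0
    (fun s => ?_) (fun s hs => ?_) (fun s hs => ?_) (fun s hs => ?_) ξ.re
  · simpa only [linePt_re_im] using key
  · have d1 : HasDerivAt (fun w : ℂ => w + ξ.im * Complex.I) 1 (s : ℂ) :=
      (hasDerivAt_id (s : ℂ)).add_const _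
    have d2 := (HasDerivAt.comp (s : ℂ) (h₂ := cauchyS lam) (h := fun w : ℂ => w + ξ.im * Complex.I)
      (hasDerivAt_cauchyS h1 h2 (hline s)) d1).comp_ofReal
    rw [mul_one] at d2
    exact Complex.imCLM.hasFDerivAt.comp_hasDerivAt s d2
  · refine (Complex.abs_im_le_norm _).trans (hK _ ⟨?_, ?_⟩)
    · simpa [linePt_re] using abs_le.mp hs
    · simp only [mem_preimage, linePt_im]; exact ⟨k1, k2⟩
  · obtain ⟨q1, q2⟩ := hX₁ s (x1.trans hs)
    have q3 := herr s
    rw [Real.dist_eq] at q2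
    rw [abs_le] at q2 q3 ⊢
    constructor <;> linarith
  · obtain ⟨q1, q2⟩ := hX₂ s (by linarith)
    have q3 := herr s
    rw [Real.dist_eq] at q2
    rw [abs_le] at q2 q3 ⊢
    constructor <;> linarith

/-- The asymptotics of the Cauchy integral on closed substrips. -/
lemma im_cauchyS_asymp {e₁ e₂ δ : ℝ} (he₁ : 3 / 2 < e₁) (he₂ : e₂ < (3 + lam) / 2) (hδ : 0 < δ) :
    ∃ C : ℝ, ∀ ξ : ℂ, ξ.im ∈ Icc e₁ e₂ →
      |((cauchyS lam ξ).im + Real.pi / 4 * |ξ.re|)| ≤ δ * |ξ.re| + C := by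
  -- One contour serves only a range of heights, shorter than the strip; compactness patches
  -- finitely many of them.
  refine isCompact_Icc.induction_on (p := fun s => ∃ C : ℝ, ∀ ξ : ℂ, ξ.im ∈ s →
      |((cauchyS lam ξ).im + Real.pi / 4 * |ξ.re|)| ≤ δ * |ξ.re| + C) ⟨0, fun ξ h => absurd h (by simp)⟩
      ?_ ?_ ?_
  · rintro s t hst ⟨C, hC⟩
    exact ⟨C, fun ξ h => hC ξ (hst h)⟩
  · rintro s t ⟨C, hC⟩ ⟨C', hC'⟩
    refine ⟨max C C', fun ξ h => ?_⟩
    rcases h with h | h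
    · exact (hC ξ h).trans (by gcongr; exact le_max_left _ _)
    · exact (hC' ξ h).trans (by gcongr; exact le_max_right _ _)
  · intro e he
    have hS : linePt e 0 ∈ stripS lam := by
      simp only [stripS, mem_ofPred_eq, linePt_im]
      exact ⟨by linarith [he.1], by linarith [he.2]⟩
    obtain ⟨hb, k1, k2⟩ := adm_contour h1 hS
    set b := contour lam (linePt e 0)
    rw [linePt_im] at k1 k2
    obtain ⟨C, hC⟩ := im_cauchyS_asymp_line h1 h2 hb (d₁ := (b - (lam - 1) / 2 + e) / 2)
      (d₂ := (e + b) / 2) (by linarith) (by linarith) hδ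
    refine ⟨Icc ((b - (lam - 1) / 2 + e) / 2) ((e + b) / 2), mem_nhdsWithin_of_mem_nhds
      (Icc_mem_nhds (by linarith) (by linarith)), C, fun ξ hξ => hC ξ hξ.1 hξ.2⟩

end

end WienerHopf

/-! ### Exponential bounds for V up to the edges of the strip. -/

namespace WienerHopf
open MeasureTheory Set

lemma norm_gammaVar_add_half (lam : ℝ) (η : ℂ) :
    ‖gammaVar lam η + 1 / 2‖ = ‖η - (2 + lam) / 2 * Complex.I‖ := by
  have : gammaVar lam η + 1 / 2 = Complex.I * (η - (2 + lam) / 2 * Complex.I) := by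
    rw [gammaVar]; linear_combination ((2 + lam : ℂ) / 2) * Complex.I_sq
  rw [this, norm_mul, Complex.norm_I, one_mul]

lemma norm_gammaVar_add_one (lam : ℝ) (η : ℂ) :
    ‖gammaVar lam η + 1‖ = ‖η - (3 + lam) / 2 * Complex.I‖ := by
  have : gammaVar lam η + 1 = Complex.I * (η - (3 + lam) / 2 * Complex.I) := by
    rw [gammaVar]; linear_combination ((3 + lam : ℂ) / 2) * Complex.I_sq
  rw [this, norm_mul, Complex.norm_I, one_mul]

lemma norm_div_le_of_sub {p q : ℂ} {d : ℝ} (hpq : ‖p - q‖ = 1 / 2) (hd : 0 < d) (hdq : d ≤ ‖q‖) :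
    ‖p / q‖ ≤ 1 + 1 / 2 / d := by
  have hq : q ≠ 0 := norm_pos_iff.mp (hd.trans_le hdq)
  have e : p / q = 1 + (p - q) / q := by field_simp; ring
  rw [e]
  refine (norm_add_le _ _).trans ?_
  rw [norm_one, norm_div, hpq]
  gcongr

lemma norm_exp_logGammaRatio_sq {w : ℂ} (hw : 1 / 2 < w.re) :
    ‖Complex.exp (logGammaRatio w)‖ ^ 2 = ‖w‖ * ‖gammaQuot w‖ := by
  have h0 : w ≠ 0 := fun h => by rw [h] at hw; simp at hw; linarith
  have hq0 : gammaQuot w ≠ 0 := fun h => by have := gammaQuot_re_pos hw; rw [h] at this; simp at this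
  have : ((2 : ℕ) : ℂ) * logGammaRatio w = Complex.log w + Complex.log (gammaQuot w) := by
    unfold logGammaRatio; push_cast; ring
  rw [← norm_pow, ← Complex.exp_nat_mul, this, Complex.exp_add, Complex.exp_log h0,
    Complex.exp_log hq0, norm_mul]

/-- The square of the modulus is |w| times a number between 7/20 and 33/20. The upper bound is
cruder than √|w|, but polynomial growth suffices. -/
lemma norm_exp_logGammaRatio_bounds {w : ℂ} (hw : 1 < w.re) :
    1 / 2 ≤ ‖Complex.exp (logGammaRatio w)‖ ∧ ‖Complex.exp (logGammaRatio w)‖ ≤ 2 * ‖w‖ := by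
  have hw' : 1 / 2 < w.re := by linarith
  have h := norm_exp_logGammaRatio_sq hw'
  have hq := norm_gammaQuot_sub_one_le hw'
  have q1 : ‖gammaQuot w‖ ≤ 33 / 20 := by
    have := norm_sub_norm_le (gammaQuot w) 1
    rw [norm_one] at this
    linarith
  have q2 : 7 / 20 ≤ ‖gammaQuot w‖ := by
    have := norm_sub_norm_le 1 (gammaQuot w)
    rw [norm_one, norm_sub_rev] at this
    linarith
  have w1 : 1 ≤ ‖w‖ := by
    have := Complex.abs_re_le_norm w
    rw [abs_of_pos (by linarith)] at this
    linarith
  have n0 := norm_nonneg (Complex.exp (logGammaRatio w))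
  constructor <;> nlinarith

section
variable {lam : ℝ} (h1 : 1 < lam) (h2 : lam < 2)
include h1 h2

omit h1 h2 in
lemma norm_Phi_eq {η : ℂ} (h : η ∈ stripU lam) :
    ‖Phi lam η‖ = 2 * Real.sqrt Real.pi * (‖Complex.exp (logGammaRatio (gammaVar lam η + 2))‖ *
      ‖(gammaVar lam η + 1) / (gammaVar lam η + 3 / 2)‖ * ‖gammaVar lam η / (gammaVar lam η + 1 / 2)‖) := by
  rw [← norm_neg, Phi_eq_shift h, norm_mul, norm_mul, norm_mul, norm_mul, Complex.norm_real,
    Real.norm_of_nonneg (Real.sqrt_nonneg _)]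
  norm_num

omit h1 h2 in
lemma sqrt_pi_bounds : 1 ≤ Real.sqrt Real.pi ∧ Real.sqrt Real.pi ≤ 2 := by
  constructor
  · rw [Real.one_le_sqrt]; linarith [Real.pi_gt_three]
  · rw [Real.sqrt_le_left (by norm_num)]; linarith [Real.pi_le_four]

/-- The only factor that can be large is the one with denominator z + 1/2, singular at the boundary
pole (2+λ)i/2. -/
lemma norm_Phi_le {r : ℝ} (hr : 0 < r) : ∃ C : ℝ, 0 < C ∧ ∀ η ∈ stripU lam,
    r ≤ ‖η - (2 + lam) / 2 * Complex.I‖ → ‖Phi lam η‖ ≤ C * (1 + ‖η‖) := by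
  refine ⟨2 * 2 * (8 * 2 * (1 + 1 / 2 / r)), by positivity, fun η hη hηr => ?_⟩
  rw [norm_Phi_eq hη]
  rw [← norm_gammaVar_add_half] at hηr
  have hre := gammaVar_re_bounds hη
  have w1 : 1 < (gammaVar lam η + 2).re := by
    simp only [Complex.add_re, Complex.re_ofNat]; linarith
  have b1 := (norm_exp_logGammaRatio_bounds w1).2
  have b0 : ‖gammaVar lam η + 2‖ ≤ 4 * (1 + ‖η‖) := by
    have e : gammaVar lam η + 2 = Complex.I * η + (((lam + 5) / 2 : ℝ) : ℂ) := by
      rw [gammaVar]; push_cast; ring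
    rw [e]
    refine (norm_add_le _ _).trans ?_
    rw [norm_mul, Complex.norm_I, Complex.norm_real, Real.norm_of_nonneg (by linarith)]
    have := norm_nonneg η
    linarith
  have b2 : ‖(gammaVar lam η + 1) / (gammaVar lam η + 3 / 2)‖ ≤ 2 := by
    refine (norm_div_le_of_sub (d := 1 / 2) ?_ (by norm_num) ?_).trans (by norm_num)
    · rw [show gammaVar lam η + 1 - (gammaVar lam η + 3 / 2) = -(1 / 2) by ring]; norm_num
    · refine le_trans ?_ (Complex.abs_re_le_norm _)
      simp only [Complex.add_re, Complex.div_ofNat_re, Complex.re_ofNat]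
      rw [abs_of_pos (by linarith)]; linarith
  have b3 : ‖gammaVar lam η / (gammaVar lam η + 1 / 2)‖ ≤ 1 + 1 / 2 / r := by
    refine norm_div_le_of_sub ?_ hr hηr
    rw [show gammaVar lam η - (gammaVar lam η + 1 / 2) = -(1 / 2) by ring]; norm_num
  have b4 : ‖Complex.exp (logGammaRatio (gammaVar lam η + 2))‖ ≤ 8 * (1 + ‖η‖) := by linarith
  calc _ ≤ 2 * 2 * (8 * (1 + ‖η‖) * 2 * (1 + 1 / 2 / r)) := by
        gcongr; exact sqrt_pi_bounds.2
    _ = _ := by ring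

omit h1 h2 in
-- The only factor that can be small has numerator z + 1, which vanishes at the boundary point
-- (3+λ)i/2.
lemma le_norm_Phi {r : ℝ} (hr : 0 < r) : ∃ c : ℝ, 0 < c ∧ ∀ η ∈ stripU lam,
    r ≤ ‖η - (3 + lam) / 2 * Complex.I‖ → c ≤ ‖Phi lam η‖ := by
  refine ⟨2 * 1 * (1 / 2 * (1 + 1 / 2 / r)⁻¹ * 2⁻¹), by positivity, fun η hη hηr => ?_⟩
  rw [norm_Phi_eq hη]
  rw [← norm_gammaVar_add_one] at hηr
  have hre := gammaVar_re_bounds hη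
  obtain ⟨n1, n2, n3, n4⟩ := gammaVar_factors_ne_zero hη
  have w1 : 1 < (gammaVar lam η + 2).re := by
    simp only [Complex.add_re, Complex.re_ofNat]; linarith
  have b1 := (norm_exp_logGammaRatio_bounds w1).1
  have b2 : (1 + 1 / 2 / r)⁻¹ ≤ ‖(gammaVar lam η + 1) / (gammaVar lam η + 3 / 2)‖ := by
    rw [← inv_div (gammaVar lam η + 3 / 2) (gammaVar lam η + 1), norm_inv]
    refine inv_anti₀ (norm_pos_iff.mpr (div_ne_zero n4 n3)) (norm_div_le_of_sub ?_ hr hηr)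
    rw [show gammaVar lam η + 3 / 2 - (gammaVar lam η + 1) = 1 / 2 by ring]; norm_num
  have b3 : 2⁻¹ ≤ ‖gammaVar lam η / (gammaVar lam η + 1 / 2)‖ := by
    rw [← inv_div, norm_inv]
    refine inv_anti₀ (norm_pos_iff.mpr (div_ne_zero n2 n1))
      ((norm_div_le_of_sub (d := 1 / 2) ?_ (by norm_num) ?_).trans (by norm_num))
    · rw [show gammaVar lam η + 1 / 2 - gammaVar lam η = 1 / 2 by ring]; norm_num
    · refine le_trans ?_ (Complex.abs_re_le_norm _)
      rw [abs_of_neg (by linarith)]; linarith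
  gcongr
  exact sqrt_pi_bounds.1

/-- The middle strip is chosen so that each remaining edge layer enters it after one shift by
(λ-1)/2. The asymptotics are used with δ(λ-1)/4, because the modulus multiplies the exponent by
2/(λ-1). -/
lemma expCauchy_bounds_middle {δ : ℝ} (hδ : 0 < δ) : ∃ C : ℝ, 0 < C ∧
    ∀ ξ : ℂ, ξ.im ∈ Icc (3 / 2 + (lam - 1) / 4) ((3 + lam) / 2 - (lam - 1) / 4) →
      C⁻¹ * Real.exp (-(1 / 2) * (Real.pi / (lam - 1) + δ) * ‖ξ‖) ≤ ‖expCauchy lam ξ‖ ∧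
      ‖expCauchy lam ξ‖ ≤ C * Real.exp (-(1 / 2) * (Real.pi / (lam - 1) - δ) * ‖ξ‖) := by
  have hl : 0 < lam - 1 := by linarith
  obtain ⟨C, hC⟩ := im_cauchyS_asymp h1 h2 (e₁ := 3 / 2 + (lam - 1) / 4)
    (e₂ := (3 + lam) / 2 - (lam - 1) / 4) (δ := δ * (lam - 1) / 4) (by linarith) (by linarith)
    (by positivity)
  set K := 2 / (lam - 1) * (C + 3 * Real.pi) with hK
  refine ⟨Real.exp K, Real.exp_pos _, fun ξ hξ => ?_⟩
  have h := hC ξ hξ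
  have n1 := Complex.abs_re_le_norm ξ
  have n2 : ‖ξ‖ ≤ |ξ.re| + 3 := by
    refine (Complex.norm_le_abs_re_add_abs_im ξ).trans ?_
    rw [abs_of_pos (by linarith [hξ.1] : 0 < ξ.im)]
    linarith [hξ.2]
  have hpi := Real.pi_pos
  rw [abs_le] at h
  have e0 : 0 ≤ |ξ.re| := abs_nonneg _
  have k1 : (cauchyS lam ξ).im ≤ -(Real.pi / 4) * ‖ξ‖ + δ * (lam - 1) / 4 * ‖ξ‖ + (C + 3 * Real.pi) := by
    have : δ * (lam - 1) / 4 * |ξ.re| ≤ δ * (lam - 1) / 4 * ‖ξ‖ := by gcongr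
    nlinarith
  have k2 : -(Real.pi / 4) * ‖ξ‖ - δ * (lam - 1) / 4 * ‖ξ‖ - (C + 3 * Real.pi) ≤ (cauchyS lam ξ).im := by
    have : δ * (lam - 1) / 4 * |ξ.re| ≤ δ * (lam - 1) / 4 * ‖ξ‖ := by gcongr
    nlinarith
  have hs : 0 < 2 / (lam - 1) := by positivity
  rw [norm_expCauchy, ← Real.exp_neg, ← Real.exp_add, ← Real.exp_add]
  constructor
  · refine Real.exp_le_exp.mpr (le_trans (le_of_eq ?_) (mul_le_mul_of_nonneg_left k2 hs.le))
    rw [hK]; field_simp; ring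
  · refine Real.exp_le_exp.mpr ((mul_le_mul_of_nonneg_left k1 hs.le).trans (le_of_eq ?_))
    rw [hK]; field_simp; ring

omit h1 h2 in
lemma one_add_le_exp {δ t : ℝ} (hδ : 0 < δ) (ht : 0 ≤ t) :
    1 + t ≤ (1 + 1 / δ) * Real.exp (δ * t) := by
  have h3 : 1 ≤ Real.exp (δ * t) := Real.one_le_exp (by positivity)
  have h4 : δ * t ≤ Real.exp (δ * t) := by linarith [Real.add_one_le_exp (δ * t)]
  have h5 : t ≤ 1 / δ * Real.exp (δ * t) := by
    rw [one_div, inv_mul_eq_div, le_div_iff₀ hδ]; linarith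
  linarith

omit h1 h2 in
lemma exp_shift_le {k x y e : ℝ} (hk : |k| ≤ e) (hxy : |x - y| ≤ 1) :
    Real.exp (k * x) ≤ Real.exp e * Real.exp (k * y) := by
  rw [← Real.exp_add]
  refine Real.exp_le_exp.mpr ?_
  have h3 : |k * (x - y)| ≤ e * 1 := by
    rw [abs_mul]; exact mul_le_mul hk hxy (abs_nonneg _) ((abs_nonneg _).trans hk)
  have := (le_abs_self _).trans h3
  linarith

omit h1 h2 in
lemma norm_shift {ξ : ℂ} {t : ℝ} (ht : |t| ≤ 1) : |‖ξ + t * Complex.I‖ - ‖ξ‖| ≤ 1 := by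
  refine (abs_norm_sub_norm_le _ _).trans ?_
  rw [add_sub_cancel_left, norm_mul, Complex.norm_I, mul_one, Complex.norm_real]
  exact ht

/-- The lower bound on the whole strip. -/
lemma expCauchy_lower {δ : ℝ} (hδ : 0 < δ) : ∃ c : ℝ, 0 < c ∧ ∀ ξ ∈ stripS lam,
    c * Real.exp (-(1 / 2) * (Real.pi / (lam - 1) + δ) * ‖ξ‖) ≤ ‖expCauchy lam ξ‖ := by
  have hl : 0 < lam - 1 := by linarith
  obtain ⟨C, hC0, hC⟩ := expCauchy_bounds_middle h1 h2 (half_pos hδ)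
  obtain ⟨c, hc0, hc⟩ := le_norm_Phi (r := 1 / 4) (by norm_num)
  obtain ⟨B, hB0, hB⟩ := norm_Phi_le h1 h2 (r := 1 / 4) (by norm_num)
  set k := -(1 / 2) * (Real.pi / (lam - 1) + δ / 2) with hk
  set k' := -(1 / 2) * (Real.pi / (lam - 1) + δ) with hk'
  have hkk : ∀ x : ℝ, 0 ≤ x → Real.exp (k' * x) ≤ Real.exp (k * x) := by
    intro x hx
    refine Real.exp_le_exp.mpr (mul_le_mul_of_nonneg_right ?_ hx)
    rw [hk, hk']; linarith
  set E := Real.exp |k| with hE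
  have hE0 : 0 < E := Real.exp_pos _
  -- From 1 + x ≤ T e^{δx/4}: the linear growth of Φ costs δ/4 in the exponent, exactly the
  -- difference of `k` and `k'`.
  set T := 1 + 1 / (δ / 4) with hT
  have hT0 : 0 < T := by positivity
  refine ⟨min (C⁻¹) (min (E⁻¹ * C⁻¹ * c) (E⁻¹ * C⁻¹ * (B * T)⁻¹)), by positivity, fun ξ hξ => ?_⟩
  have a1 : |(lam - 1) / 2| ≤ 1 := by rw [abs_of_pos (by linarith)]; linarith
  have a2 : |-((lam - 1) / 2)| ≤ 1 := by rwa [abs_neg]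
  rcases le_or_gt (3 / 2 + (lam - 1) / 4) ξ.im with hb | hb
  · rcases le_or_gt ξ.im ((3 + lam) / 2 - (lam - 1) / 4) with ht | ht
    · refine le_trans ?_ (hC ξ ⟨hb, ht⟩).1
      exact mul_le_mul (min_le_left _ _) (hkk _ (norm_nonneg _)) (Real.exp_pos _).le (by positivity)
    -- Top layer: V(ξ) is -V(ζ)/Φ(ξ), so an upper bound for Φ is needed, and ξ is far from the pole
    -- of Φ. The zero of Φ can only make V larger.
    · set ζ := ξ + (-((lam - 1) / 2) : ℝ) * Complex.I with hζ
      have him : ζ.im = ξ.im - (lam - 1) / 2 := by simp [hζ]; ring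
      have hfe := expCauchy_eq h1 h2 (η := ζ) (by rw [him]; linarith [hξ.2]) (by rw [him]; linarith [hξ.2])
      have hback : ζ + (lam - 1) / 2 * Complex.I = ξ := by rw [hζ]; push_cast; ring
      rw [hback] at hfe
      have hU : ξ ∈ stripU lam := ⟨by linarith, hξ.2⟩
      have hfar : 1 / 4 ≤ ‖ξ - (2 + lam) / 2 * Complex.I‖ := by
        refine le_trans ?_ (Complex.abs_im_le_norm _)
        have : (ξ - (2 + lam) / 2 * Complex.I).im = ξ.im - (2 + lam) / 2 := by simp
        rw [this, abs_of_pos (by linarith)]; linarith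
      have hP := hB ξ hU hfar
      have hP0 : 0 < ‖Phi lam ξ‖ := norm_pos_iff.mpr (Phi_ne_zero hU)
      have hm := (hC ζ ⟨by rw [him]; linarith, by rw [him]; linarith [hξ.2]⟩).1
      have hn : ‖expCauchy lam ζ‖ = ‖expCauchy lam ξ‖ * ‖Phi lam ξ‖ := by
        rw [hfe, norm_mul, norm_neg]
      have hs := exp_shift_le (k := k) (le_refl |k|) (by rw [abs_sub_comm]; exact norm_shift (ξ := ξ) a2)
      have hT' := one_add_le_exp (δ := δ / 4) (by positivity) (norm_nonneg ξ)
      have hsplit : Real.exp (k' * ‖ξ‖) * Real.exp (δ / 4 * ‖ξ‖) = Real.exp (k * ‖ξ‖) := by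
        rw [← Real.exp_add]; congr 1; rw [hk, hk']; ring
      have hmain : E⁻¹ * C⁻¹ * (B * T)⁻¹ * Real.exp (k' * ‖ξ‖) * ‖Phi lam ξ‖ ≤
          ‖expCauchy lam ξ‖ * ‖Phi lam ξ‖ := by
        rw [← hn]
        refine le_trans ?_ hm
        calc E⁻¹ * C⁻¹ * (B * T)⁻¹ * Real.exp (k' * ‖ξ‖) * ‖Phi lam ξ‖
            ≤ E⁻¹ * C⁻¹ * (B * T)⁻¹ * Real.exp (k' * ‖ξ‖) * (B * (T * Real.exp (δ / 4 * ‖ξ‖))) := by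
              gcongr; exact hP.trans (by gcongr)
          _ = E⁻¹ * C⁻¹ * (Real.exp (k' * ‖ξ‖) * Real.exp (δ / 4 * ‖ξ‖)) := by field_simp
          _ = E⁻¹ * C⁻¹ * Real.exp (k * ‖ξ‖) := by rw [hsplit]
          _ ≤ E⁻¹ * C⁻¹ * (E * Real.exp (k * ‖ζ‖)) := by gcongr
          _ = C⁻¹ * Real.exp (k * ‖ζ‖) := by field_simp
      refine le_trans ?_ (le_of_mul_le_mul_right hmain hP0)
      gcongr
      exact (min_le_right _ _).trans (min_le_right _ _)
  -- Bottom layer: V(ξ) is -V(ζ)Φ(ζ), and ζ is far from the zero of Φ.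
  · set ζ := ξ + ((lam - 1) / 2 : ℝ) * Complex.I with hζ
    have him : ζ.im = ξ.im + (lam - 1) / 2 := by simp [hζ]
    have hfe := expCauchy_eq h1 h2 (η := ξ) hξ.1 (by linarith)
    have hback : ξ + (lam - 1) / 2 * Complex.I = ζ := by rw [hζ]; push_cast; ring
    rw [hback] at hfe
    have hU : ζ ∈ stripU lam := ⟨by rw [him]; linarith [hξ.1], by rw [him]; linarith⟩
    have hfar : 1 / 4 ≤ ‖ζ - (3 + lam) / 2 * Complex.I‖ := by
      refine le_trans ?_ (Complex.abs_im_le_norm _)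
      have : (ζ - (3 + lam) / 2 * Complex.I).im = ζ.im - (3 + lam) / 2 := by simp
      rw [this, abs_of_neg (by linarith)]; linarith
    have hP := hc ζ hU hfar
    have hm := (hC ζ ⟨by rw [him]; linarith [hξ.1], by rw [him]; linarith⟩).1
    have hn : ‖expCauchy lam ξ‖ = ‖expCauchy lam ζ‖ * ‖Phi lam ζ‖ := by
      rw [hfe, norm_mul, norm_neg]
    have hs := exp_shift_le (k := k) (le_refl |k|) (by rw [abs_sub_comm]; exact norm_shift (ξ := ξ) a1)
    rw [hn]
    calc _ ≤ E⁻¹ * C⁻¹ * c * Real.exp (k * ‖ξ‖) := by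
          refine mul_le_mul ((min_le_right _ _).trans (min_le_left _ _)) (hkk _ (norm_nonneg _))
            (Real.exp_pos _).le (by positivity)
      _ ≤ E⁻¹ * C⁻¹ * c * (E * Real.exp (k * ‖ζ‖)) := by gcongr
      _ = (C⁻¹ * Real.exp (k * ‖ζ‖)) * c := by field_simp
      _ ≤ _ := by gcongr

/-- The upper bound away from the two boundary poles. -/
lemma expCauchy_upper {δ r : ℝ} (hδ : 0 < δ) (hr : 0 < r) : ∃ C : ℝ, 0 < C ∧ ∀ ξ ∈ stripS lam,
    r ≤ ‖ξ - 3 / 2 * Complex.I‖ → r ≤ ‖ξ - (3 + lam) / 2 * Complex.I‖ →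
    ‖expCauchy lam ξ‖ ≤ C * Real.exp (-(1 / 2) * (Real.pi / (lam - 1) - δ) * ‖ξ‖) := by
  have hl : 0 < lam - 1 := by linarith
  obtain ⟨C, hC0, hC⟩ := expCauchy_bounds_middle h1 h2 (half_pos hδ)
  obtain ⟨c, hc0, hc⟩ := le_norm_Phi hr
  obtain ⟨B, hB0, hB⟩ := norm_Phi_le h1 h2 hr
  set k := -(1 / 2) * (Real.pi / (lam - 1) - δ / 2) with hk
  set k' := -(1 / 2) * (Real.pi / (lam - 1) - δ) with hk'
  have hkk : ∀ x : ℝ, 0 ≤ x → Real.exp (k * x) ≤ Real.exp (k' * x) := by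
    intro x hx
    refine Real.exp_le_exp.mpr (mul_le_mul_of_nonneg_right ?_ hx)
    rw [hk, hk']; linarith
  set E := Real.exp |k| with hE
  have hE0 : 0 < E := Real.exp_pos _
  set T := 1 + 1 / (δ / 4) with hT
  have hT0 : 0 < T := by positivity
  refine ⟨max C (max (C * E / c) (C * E * (B * (2 * T)))), by positivity, fun ξ hξ hr1 hr2 => ?_⟩
  have a1 : |(lam - 1) / 2| ≤ 1 := by rw [abs_of_pos (by linarith)]; linarith
  have a2 : |-((lam - 1) / 2)| ≤ 1 := by rwa [abs_neg]
  rcases le_or_gt (3 / 2 + (lam - 1) / 4) ξ.im with hb | hb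
  · rcases le_or_gt ξ.im ((3 + lam) / 2 - (lam - 1) / 4) with ht | ht
    · refine (hC ξ ⟨hb, ht⟩).2.trans ?_
      exact mul_le_mul (le_max_left _ _) (hkk _ (norm_nonneg _)) (Real.exp_pos _).le (by positivity)
    · set ζ := ξ + (-((lam - 1) / 2) : ℝ) * Complex.I with hζ
      have him : ζ.im = ξ.im - (lam - 1) / 2 := by simp [hζ]; ring
      have hfe := expCauchy_eq h1 h2 (η := ζ) (by rw [him]; linarith [hξ.2]) (by rw [him]; linarith [hξ.2])
      have hback : ζ + (lam - 1) / 2 * Complex.I = ξ := by rw [hζ]; push_cast; ring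
      rw [hback] at hfe
      have hU : ξ ∈ stripU lam := ⟨by linarith, hξ.2⟩
      -- Division by Φ(ξ) near the top edge is where distance from (3+λ)i/2 enters.
      have hP := hc ξ hU hr2
      have hm := (hC ζ ⟨by rw [him]; linarith, by rw [him]; linarith [hξ.2]⟩).2
      have hn : ‖expCauchy lam ζ‖ = ‖expCauchy lam ξ‖ * ‖Phi lam ξ‖ := by
        rw [hfe, norm_mul, norm_neg]
      have hs := exp_shift_le (k := k) (le_refl |k|) (norm_shift (ξ := ξ) a2)
      calc ‖expCauchy lam ξ‖ ≤ ‖expCauchy lam ζ‖ / c := by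
            rw [le_div_iff₀ hc0, hn]; gcongr
        _ ≤ C * Real.exp (k * ‖ζ‖) / c := by gcongr
        _ ≤ C * (E * Real.exp (k * ‖ξ‖)) / c := by gcongr
        _ = C * E / c * Real.exp (k * ‖ξ‖) := by ring
        _ ≤ _ := by
            refine mul_le_mul ((le_max_left _ _).trans (le_max_right _ _)) (hkk _ (norm_nonneg _))
              (Real.exp_pos _).le (by positivity)
  · set ζ := ξ + ((lam - 1) / 2 : ℝ) * Complex.I with hζ
    have him : ζ.im = ξ.im + (lam - 1) / 2 := by simp [hζ]
    have hfe := expCauchy_eq h1 h2 (η := ξ) hξ.1 (by linarith)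
    have hback : ξ + (lam - 1) / 2 * Complex.I = ζ := by rw [hζ]; push_cast; ring
    rw [hback] at hfe
    have hU : ζ ∈ stripU lam := ⟨by rw [him]; linarith [hξ.1], by rw [him]; linarith⟩
    -- The shift carries the excluded point 3i/2 to the pole (2+λ)i/2 of Φ.
    have hfar : r ≤ ‖ζ - (2 + lam) / 2 * Complex.I‖ := by
      refine hr1.trans (le_of_eq ?_)
      congr 1
      rw [hζ]; push_cast; ring
    have hP := hB ζ hU hfar
    have hm := (hC ζ ⟨by rw [him]; linarith [hξ.1], by rw [him]; linarith⟩).2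
    have hn : ‖expCauchy lam ξ‖ = ‖expCauchy lam ζ‖ * ‖Phi lam ζ‖ := by
      rw [hfe, norm_mul, norm_neg]
    have hsh := norm_shift (ξ := ξ) a1
    have hs := exp_shift_le (k := k) (le_refl |k|) hsh
    have hz : 1 + ‖ζ‖ ≤ 2 * (T * Real.exp (δ / 4 * ‖ξ‖)) := by
      have hT' := one_add_le_exp (δ := δ / 4) (by positivity) (norm_nonneg ξ)
      rw [← hT] at hT'
      have h3 := (le_abs_self _).trans hsh
      rw [← hζ] at h3
      have h0 := norm_nonneg ξ
      linarith
    have hsplit : Real.exp (k * ‖ξ‖) * Real.exp (δ / 4 * ‖ξ‖) = Real.exp (k' * ‖ξ‖) := by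
      rw [← Real.exp_add]; congr 1; rw [hk, hk']; ring
    rw [hn]
    calc _ ≤ (C * (E * Real.exp (k * ‖ξ‖))) * (B * (2 * (T * Real.exp (δ / 4 * ‖ξ‖)))) := by
          gcongr
          · exact hm.trans (by gcongr)
          · exact hP.trans (by gcongr)
      _ = C * E * (B * (2 * T)) * (Real.exp (k * ‖ξ‖) * Real.exp (δ / 4 * ‖ξ‖)) := by ring
      _ = C * E * (B * (2 * T)) * Real.exp (k' * ‖ξ‖) := by rw [hsplit]
      _ ≤ _ := by
          gcongr
          exact (le_max_right _ _).trans (le_max_right _ _)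

end

end WienerHopf

/-! ### Meromorphic continuation by iterating the difference equation. -/

namespace WienerHopf
open MeasureTheory Set

/-- The translate `ξ + n (λ-1)i/2`. -/
noncomputable def shift (lam : ℝ) (n : ℤ) (ξ : ℂ) : ℂ := ξ + n * ((lam - 1) / 2 * Complex.I)

lemma shift_im (lam : ℝ) (n : ℤ) (ξ : ℂ) : (shift lam n ξ).im = ξ.im + n * ((lam - 1) / 2) := by
  simp [shift]

lemma shift_shift (lam : ℝ) (m n : ℤ) (ξ : ℂ) :
    shift lam m (shift lam n ξ) = shift lam (m + n) ξ := by
  simp only [shift]; push_cast; ring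

lemma shift_zero (lam : ℝ) (ξ : ℂ) : shift lam 0 ξ = ξ := by simp [shift]

lemma shift_one (lam : ℝ) (ξ : ℂ) : shift lam 1 ξ = ξ + (lam - 1) / 2 * Complex.I := by simp [shift]

/-- The factor relating the values at `ξ` and at `shift lam n ξ` of a solution of the
difference equation. -/
noncomputable def shiftFactor (lam : ℝ) : ℤ → ℂ → ℂ
  | Int.ofNat n, ξ => ∏ j ∈ Finset.range n, -Phi lam (shift lam (j + 1) ξ)
  | Int.negSucc n, ξ => ∏ j ∈ Finset.range (n + 1), (-Phi lam (shift lam (-j) ξ))⁻¹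

lemma shiftFactor_zero (lam : ℝ) (ξ : ℂ) : shiftFactor lam 0 ξ = 1 := by
  change shiftFactor lam (Int.ofNat 0) ξ = 1
  simp [shiftFactor]

/-- Recursion in n with the base point fixed; nonvanishing is what lets an inverse factor cancel
when n is negative. -/
lemma shiftFactor_add_one {lam : ℝ} {n : ℤ} {ξ : ℂ} (h : Phi lam (shift lam (n + 1) ξ) ≠ 0) :
    shiftFactor lam (n + 1) ξ = shiftFactor lam n ξ * -Phi lam (shift lam (n + 1) ξ) := by
  rcases n with n | n
  · change shiftFactor lam (Int.ofNat (n + 1)) ξ = _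
    simp only [shiftFactor, Finset.prod_range_succ, Int.ofNat_eq_natCast]
  · rcases n with _ | n
    · change shiftFactor lam 0 ξ = _
      rw [shiftFactor_zero]
      simp only [shiftFactor, Finset.prod_range_succ, Finset.prod_range_zero, one_mul]
      have e : (Int.negSucc 0 + 1 : ℤ) = -((0 : ℕ) : ℤ) := by simp
      rw [e] at h ⊢
      rw [inv_mul_cancel₀ (neg_ne_zero.mpr h)]
    · have e : (Int.negSucc (n + 1) + 1 : ℤ) = -((n + 1 : ℕ) : ℤ) := by
        rw [Int.negSucc_eq]; push_cast; ring
      have e' : (Int.negSucc (n + 1) + 1 : ℤ) = Int.negSucc n := by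
        rw [Int.negSucc_eq, Int.negSucc_eq]; push_cast; ring
      rw [e] at h
      rw [show shiftFactor lam (Int.negSucc (n + 1) + 1) ξ = shiftFactor lam (Int.negSucc n) ξ by rw [e'],
        e]
      simp only [shiftFactor]
      rw [Finset.prod_range_succ _ (n + 1), mul_assoc, inv_mul_cancel₀ (neg_ne_zero.mpr h), mul_one]

/-- The cocycle property under a change of base point; this is the difference equation for the
extension. -/
lemma shiftFactor_sub_one {lam : ℝ} {n : ℤ} {ξ : ℂ} (h : Phi lam (shift lam 1 ξ) ≠ 0) :
    shiftFactor lam n ξ = -shiftFactor lam (n - 1) (shift lam 1 ξ) * Phi lam (shift lam 1 ξ) := by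
  rcases n with n | n
  · rcases n with _ | n
    · change shiftFactor lam 0 ξ = -shiftFactor lam (Int.negSucc 0) _ * _
      rw [shiftFactor_zero]
      simp only [shiftFactor, Finset.prod_range_succ, Finset.prod_range_zero, one_mul, shift_shift]
      norm_num
      rw [inv_mul_cancel₀ h]
    · have e : (Int.ofNat (n + 1) - 1 : ℤ) = Int.ofNat n := by simp
      rw [e]
      simp only [shiftFactor, shift_shift]
      rw [Finset.prod_range_succ']
      push_cast
      ring
  · have e : (Int.negSucc n - 1 : ℤ) = Int.negSucc (n + 1) := by
      rw [Int.negSucc_eq, Int.negSucc_eq]; push_cast; ring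
    rw [e]
    simp only [shiftFactor, shift_shift]
    rw [Finset.prod_range_succ' _ (n + 1)]
    push_cast
    have e2 : ∀ j : ℕ, (-((j : ℤ) + 1) + 1) = -(j : ℤ) := fun j => by ring
    simp only [e2]
    rw [inv_neg (a := Phi lam (shift lam 1 ξ))]
    rw [mul_neg, neg_neg, mul_assoc, inv_mul_cancel₀ h, mul_one]

lemma meromorphicAt_Phi (lam : ℝ) (ξ : ℂ) : MeromorphicAt (Phi lam) ξ := by
  have hG : ∀ c : ℂ, MeromorphicAt (fun ξ : ℂ => Complex.Gamma (Complex.I * ξ + c)) ξ := by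
    intro c
    exact (Meromorphic.Gamma _).comp_analyticAt (f := Complex.Gamma) (g := fun ξ : ℂ => Complex.I * ξ + c)
      (Differentiable.analyticAt (by fun_prop) ξ)
  have h1 := hG (1 + lam / 2)
  have h2 := hG ((lam + 1) / 2)
  have := (((MeromorphicAt.const (2 * (Real.sqrt Real.pi : ℂ)) ξ).mul h1).div h2).neg
  refine this.congr (Eventually.of_forall fun z => ?_)
  simp only [Phi, Pi.neg_apply, Pi.div_apply, Pi.mul_apply, add_assoc]

lemma meromorphicAt_Phi_shift (lam : ℝ) (n : ℤ) (ξ : ℂ) :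
    MeromorphicAt (fun ξ => -Phi lam (shift lam n ξ)) ξ :=
  ((meromorphicAt_Phi lam _).comp_analyticAt (f := Phi lam) (g := shift lam n)
    (Differentiable.analyticAt (by unfold shift; fun_prop) ξ)).neg

lemma meromorphicAt_shiftFactor (lam : ℝ) (n : ℤ) (ξ : ℂ) : MeromorphicAt (shiftFactor lam n) ξ := by
  have hp : ∀ (f : ℕ → ℂ → ℂ), (∀ j, MeromorphicAt (f j) ξ) → ∀ m : ℕ,
      MeromorphicAt (fun ξ => ∏ j ∈ Finset.range m, f j ξ) ξ := by
    intro f hf m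
    induction m with
    | zero => simp
    | succ m ih =>
      simp only [Finset.prod_range_succ]
      exact ih.mul (hf m)
  rcases n with n | n
  · exact hp _ (fun j => meromorphicAt_Phi_shift lam (j + 1) ξ) n
  · exact hp _ (fun j => (meromorphicAt_Phi_shift lam (-j) ξ).inv) (n + 1)

lemma eventually_codiscrete_Phi_ne_zero {lam : ℝ} (h1 : 1 < lam) :
    ∀ᶠ η in codiscrete ℂ, Phi lam (shift lam 1 η) ≠ 0 := by
  set f : ℂ → ℂ := fun η => (Complex.Gamma (Complex.I * shift lam 1 η + 1 + lam / 2))⁻¹ *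
    (Complex.Gamma (Complex.I * shift lam 1 η + (lam + 1) / 2))⁻¹ with hf
  have hs : Differentiable ℂ (shift lam 1) := by unfold shift; fun_prop
  have d1 : Differentiable ℂ f := by
    refine Differentiable.mul ?_ ?_
    · exact Complex.differentiable_one_div_Gamma.comp
        (g := fun s => (Complex.Gamma s)⁻¹) (f := fun η => Complex.I * shift lam 1 η + 1 + lam / 2)
        (by fun_prop)
    · exact Complex.differentiable_one_div_Gamma.comp
        (g := fun s => (Complex.Gamma s)⁻¹) (f := fun η => Complex.I * shift lam 1 η + (lam + 1) / 2)
        (by fun_prop)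
  -- At this point the shifted argument is 0 and both Gamma factors are evaluated at positive reals,
  -- so the entire function 1/(ΓΓ) is not identically zero.
  have hf0 : f (-Complex.I * ((lam - 1) / 2)) ≠ 0 := by
    have e : shift lam 1 (-Complex.I * ((lam - 1) / 2)) = 0 := by rw [shift_one]; ring
    simp only [hf, e, mul_zero, zero_add]
    refine mul_ne_zero (inv_ne_zero (Complex.Gamma_ne_zero_of_re_pos ?_))
      (inv_ne_zero (Complex.Gamma_ne_zero_of_re_pos ?_))
    · simp; linarith
    · simp; linarith
  have hm := AnalyticOnNhd.preimage_zero_mem_codiscrete (f := f) (x := -Complex.I * ((lam - 1) / 2))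
    (fun z _ => d1.analyticAt z) hf0
  filter_upwards [hm] with η hη
  have hη' : f η ≠ 0 := hη
  obtain ⟨q1, q2⟩ := mul_ne_zero_iff.mp hη'
  have hpi : (Real.sqrt Real.pi : ℂ) ≠ 0 := by
    rw [Complex.ofReal_ne_zero]; positivity
  rw [Phi, neg_ne_zero]
  exact div_ne_zero (mul_ne_zero (mul_ne_zero two_ne_zero hpi) (inv_eq_zero.not.mp q1)) (inv_eq_zero.not.mp q2)

/-- The number of periods by which `ξ` is moved into the strip. -/
noncomputable def stripIndex (lam : ℝ) (ξ : ℂ) : ℤ := ⌊(3 / 2 - ξ.im) / ((lam - 1) / 2)⌋ + 1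

/-- The meromorphic extension of `expCauchy`. -/
noncomputable def extCauchy (lam : ℝ) (ξ : ℂ) : ℂ :=
  shiftFactor lam (stripIndex lam ξ) ξ * expCauchy lam (shift lam (stripIndex lam ξ) ξ)

lemma shift_stripIndex_mem {lam : ℝ} (h1 : 1 < lam) (ξ : ℂ) :
    shift lam (stripIndex lam ξ) ξ ∈ stripS lam := by
  have ha : 0 < (lam - 1) / 2 := by linarith
  have f1 := Int.floor_le ((3 / 2 - ξ.im) / ((lam - 1) / 2))
  have f2 := Int.lt_floor_add_one ((3 / 2 - ξ.im) / ((lam - 1) / 2))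
  rw [le_div_iff₀ ha] at f1
  rw [div_lt_iff₀ ha] at f2
  simp only [stripS, mem_ofPred_eq, shift_im, stripIndex]
  push_cast
  constructor
  · linarith
  · linarith

section
variable {lam : ℝ} (h1 : 1 < lam) (h2 : lam < 2)
include h1 h2

lemma shiftFactor_mul_step {n : ℤ} {ξ : ℂ} (hn : shift lam n ξ ∈ stripS lam)
    (hn' : shift lam (n + 1) ξ ∈ stripS lam) :
    shiftFactor lam (n + 1) ξ * expCauchy lam (shift lam (n + 1) ξ)
      = shiftFactor lam n ξ * expCauchy lam (shift lam n ξ) := by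
  have him : (shift lam (n + 1) ξ).im = (shift lam n ξ).im + (lam - 1) / 2 := by
    rw [shift_im, shift_im]; push_cast; ring
  have hU : shift lam (n + 1) ξ ∈ stripU lam := ⟨by rw [him]; linarith [hn.1], by linarith [hn'.2]⟩
  have hlt := hn'.2
  have h3 := expCauchy_eq h1 h2 (η := shift lam n ξ) hn.1 (by rw [him] at hlt; linarith)
  have e : shift lam n ξ + (lam - 1) / 2 * Complex.I = shift lam (n + 1) ξ := by
    rw [← shift_one, shift_shift, add_comm]
  rw [e] at h3
  rw [shiftFactor_add_one (Phi_ne_zero hU), h3]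
  ring

/-- The strip has width λ/2, more than one period, so several translates of a point may lie in it.
All give the same value, which allows a locally constant choice of n. -/
lemma shiftFactor_mul_eq_of_le {m n : ℤ} {ξ : ℂ} (hmn : m ≤ n) (hm : shift lam m ξ ∈ stripS lam)
    (hn : shift lam n ξ ∈ stripS lam) :
    shiftFactor lam n ξ * expCauchy lam (shift lam n ξ)
      = shiftFactor lam m ξ * expCauchy lam (shift lam m ξ) := by
  induction n, hmn using Int.leInduction with
  | base => rfl
  | succ k hk ih =>
    have hk' : shift lam k ξ ∈ stripS lam := by
      simp only [stripS, mem_ofPred_eq, shift_im] at hm hn ⊢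
      push_cast at hn
      have hmk : (m : ℝ) ≤ k := by exact_mod_cast hk
      constructor <;> nlinarith [hm.1, hn.2]
    rw [shiftFactor_mul_step h1 h2 hk' hn, ih hk']

lemma extCauchy_eq {n : ℤ} {ξ : ℂ} (hn : shift lam n ξ ∈ stripS lam) :
    extCauchy lam ξ = shiftFactor lam n ξ * expCauchy lam (shift lam n ξ) := by
  have hm := shift_stripIndex_mem h1 ξ
  rcases le_total (stripIndex lam ξ) n with h | h
  · exact (shiftFactor_mul_eq_of_le h1 h2 h hm hn).symm
  · exact shiftFactor_mul_eq_of_le h1 h2 h hn hm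

lemma extCauchy_eq_expCauchy {ξ : ℂ} (h : ξ ∈ stripS lam) : extCauchy lam ξ = expCauchy lam ξ := by
  rw [extCauchy_eq h1 h2 (n := 0) (by rwa [shift_zero]), shiftFactor_zero, shift_zero, one_mul]

lemma meromorphicAt_extCauchy (ξ : ℂ) : MeromorphicAt (extCauchy lam) ξ := by
  set n := stripIndex lam ξ
  have hm : shift lam n ξ ∈ stripS lam := shift_stripIndex_mem h1 ξ
  have hs : Differentiable ℂ (shift lam n) := by unfold shift; fun_prop
  have hev : ∀ᶠ z in 𝓝 ξ, shift lam n z ∈ stripS lam :=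
    hs.continuous.continuousAt.eventually ((isOpen_stripS lam).mem_nhds hm)
  have ha : AnalyticAt ℂ (fun z => expCauchy lam (shift lam n z)) ξ := by
    have h3 : AnalyticAt ℂ (expCauchy lam) (shift lam n ξ) :=
      DifferentiableOn.analyticAt (s := stripS lam)
        (fun z hz => (differentiableAt_expCauchy h1 h2 hz).differentiableWithinAt)
        ((isOpen_stripS lam).mem_nhds hm)
    exact h3.comp (hs.analyticAt ξ)
  refine ((meromorphicAt_shiftFactor lam n ξ).mul ha.meromorphicAt).congr ?_
  refine (hev.mono fun z hz => ?_).filter_mono nhdsWithin_le_nhds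
  exact (extCauchy_eq h1 h2 hz).symm

lemma eventually_extCauchy_eq : ∀ᶠ η in codiscrete ℂ,
    extCauchy lam η = -extCauchy lam (η + (lam - 1) / 2 * Complex.I) *
      Phi lam (η + (lam - 1) / 2 * Complex.I) := by
  filter_upwards [eventually_codiscrete_Phi_ne_zero h1] with η hη
  rw [← shift_one]
  have hm := shift_stripIndex_mem h1 η
  set n := stripIndex lam η
  have e : shift lam (n - 1) (shift lam 1 η) = shift lam n η := by rw [shift_shift, sub_add_cancel]
  rw [extCauchy_eq h1 h2 hm, extCauchy_eq h1 h2 (n := n - 1) (by rwa [e]), e, shiftFactor_sub_one hη]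
  ring

end

end WienerHopf

/-! ### Decay of the Gamma function and of the Gamma kernel. -/

namespace WienerHopf
open MeasureTheory Set

/-- A non-integrable function would have integral 0, but Euler's formula gives a positive value. -/
lemma integrableOn_rpow_mul_exp {σ ρ : ℝ} (hσ : 0 < σ) (hρ : 0 < ρ) :
    IntegrableOn (fun t : ℝ => t ^ (σ - 1) * Real.exp (-(ρ * t))) (Ioi 0) := by
  by_contra h
  have h2 := Real.integral_rpow_mul_exp_neg_mul_Ioi hσ hρ
  rw [integral_undef h] at h2
  have := Real.Gamma_pos_of_pos hσ
  have : 0 < (1 / ρ) ^ σ * Real.Gamma σ := by positivity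
  linarith

lemma norm_cpow_mul_exp {s r : ℂ} {t : ℝ} (ht : 0 < t) :
    ‖(t : ℂ) ^ (s - 1) * Complex.exp (-(r * t))‖ = t ^ (s.re - 1) * Real.exp (-(r.re * t)) := by
  rw [norm_mul, Complex.norm_cpow_eq_rpow_re_of_pos ht, Complex.norm_exp]
  simp

/-- The rotated Euler integral. -/
lemma integral_cpow_mul_exp_neg_mul_of_re_pos {s r : ℂ} (hs : 0 < s.re) (hr : 0 < r.re) :
    ∫ t in Ioi (0 : ℝ), (t : ℂ) ^ (s - 1) * Complex.exp (-(r * t)) = r ^ (-s) * Complex.Gamma s := by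
  set U : Set ℂ := {r | 0 < r.re} with hU
  have hUo : IsOpen U := isOpen_lt continuous_const Complex.continuous_re
  set f : ℂ → ℂ := fun r => ∫ t in Ioi (0 : ℝ), (t : ℂ) ^ (s - 1) * Complex.exp (-(r * t)) with hf
  set g : ℂ → ℂ := fun r => r ^ (-s) * Complex.Gamma s with hg
  have hgd : AnalyticOnNhd ℂ g U := by
    refine DifferentiableOn.analyticOnNhd (fun r hr => ?_) hUo
    exact ((differentiableAt_id.cpow_const (mem_slitPlane_of_re_pos hr)).mul_const _).differentiableWithinAt
  have hfd : AnalyticOnNhd ℂ f U := by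
    refine DifferentiableOn.analyticOnNhd (fun r₀ hr₀ => ?_) hUo
    have hr₀' : 0 < r₀.re := hr₀
    set F : ℂ → ℝ → ℂ := fun r => (Ioi (0 : ℝ)).indicator
      fun t => (t : ℂ) ^ (s - 1) * Complex.exp (-(r * t)) with hF
    have hfF : f = fun r => ∫ t, F r t := by
      funext r
      rw [hf, hF, integral_indicator measurableSet_Ioi]
    have hb := (integrableOn_rpow_mul_exp hs (half_pos hr₀')).integrable_indicator measurableSet_Ioi
    have hre : ∀ z ∈ Metric.ball r₀ (r₀.re / 2), r₀.re / 2 ≤ z.re := by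
      intro z hz
      rw [Metric.mem_ball, dist_eq_norm] at hz
      have := (Complex.abs_re_le_norm (z - r₀)).trans hz.le
      rw [Complex.sub_re, abs_le] at this
      linarith
    have key := hasDerivAt_integral_of_norm_le (F := F) (z₀ := r₀) (half_pos hr₀') hb (fun z _ => ?_) (fun t => ?_)
      (fun z hz t => ?_)
    · rw [hfF]
      exact key.2.differentiableAt.differentiableWithinAt
    · rw [aestronglyMeasurable_indicator_iff measurableSet_Ioi]
      refine ContinuousOn.aestronglyMeasurable (fun t ht => ?_) measurableSet_Ioi
      refine ContinuousAt.continuousWithinAt (ContinuousAt.mul ?_ (by fun_prop))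
      exact (Complex.continuousAt_ofReal_cpow_const t (s - 1) (Or.inr (ne_of_gt ht)))
    · by_cases ht : t ∈ Ioi (0 : ℝ)
      · simp only [hF, indicator_of_mem ht]
        fun_prop
      · simp only [hF, indicator_of_notMem ht]
        exact differentiableOn_const 0
    · by_cases ht : t ∈ Ioi (0 : ℝ)
      · simp only [hF, indicator_of_mem ht]
        have ht' : 0 < t := ht
        rw [norm_cpow_mul_exp ht']
        have := hre z hz
        gcongr
      · simp [hF, indicator_of_notMem ht]
  have hpre : IsPreconnected U := (convex_halfSpace_re_gt 0).isPreconnected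
  have h1U : (1 : ℂ) ∈ U := by simp [hU]
  -- Identity theorem: the formula is known for positive real r, and these accumulate at 1.
  have hfreq : ∃ᶠ z in 𝓝[≠] (1 : ℂ), f z = g z := by
    have ht : Tendsto (fun x : ℝ => (x : ℂ)) (𝓝[≠] 1) (𝓝[≠] 1) := by
      refine tendsto_nhdsWithin_iff.mpr ⟨?_, ?_⟩
      · have := Complex.continuous_ofReal.tendsto (1 : ℝ)
        rw [Complex.ofReal_one] at this
        exact this.mono_left nhdsWithin_le_nhds
      · filter_upwards [self_mem_nhdsWithin] with x hx
        simpa using hx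
    refine ht.frequently (Eventually.frequently ?_)
    have : ∀ᶠ x : ℝ in 𝓝[≠] 1, 0 < x := nhdsWithin_le_nhds (lt_mem_nhds one_pos)
    filter_upwards [this] with x hx
    simp only [hf, hg]
    rw [Complex.integral_cpow_mul_exp_neg_mul_Ioi hs hx, one_div, ← Complex.ofReal_inv,
      Complex.cpow_neg, Complex.ofReal_inv, Complex.inv_cpow]
    rw [Complex.arg_ofReal_of_nonneg hx.le]
    exact Real.pi_pos.ne
  exact hfd.eqOn_of_preconnected_of_frequently_eq hgd hpre h1U hfreq hr

/-- Exponential decay of the Gamma function on vertical lines. -/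
lemma exists_norm_Gamma_le {σ₁ σ₂ θ : ℝ} (hσ : 0 < σ₁) (hθ : 0 < θ) (hθ' : θ < Real.pi / 2) :
    ∃ A : ℝ, 0 < A ∧ ∀ s : ℂ, σ₁ ≤ s.re → s.re ≤ σ₂ →
      ‖Complex.Gamma s‖ ≤ A * Real.exp (-θ * |s.im|) := by
  have hcos : 0 < Real.cos θ := Real.cos_pos_of_mem_Ioo ⟨by linarith, hθ'⟩
  have hcont : ContinuousOn (fun σ : ℝ => (1 / Real.cos θ) ^ σ * Real.Gamma σ) (Icc σ₁ σ₂) := by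
    intro σ hs
    refine ContinuousAt.continuousWithinAt (ContinuousAt.mul ?_ ?_)
    · exact (Real.continuousAt_const_rpow (by positivity))
    · refine (Real.differentiableAt_Gamma fun m h => ?_).continuousAt
      have := hs.1
      rw [h] at this
      have : (0 : ℝ) ≤ m := Nat.cast_nonneg m
      linarith
  obtain ⟨A, hA⟩ := isCompact_Icc.exists_bound_of_continuousOn hcont
  refine ⟨max A 1, lt_max_of_lt_right one_pos, fun s h1 h2 => ?_⟩
  have hs : 0 < s.re := by linarith
  -- Put r = e^{iφ} in the rotated integral: |r^{-s}| = e^{φ Im s}, and the integrand is bounded by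
  -- the real Euler integral with rate cos θ. The sign of φ is later taken to be that of Im s.
  have key : ∀ φ : ℝ, |φ| = θ → ‖Complex.Gamma s‖ * Real.exp (s.im * φ) ≤ max A 1 := by
    intro φ hφ
    set r : ℂ := Complex.exp (φ * Complex.I) with hr
    have hrre : r.re = Real.cos θ := by
      rw [hr, Complex.exp_ofReal_mul_I_re, ← hφ, Real.cos_abs]
    have hpi : |φ| < Real.pi := by linarith [Real.pi_pos]
    rw [abs_lt] at hpi
    have hlog : Complex.log r = φ * Complex.I := by
      rw [hr, Complex.log_exp] <;> simp <;> linarith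
    have h3 := integral_cpow_mul_exp_neg_mul_of_re_pos hs (r := r) (by rw [hrre]; exact hcos)
    have h4 : ‖r ^ (-s)‖ = Real.exp (s.im * φ) := by
      rw [Complex.cpow_def_of_ne_zero (Complex.exp_ne_zero _), hlog, Complex.norm_exp]
      congr 1
      simp; ring
    have h5 : ‖Complex.Gamma s‖ * Real.exp (s.im * φ)
        = ‖∫ t in Ioi (0 : ℝ), (t : ℂ) ^ (s - 1) * Complex.exp (-(r * t))‖ := by
      rw [h3, norm_mul, h4, mul_comm]
    rw [h5]
    refine le_trans ?_ (le_max_left _ _)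
    refine le_trans ?_ ((le_abs_self _).trans (hA s.re ⟨h1, h2⟩))
    refine (norm_integral_le_integral_norm _).trans (le_of_eq ?_)
    rw [← Real.integral_rpow_mul_exp_neg_mul_Ioi hs hcos]
    refine setIntegral_congr_fun measurableSet_Ioi fun t ht => ?_
    rw [norm_cpow_mul_exp ht, hrre]
  have h6 : ‖Complex.Gamma s‖ * Real.exp (θ * |s.im|) ≤ max A 1 := by
    rcases le_total 0 s.im with h | h
    · have := key θ (abs_of_pos hθ)
      rwa [abs_of_nonneg h, mul_comm θ]
    · have := key (-θ) (by rw [abs_neg, abs_of_pos hθ])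
      rw [abs_of_nonpos h]
      rwa [show θ * -s.im = s.im * -θ by ring]
  rw [neg_mul, Real.exp_neg, ← div_eq_mul_inv, le_div_iff₀ (Real.exp_pos _)]
  exact h6

/-- Γ(s) = Γ(s+1)/s reaches Re s > -1, as needed for contours above ξ, at the price of the distance
ρ to the pole 0. -/
lemma exists_norm_Gamma_le_of_add_one {σ₁ σ₂ θ : ℝ} (hσ : 0 < σ₁) (hθ : 0 < θ)
    (hθ' : θ < Real.pi / 2) :
    ∃ A : ℝ, 0 < A ∧ ∀ (s : ℂ) (ρ : ℝ), 0 < ρ → ρ ≤ ‖s‖ → σ₁ ≤ s.re + 1 → s.re + 1 ≤ σ₂ →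
      ‖Complex.Gamma s‖ ≤ A / ρ * Real.exp (-θ * |s.im|) := by
  obtain ⟨A, hA0, hA⟩ := exists_norm_Gamma_le (σ₂ := σ₂) hσ hθ hθ'
  refine ⟨A, hA0, fun s ρ hρ hs h1 h2 => ?_⟩
  have hs0 : s ≠ 0 := norm_pos_iff.mp (hρ.trans_le hs)
  have h3 := hA (s + 1) (by simpa using h1) (by simpa using h2)
  rw [Complex.Gamma_add_one s hs0, norm_mul] at h3
  simp only [Complex.add_im, Complex.one_im, add_zero] at h3
  rw [div_mul_eq_mul_div, le_div_iff₀ hρ]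
  refine le_trans ?_ h3
  rw [mul_comm]
  gcongr

lemma rpow_le_add {t u u₁ u₂ : ℝ} (ht : 0 < t) (h1 : u₁ ≤ u) (h2 : u ≤ u₂) :
    t ^ u ≤ t ^ u₁ + t ^ u₂ := by
  have p1 := Real.rpow_pos_of_pos ht u₁
  have p2 := Real.rpow_pos_of_pos ht u₂
  rcases le_total 1 t with h | h
  · have := Real.rpow_le_rpow_of_exponent_le h h2
    linarith
  · have := Real.rpow_le_rpow_of_exponent_ge ht h h1
    linarith

lemma rpow_le_add_of_mem {s t₁ t₂ u : ℝ} (ht : 0 < t₁) (h1 : t₁ ≤ s) (h2 : s ≤ t₂) :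
    s ^ u ≤ t₁ ^ u + t₂ ^ u := by
  have p1 := Real.rpow_pos_of_pos ht u
  have p2 := Real.rpow_pos_of_pos (ht.trans_le (h1.trans h2)) u
  rcases le_total 0 u with h | h
  · have := Real.rpow_le_rpow (ht.le.trans h1) h2 h
    linarith
  · have := Real.rpow_le_rpow_of_nonpos ht h1 h
    linarith

/-- The exponent `2i(ξ-y)/(λ-1)`. -/
noncomputable def gexp (lam : ℝ) (ξ y : ℂ) : ℂ := 2 * Complex.I * (ξ - y) / (lam - 1)

lemma gexp_eq (lam : ℝ) (ξ y : ℂ) :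
    gexp lam ξ y = ((2 / (lam - 1) : ℝ) : ℂ) * (Complex.I * (ξ - y)) := by
  rw [gexp]; push_cast; ring

lemma gexp_re (lam : ℝ) (ξ y : ℂ) : (gexp lam ξ y).re = -(2 / (lam - 1) * (ξ.im - y.im)) := by
  rw [gexp_eq, Complex.re_ofReal_mul]; simp; ring

lemma gexp_im (lam : ℝ) (ξ y : ℂ) : (gexp lam ξ y).im = 2 / (lam - 1) * (ξ.re - y.re) := by
  rw [gexp_eq, Complex.im_ofReal_mul]; simp

/-- The Gamma kernel, without the factor depending on `ξ` only. -/
noncomputable def gkern (lam t : ℝ) (ξ y : ℂ) : ℂ :=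
  (expCauchy lam y)⁻¹ * (t : ℂ) ^ gexp lam ξ y * Complex.Gamma (-gexp lam ξ y)

lemma gammaIntegrand_eq {lam : ℝ} {V : ℂ → ℂ} {K : ℂ} (hK : K ≠ 0)
    (hV : ∀ z ∈ stripS lam, V z = K * expCauchy lam z) {t : ℝ} {ξ y : ℂ} (hξ : ξ ∈ stripS lam)
    (hy : y ∈ stripS lam) :
    gammaIntegrand lam V t ξ y = expCauchy lam ξ * gkern lam t ξ y := by
  rw [gammaIntegrand, gkern, hV ξ hξ, hV y hy, mul_div_mul_left _ _ hK]
  simp only [gexp]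
  ring

lemma Gamma_differentiableAt_of_re {s : ℂ} (h : -1 < s.re) (h0 : s ≠ 0) :
    DifferentiableAt ℂ Complex.Gamma s := by
  refine Complex.differentiableAt_Gamma s fun m hm => ?_
  rcases m with _ | m
  · simp at hm; exact h0 hm
  · rw [hm] at h
    simp at h
    linarith [(Nat.cast_nonneg m : (0 : ℝ) ≤ m)]

section
variable {lam : ℝ} (h1 : 1 < lam) (h2 : lam < 2)
include h1 h2

omit h2 in
lemma gexp_ne_zero {ξ y : ℂ} (h : y ≠ ξ) : gexp lam ξ y ≠ 0 := by
  rw [gexp]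
  exact div_ne_zero (mul_ne_zero (mul_ne_zero two_ne_zero Complex.I_ne_zero) (sub_ne_zero.mpr h.symm))
    (lam_sub_one_ne_zero h1)

/-- Below Im ξ + (λ-1)/2 the argument of Γ has real part above -1, so y = ξ is the only pole. -/
lemma differentiableAt_gkern_right {t : ℝ} (ht : 0 < t) {ξ y : ℂ} (hy : y ∈ stripS lam)
    (hyξ : y ≠ ξ) (him : y.im < ξ.im + (lam - 1) / 2) : DifferentiableAt ℂ (gkern lam t ξ) y := by
  have hg : DifferentiableAt ℂ (fun y => gexp lam ξ y) y := by
    simp only [gexp_eq]; fun_prop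
  have ht' : (t : ℂ) ≠ 0 := Complex.ofReal_ne_zero.mpr ht.ne'
  have hl : 0 < lam - 1 := by linarith
  refine DifferentiableAt.mul (DifferentiableAt.mul
    ((differentiableAt_expCauchy h1 h2 hy).inv (expCauchy_ne_zero _ _))
    (hg.const_cpow (Or.inl ht'))) ?_
  refine DifferentiableAt.comp y (g := Complex.Gamma) (f := fun y => -gexp lam ξ y)
    (Gamma_differentiableAt_of_re ?_ (neg_ne_zero.mpr (gexp_ne_zero h1 hyξ))) hg.neg
  rw [Complex.neg_re, gexp_re, neg_neg]
  have : 2 / (lam - 1) * ((lam - 1) / 2) = 1 := by field_simp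
  have h3 : 0 < 2 / (lam - 1) := by positivity
  nlinarith

lemma differentiableAt_gkern_left {t : ℝ} (ht : 0 < t) {ξ y : ℂ} (him : y.im < ξ.im) :
    DifferentiableAt ℂ (fun ξ => gkern lam t ξ y) ξ := by
  have hg : DifferentiableAt ℂ (fun ξ => gexp lam ξ y) ξ := by
    simp only [gexp_eq]; fun_prop
  have ht' : (t : ℂ) ≠ 0 := Complex.ofReal_ne_zero.mpr ht.ne'
  have hl : 0 < lam - 1 := by linarith
  refine DifferentiableAt.mul (DifferentiableAt.const_mul (hg.const_cpow (Or.inl ht')) _) ?_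
  have hne : y ≠ ξ := fun h => by rw [h] at him; exact lt_irrefl _ him
  refine DifferentiableAt.comp ξ (g := Complex.Gamma) (f := fun ξ => -gexp lam ξ y)
    (Gamma_differentiableAt_of_re ?_ (neg_ne_zero.mpr (gexp_ne_zero h1 hne))) hg.neg
  rw [Complex.neg_re, gexp_re, neg_neg]
  have h3 : 0 < 2 / (lam - 1) * (ξ.im - y.im) := mul_pos (by positivity) (by linarith)
  linarith

/-- The basic bound for the Gamma kernel. -/
lemma exists_norm_gkern_le : ∃ C : ℝ, 0 < C ∧ ∀ (A t : ℝ) (ξ y : ℂ), 0 < t → y ∈ stripS lam →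
    ‖Complex.Gamma (-gexp lam ξ y)‖ ≤ A * Real.exp (-(3 * Real.pi / 8) * |(-gexp lam ξ y).im|) →
    ‖gkern lam t ξ y‖ ≤ C * A * Real.exp (3 / 4 * (Real.pi / (lam - 1)) * |ξ.re|) *
      t ^ (gexp lam ξ y).re * Real.exp (-(1 / 8 * (Real.pi / (lam - 1))) * |y.re|) := by
  have hl : 0 < lam - 1 := by linarith
  have hpi := Real.pi_pos
  set p := Real.pi / (lam - 1) with hp
  have hp0 : 0 < p := by positivity
  -- With p = π/(λ-1), 1/V grows at rate ½(p + p/4) = 5p/8, while Γ at angle 3π/8 decays at rate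
  -- 3p/4; the net decay rate is p/8.
  obtain ⟨c, hc0, hc⟩ := expCauchy_lower h1 h2 (δ := p / 4) (by positivity)
  refine ⟨c⁻¹ * Real.exp (5 / 8 * p * 3), by positivity, fun A t ξ y ht hy hG => ?_⟩
  have hA : 0 ≤ A := by
    have := (norm_nonneg _).trans hG
    have h3 := Real.exp_pos (-(3 * Real.pi / 8) * |(-gexp lam ξ y).im|)
    nlinarith
  have hinv : ‖(expCauchy lam y)⁻¹‖ ≤ c⁻¹ * (Real.exp (5 / 8 * p * 3) * Real.exp (5 / 8 * p * |y.re|)) := by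
    have h3 := hc y hy
    have hny : ‖y‖ ≤ |y.re| + 3 := by
      refine (Complex.norm_le_abs_re_add_abs_im y).trans ?_
      rw [abs_of_pos (by linarith [hy.1] : 0 < y.im)]
      linarith [hy.2]
    have h4 : Real.exp (-(1 / 2) * (p + p / 4) * ‖y‖) = (Real.exp (5 / 8 * p * ‖y‖))⁻¹ := by
      rw [← Real.exp_neg]; congr 1; ring
    rw [h4] at h3
    rw [norm_inv, ← Real.exp_add]
    refine (inv_anti₀ (by positivity) h3).trans ?_
    rw [mul_inv, inv_inv]
    gcongr
    nlinarith
  have hG2 : ‖Complex.Gamma (-gexp lam ξ y)‖ ≤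
      A * (Real.exp (3 / 4 * p * |ξ.re|) * Real.exp (-(3 / 4 * p) * |y.re|)) := by
    refine hG.trans ?_
    rw [← Real.exp_add, Complex.neg_im, abs_neg, gexp_im, abs_mul, abs_of_pos (by positivity : 0 < 2 / (lam - 1))]
    have e : -(3 * Real.pi / 8) * (2 / (lam - 1) * |ξ.re - y.re|) = -(3 / 4 * p) * |ξ.re - y.re| := by
      rw [hp]; field_simp; ring
    rw [e]
    have h3 := abs_sub_abs_le_abs_sub y.re ξ.re
    rw [abs_sub_comm] at h3
    gcongr
    nlinarith
  rw [gkern, norm_mul, norm_mul, Complex.norm_cpow_eq_rpow_re_of_pos ht]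
  calc _ ≤ (c⁻¹ * (Real.exp (5 / 8 * p * 3) * Real.exp (5 / 8 * p * |y.re|))) * t ^ (gexp lam ξ y).re *
        (A * (Real.exp (3 / 4 * p * |ξ.re|) * Real.exp (-(3 / 4 * p) * |y.re|))) := by
        gcongr
    _ = c⁻¹ * Real.exp (5 / 8 * p * 3) * A * Real.exp (3 / 4 * p * |ξ.re|) * t ^ (gexp lam ξ y).re *
        (Real.exp (5 / 8 * p * |y.re|) * Real.exp (-(3 / 4 * p) * |y.re|)) := by ring
    _ = _ := by rw [← Real.exp_add]; ring_nf

end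

end WienerHopf

/-! ### The Gamma-kernel integral: contour independence, analyticity, evolution in t. -/

namespace WienerHopf
open MeasureTheory Set

/-- The Gamma-kernel integral over `Im y = b`, without its prefactors. -/
noncomputable def gline (lam b t : ℝ) (ξ : ℂ) : ℂ := lineIntegral (gkern lam t ξ) b

/-- The prefactor of the Gamma-kernel integral. -/
noncomputable def gconst (lam : ℝ) : ℂ :=
  1 / (2 * Real.pi * Complex.I) *
    (-((Real.sqrt 2 : ℂ) / ((Real.sqrt Real.pi : ℂ) * Complex.I * (lam - 1))))

/-- The solution of the transformed problem, on the strip. -/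
noncomputable def gsol (lam t : ℝ) (ξ : ℂ) : ℂ :=
  gconst lam * (expCauchy lam ξ * gline lam ((3 / 2 + min ξ.im 2) / 2) t ξ)

lemma gexp_linePt_re (lam : ℝ) (ξ : ℂ) (b x : ℝ) :
    (gexp lam ξ (linePt b x)).re = -(2 / (lam - 1) * (ξ.im - b)) := by
  rw [gexp_re, linePt_im]

section
variable {lam : ℝ} (h1 : 1 < lam) (h2 : lam < 2)
include h1 h2

lemma exists_norm_gkern_le_of_norm {σ₁ σ₂ : ℝ} (hσ : 0 < σ₁) :
    ∃ C : ℝ, 0 < C ∧ ∀ (ρ t : ℝ) (ξ y : ℂ), 0 < t → y ∈ stripS lam → 0 < ρ →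
      ρ ≤ ‖gexp lam ξ y‖ → σ₁ ≤ 1 + 2 / (lam - 1) * (ξ.im - y.im) →
      1 + 2 / (lam - 1) * (ξ.im - y.im) ≤ σ₂ →
      ‖gkern lam t ξ y‖ ≤ C / ρ * Real.exp (3 / 4 * (Real.pi / (lam - 1)) * |ξ.re|) *
        t ^ (gexp lam ξ y).re * Real.exp (-(1 / 8 * (Real.pi / (lam - 1))) * |y.re|) := by
  have hpi := Real.pi_pos
  obtain ⟨A, hA0, hA⟩ := exists_norm_Gamma_le_of_add_one (σ₂ := σ₂) (θ := 3 * Real.pi / 8) hσ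
    (by positivity) (by linarith)
  obtain ⟨C, hC0, hC⟩ := exists_norm_gkern_le h1 h2
  refine ⟨C * A, by positivity, fun ρ t ξ y ht hy hρ hn h3 h4 => ?_⟩
  have e : (-gexp lam ξ y).re + 1 = 1 + 2 / (lam - 1) * (ξ.im - y.im) := by
    rw [Complex.neg_re, gexp_re]; ring
  have := hC (A / ρ) t ξ y ht hy
    (hA _ ρ hρ (by rwa [norm_neg]) (by rw [e]; exact h3) (by rw [e]; exact h4))
  rwa [← mul_div_assoc] at this

lemma exists_norm_gkern_le_below {σ₁ σ₂ : ℝ} (hσ : 0 < σ₁) :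
    ∃ C : ℝ, 0 < C ∧ ∀ (t : ℝ) (ξ y : ℂ), 0 < t → y ∈ stripS lam →
      σ₁ ≤ ξ.im - y.im → ξ.im - y.im ≤ σ₂ →
      ‖gkern lam t ξ y‖ ≤ C * Real.exp (3 / 4 * (Real.pi / (lam - 1)) * |ξ.re|) *
        t ^ (gexp lam ξ y).re * Real.exp (-(1 / 8 * (Real.pi / (lam - 1))) * |y.re|) := by
  have hl : 0 < 2 / (lam - 1) := div_pos two_pos (by linarith)
  obtain ⟨C, hC0, hC⟩ := exists_norm_gkern_le_of_norm h1 h2 (σ₁ := 1)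
    (σ₂ := 1 + 2 / (lam - 1) * σ₂) one_pos
  refine ⟨C / (2 / (lam - 1) * σ₁), by positivity, fun t ξ y ht hy h3 h4 => ?_⟩
  refine hC _ t ξ y ht hy (by positivity) ?_ ?_ (by gcongr)
  · refine le_trans ?_ (Complex.abs_re_le_norm _)
    rw [gexp_re, abs_neg]
    exact le_trans (by gcongr) (le_abs_self _)
  · have : 0 < 2 / (lam - 1) * (ξ.im - y.im) := mul_pos hl (by linarith)
    linarith

omit h2 in
lemma decay_pos : 0 < 1 / 8 * (Real.pi / (lam - 1)) :=
  mul_pos (by norm_num) (div_pos Real.pi_pos (by linarith))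

lemma continuous_gkern_linePt {b t : ℝ} (ht : 0 < t) {ξ : ℂ} (hb : 3 / 2 < b)
    (hb' : b < (3 + lam) / 2) (hbξ : b < ξ.im + (lam - 1) / 2) (hne : b ≠ ξ.im) :
    Continuous fun x : ℝ => gkern lam t ξ (linePt b x) := by
  rw [continuous_iff_continuousAt]
  intro x
  have := differentiableAt_gkern_right h1 h2 ht (ξ := ξ) (y := linePt b x)
    (by constructor <;> rwa [linePt_im])
    (fun h => hne (by rw [← linePt_im b x, h])) (by rwa [linePt_im])
  exact this.continuousAt.comp (f := fun x : ℝ => linePt b x) (continuous_linePt b).continuousAt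

lemma lineIntegrable_gkern {b t : ℝ} (ht : 0 < t) {ξ : ℂ} (hb : 3 / 2 < b)
    (hb' : b < (3 + lam) / 2) (hbξ : b < ξ.im + (lam - 1) / 2) (hne : b ≠ ξ.im) :
    LineIntegrable (gkern lam t ξ) b := by
  have hl : 0 < 2 / (lam - 1) := div_pos two_pos (by linarith)
  have hσ : 0 < 1 + 2 / (lam - 1) * (ξ.im - b) := by
    have : 2 / (lam - 1) * ((lam - 1) / 2) = 1 := by
      have : lam - 1 ≠ 0 := by linarith
      field_simp
    nlinarith
  obtain ⟨C, hC0, hC⟩ := exists_norm_gkern_le_of_norm h1 h2 (σ₂ := 1 + 2 / (lam - 1) * (ξ.im - b)) hσ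
  have hρ : 0 < |2 / (lam - 1) * (ξ.im - b)| :=
    abs_pos.mpr (mul_ne_zero hl.ne' (sub_ne_zero.mpr hne.symm))
  refine Integrable.mono' ((integrable_exp_neg_mul_abs (decay_pos h1)).const_mul
    (C / |2 / (lam - 1) * (ξ.im - b)| * Real.exp (3 / 4 * (Real.pi / (lam - 1)) * |ξ.re|) *
      t ^ (-(2 / (lam - 1) * (ξ.im - b))))) (continuous_gkern_linePt h1 h2 ht hb hb' hbξ
      hne).aestronglyMeasurable (ae_of_all _ fun x => ?_)
  have := hC _ t ξ (linePt b x) ht (by constructor <;> rwa [linePt_im]) hρ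
    (by
      refine le_trans ?_ (Complex.abs_re_le_norm _)
      rw [gexp_linePt_re, abs_neg]) (by rw [linePt_im]) (by rw [linePt_im])
  rwa [gexp_linePt_re, linePt_re] at this

/-- Both contours lie below the pole y = ξ, so none is crossed. -/
lemma gline_eq_of_le {b₁ b₂ t : ℝ} (ht : 0 < t) {ξ : ℂ} (hξ : ξ ∈ stripS lam) (hb₁ : 3 / 2 < b₁)
    (hb : b₁ ≤ b₂) (hbξ : b₂ < ξ.im) : gline lam b₁ t ξ = gline lam b₂ t ξ := by
  have hl : 0 < 2 / (lam - 1) := div_pos two_pos (by linarith)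
  have h3 := hξ.2
  obtain ⟨C, hC0, hC⟩ := exists_norm_gkern_le_below h1 h2 (σ₂ := ξ.im - b₁) (sub_pos.mpr hbξ)
  refine lineIntegral_eq_of_differentiableAt hb (fun z hz hz' => ?_)
    (lineIntegrable_gkern h1 h2 ht hb₁ (by linarith) (by linarith) (by linarith))
    (lineIntegrable_gkern h1 h2 ht (by linarith) (by linarith) (by linarith) (by linarith))
    fun ε hε => ?_
  · refine differentiableAt_gkern_right h1 h2 ht ⟨by linarith, by linarith⟩ (fun h => ?_)
      (by linarith)
    rw [h] at hz'
    linarith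
  · obtain ⟨X, hX⟩ := exists_abs_ge_exp_le
      (C := C * Real.exp (3 / 4 * (Real.pi / (lam - 1)) * |ξ.re|) *
        (t ^ (-(2 / (lam - 1) * (ξ.im - b₁))) + t ^ (-(2 / (lam - 1) * (ξ.im - b₂)))))
      (decay_pos h1) hε
    refine ⟨X, fun x b hx hb₁' hb₂' => ?_⟩
    have := hC t ξ (linePt b x) ht (by constructor <;> rw [linePt_im] <;> linarith)
      (by rw [linePt_im]; linarith) (by rw [linePt_im]; linarith)
    rw [gexp_linePt_re, linePt_re] at this
    refine this.trans (le_trans ?_ (hX x hx))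
    gcongr
    exact rpow_le_add ht (by gcongr) (by gcongr)

lemma gline_eq {b₁ b₂ t : ℝ} (ht : 0 < t) {ξ : ℂ} (hξ : ξ ∈ stripS lam) (hb₁ : 3 / 2 < b₁)
    (hb₂ : 3 / 2 < b₂) (hbξ₁ : b₁ < ξ.im) (hbξ₂ : b₂ < ξ.im) :
    gline lam b₁ t ξ = gline lam b₂ t ξ := by
  rcases le_total b₁ b₂ with h | h
  · exact gline_eq_of_le h1 h2 ht hξ hb₁ h hbξ₂
  · exact (gline_eq_of_le h1 h2 ht hξ hb₂ h hbξ₁).symm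

lemma gsol_eq {b t : ℝ} (ht : 0 < t) {ξ : ℂ} (hξ : ξ ∈ stripS lam) (hb : 3 / 2 < b)
    (hbξ : b < ξ.im) : gsol lam t ξ = gconst lam * (expCauchy lam ξ * gline lam b t ξ) := by
  have h3 := hξ.1
  have h4 : min ξ.im 2 ≤ ξ.im := min_le_left _ _
  have h5 : 3 / 2 < min ξ.im 2 := lt_min h3 (by norm_num)
  rw [gsol, gline_eq h1 h2 ht hξ (by linarith) hb (by linarith) hbξ]

lemma differentiableAt_gline {b t : ℝ} (ht : 0 < t) {ξ : ℂ} (hξ : ξ ∈ stripS lam) (hb : 3 / 2 < b)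
    (hbξ : b < ξ.im) : DifferentiableAt ℂ (gline lam b t) ξ := by
  have hl : 0 < 2 / (lam - 1) := div_pos two_pos (by linarith)
  have h3 := hξ.2
  set r := (ξ.im - b) / 2 with hr
  have hr0 : 0 < r := by rw [hr]; linarith
  have him : ∀ z ∈ Metric.ball ξ r, r ≤ z.im - b ∧ z.im - b ≤ 3 * r ∧ |z.re| ≤ |ξ.re| + r := by
    intro z hz
    rw [Metric.mem_ball, dist_eq_norm] at hz
    have h4 := (Complex.abs_im_le_norm (z - ξ)).trans hz.le
    have h5 := (Complex.abs_re_le_norm (z - ξ)).trans hz.le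
    rw [Complex.sub_im, abs_le] at h4
    rw [Complex.sub_re] at h5
    have h6 := abs_sub_abs_le_abs_sub z.re ξ.re
    refine ⟨?_, ?_, ?_⟩ <;> linarith
  obtain ⟨C, hC0, hC⟩ := exists_norm_gkern_le_below h1 h2 (σ₂ := 3 * r) hr0
  refine (hasDerivAt_integral_of_norm_le (z₀ := ξ) (F := fun z x => gkern lam t z (linePt b x)) hr0
    ((integrable_exp_neg_mul_abs (decay_pos h1)).const_mul
      (C * Real.exp (3 / 4 * (Real.pi / (lam - 1)) * (|ξ.re| + r)) *
      (t ^ (-(2 / (lam - 1) * (3 * r))) + t ^ (-(2 / (lam - 1) * r)))))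
    (fun z hz => ?_) (fun x z hz => ?_) (fun z hz x => ?_)).2.differentiableAt
  · have := him z hz
    exact (continuous_gkern_linePt h1 h2 ht hb (by linarith) (by linarith)
      (by linarith)).aestronglyMeasurable
  · have := him z hz
    exact (differentiableAt_gkern_left h1 h2 ht (by rw [linePt_im]; linarith)).differentiableWithinAt
  · obtain ⟨h4, h5, h6⟩ := him z hz
    have := hC t z (linePt b x) ht (by constructor <;> rw [linePt_im] <;> linarith)
      (by rwa [linePt_im]) (by rwa [linePt_im])
    rw [gexp_linePt_re, linePt_re] at this
    refine this.trans ?_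
    have hp : 0 ≤ 3 / 4 * (Real.pi / (lam - 1)) := by
      have := decay_pos h1
      linarith
    gcongr
    exact rpow_le_add ht (by gcongr) (by gcongr)

lemma analyticOnNhd_gsol {t : ℝ} (ht : 0 < t) : AnalyticOnNhd ℂ (gsol lam t) (stripS lam) := by
  refine DifferentiableOn.analyticOnNhd (fun ξ hξ => ?_) (isOpen_stripS lam)
  have h3 := hξ.1
  have hmem : ∀ᶠ z in 𝓝 ξ, (3 / 2 + ξ.im) / 2 < z.im :=
    (isOpen_lt continuous_const Complex.continuous_im).mem_nhds
      (show (3 / 2 + ξ.im) / 2 < ξ.im by linarith)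
  -- The contour in `gsol` moves with ξ; contour independence freezes it near a given point.
  have heq : gsol lam t =ᶠ[𝓝 ξ] fun z =>
      gconst lam * (expCauchy lam z * gline lam ((3 / 2 + ξ.im) / 2) t z) := by
    filter_upwards [(isOpen_stripS lam).mem_nhds hξ, hmem] with z hz hz'
    exact gsol_eq h1 h2 ht hz (by linarith) hz'
  refine DifferentiableAt.differentiableWithinAt (DifferentiableAt.congr_of_eventuallyEq ?_ heq)
  exact ((differentiableAt_expCauchy h1 h2 hξ).mul
    (differentiableAt_gline h1 h2 ht hξ (by linarith) (by linarith))).const_mul _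

omit h2 in
lemma gexp_add_shift (ξ y : ℂ) : gexp lam (ξ + (lam - 1) / 2 * Complex.I) y = gexp lam ξ y - 1 := by
  have := lam_sub_one_ne_zero h1
  simp only [gexp]
  field_simp
  ring_nf
  simp only [Complex.I_sq]
  ring

omit h2 in
-- With g the exponent, the derivative of t^g Γ(-g) is g t^{g-1} Γ(-g) = -t^{g-1} Γ(1-g), and g - 1
-- is the exponent belonging to ξ + i(λ-1)/2.
lemma hasDerivAt_gkern {t : ℝ} (ht : 0 < t) {ξ y : ℂ} (hy : y ≠ ξ) :
    HasDerivAt (fun s : ℝ => gkern lam s ξ y)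
      (-gkern lam t (ξ + (lam - 1) / 2 * Complex.I) y) t := by
  have hg := gexp_ne_zero h1 hy
  have h3 := ((hasDerivAt_id (t : ℂ)).cpow_const (c := gexp lam ξ y)
    (mem_slitPlane_of_re_pos (by simpa using ht))).comp_ofReal
  have h4 := (h3.const_mul (expCauchy lam y)⁻¹).mul_const (Complex.Gamma (-gexp lam ξ y))
  refine h4.congr_deriv ?_
  rw [gkern, gexp_add_shift h1, neg_sub, sub_eq_neg_add 1, Complex.Gamma_add_one _ (neg_ne_zero.mpr hg)]
  simp only [id]
  ring

lemma hasDerivAt_gline {b t : ℝ} (ht : 0 < t) {ξ : ℂ} (hξ : ξ ∈ stripS lam) (hb : 3 / 2 < b)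
    (hbξ : b < ξ.im) : HasDerivAt (fun s : ℝ => gline lam b s ξ)
      (-gline lam b t (ξ + (lam - 1) / 2 * Complex.I)) t := by
  have h3 := hξ.2
  set ξ' := ξ + (lam - 1) / 2 * Complex.I with hξ'
  have him : ξ'.im = ξ.im + (lam - 1) / 2 := by
    rw [hξ', Complex.add_im, show ((lam : ℂ) - 1) / 2 = (((lam - 1) / 2 : ℝ) : ℂ) by push_cast; ring,
      Complex.im_ofReal_mul]
    simp
  obtain ⟨C, hC0, hC⟩ := exists_norm_gkern_le_below h1 h2 (σ₁ := ξ'.im - b) (σ₂ := ξ'.im - b)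
    (by linarith)
  have key := hasDerivAt_integral_of_dominated_loc_of_deriv_le (μ := volume) (x₀ := t)
    (F := fun s x => gkern lam s ξ (linePt b x)) (F' := fun s x => -gkern lam s ξ' (linePt b x))
    (s := Metric.ball t (t / 2)) (Metric.ball_mem_nhds t (half_pos ht))
    (bound := fun x => C * Real.exp (3 / 4 * (Real.pi / (lam - 1)) * |ξ'.re|) *
      ((t / 2) ^ (-(2 / (lam - 1) * (ξ'.im - b))) + (2 * t) ^ (-(2 / (lam - 1) * (ξ'.im - b)))) *
      Real.exp (-(1 / 8 * (Real.pi / (lam - 1))) * |x|))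
    ?_ ?_ ?_ ?_ ?_ ?_
  · have := key.2
    rw [integral_neg] at this
    exact this
  · filter_upwards [lt_mem_nhds ht] with s hs
    exact (continuous_gkern_linePt h1 h2 hs hb (by linarith) (by linarith)
      (by linarith)).aestronglyMeasurable
  · exact lineIntegrable_gkern h1 h2 ht hb (by linarith) (by linarith) (by linarith)
  · exact (continuous_gkern_linePt h1 h2 ht hb (by linarith) (by linarith)
      (by linarith)).aestronglyMeasurable.neg
  · refine ae_of_all _ fun x s hs => ?_
    rw [Metric.mem_ball, Real.dist_eq, abs_lt] at hs
    rw [norm_neg]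
    have := hC s ξ' (linePt b x) (by linarith) (by constructor <;> rw [linePt_im] <;> linarith)
      (by rw [linePt_im]) (by rw [linePt_im])
    rw [gexp_linePt_re, linePt_re] at this
    refine this.trans ?_
    gcongr
    exact rpow_le_add_of_mem (half_pos ht) (by linarith) (by linarith)
  · exact (integrable_exp_neg_mul_abs (decay_pos h1)).const_mul _
  · refine ae_of_all _ fun x s hs => ?_
    rw [Metric.mem_ball, Real.dist_eq, abs_lt] at hs
    refine hasDerivAt_gkern h1 (by linarith) fun h => ?_
    rw [← h, linePt_im] at hbξ
    exact lt_irrefl _ hbξ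

/-- A contour below ξ is also below the shifted point, so one contour represents both values. The
minus sign from Γ is absorbed by the difference equation for the prefactor V(ξ). -/
lemma hasDerivAt_gsol {t : ℝ} (ht : 0 < t) {ξ : ℂ} (hξ : 3 / 2 < ξ.im) (hξ' : ξ.im < 2) :
    HasDerivAt (fun s : ℝ => gsol lam s ξ)
      (gsol lam t (ξ + (lam - 1) / 2 * Complex.I) * Phi lam (ξ + (lam - 1) / 2 * Complex.I)) t := by
  have him : (ξ + (lam - 1) / 2 * Complex.I).im = ξ.im + (lam - 1) / 2 := by
    rw [Complex.add_im, show ((lam : ℂ) - 1) / 2 = (((lam - 1) / 2 : ℝ) : ℂ) by push_cast; ring,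
      Complex.im_ofReal_mul]
    simp
  have hS : ξ ∈ stripS lam := ⟨hξ, by linarith⟩
  have hS' : ξ + (lam - 1) / 2 * Complex.I ∈ stripS lam :=
    ⟨by rw [him]; linarith, by rw [him]; linarith⟩
  have hd := ((hasDerivAt_gline h1 h2 ht hS (b := (3 / 2 + ξ.im) / 2) (by linarith)
    (by linarith)).const_mul (expCauchy lam ξ)).const_mul (gconst lam)
  refine (hd.congr_of_eventuallyEq ?_).congr_deriv ?_
  · filter_upwards [lt_mem_nhds ht] with s hs
    exact gsol_eq h1 h2 hs hS (by linarith) (by linarith)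
  · rw [gsol_eq h1 h2 ht hS' (b := (3 / 2 + ξ.im) / 2) (by linarith) (by rw [him]; linarith),
      expCauchy_eq h1 h2 hξ hξ']
    ring

end

end WienerHopf

/-! ### The limit t → 0. -/

namespace WienerHopf
open MeasureTheory Set

section
variable {lam : ℝ} (h1 : 1 < lam) (h2 : lam < 2)
include h1 h2

lemma tendsto_sub_mul_gkern {t : ℝ} (ht : 0 < t) {ξ : ℂ} (hξ : ξ ∈ stripS lam) :
    Tendsto (fun z => (z - ξ) * gkern lam t ξ z) (𝓝[≠] ξ)
      (𝓝 ((expCauchy lam ξ)⁻¹ * ((lam - 1) / (2 * Complex.I)))) := by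
  have hl := lam_sub_one_ne_zero h1
  have hg : ContinuousAt (fun z => gexp lam ξ z) ξ := by
    have : (fun z => gexp lam ξ z) = fun z =>
        ((2 / (lam - 1) : ℝ) : ℂ) * (Complex.I * (ξ - z)) := funext fun z => gexp_eq lam ξ z
    rw [this]; fun_prop
  have hgξ : gexp lam ξ ξ = 0 := by simp [gexp]
  have hneg : Tendsto (fun z => -gexp lam ξ z) (𝓝[≠] ξ) (𝓝[≠] 0) := by
    refine tendsto_nhdsWithin_iff.mpr ⟨?_, ?_⟩
    · have := hg.neg.tendsto
      rw [Pi.neg_apply, hgξ, neg_zero] at this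
      exact this.mono_left nhdsWithin_le_nhds
    · filter_upwards [self_mem_nhdsWithin] with z hz
      exact neg_ne_zero.mpr (gexp_ne_zero h1 hz)
  have hΓ := Complex.tendsto_self_mul_Gamma_nhds_zero.comp hneg
  have hpow : Tendsto (fun z => (t : ℂ) ^ gexp lam ξ z) (𝓝[≠] ξ) (𝓝 1) := by
    have := (hg.const_cpow (b := (t : ℂ)) (Or.inl (Complex.ofReal_ne_zero.mpr ht.ne'))).tendsto
    simp only [hgξ, Complex.cpow_zero] at this
    exact this.mono_left nhdsWithin_le_nhds
  have hinv : Tendsto (fun z => (expCauchy lam z)⁻¹) (𝓝[≠] ξ) (𝓝 (expCauchy lam ξ)⁻¹) :=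
    ((differentiableAt_expCauchy h1 h2 hξ).continuousAt.inv₀
      (expCauchy_ne_zero lam ξ)).tendsto.mono_left nhdsWithin_le_nhds
  have := ((hinv.mul hpow).mul hΓ).mul_const (((lam : ℂ) - 1) / (2 * Complex.I))
  simp only [mul_one] at this
  refine this.congr fun z => ?_
  have e : z - ξ = -gexp lam ξ z * (((lam : ℂ) - 1) / (2 * Complex.I)) := by
    simp only [gexp]; field_simp; ring
  simp only [Function.comp_apply, gkern]
  rw [e]
  ring

/-- The contour passes from below ξ to a height g above it. The bound on 3g keeps the argument of Γ
to the right of the next pole, and the remaining margins keep the lines inside the strip. -/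
lemma gline_sub_eq {b g t : ℝ} (ht : 0 < t) {ξ : ℂ} (hξ : ξ ∈ stripS lam) (hbξ : b < ξ.im)
    (hg : 0 < g) (hgb : 3 / 2 + g < b) (hgl : 3 * g ≤ (lam - 1) / 2)
    (hgξ : ξ.im + 3 * g ≤ (3 + lam) / 2) :
    gline lam b t ξ - gline lam (ξ.im + g) t ξ =
      2 * Real.pi * Complex.I * ((expCauchy lam ξ)⁻¹ * ((lam - 1) / (2 * Complex.I))) := by
  have hl : 0 < 2 / (lam - 1) := div_pos two_pos (by linarith)
  have hlg : 2 / (lam - 1) * g ≤ 1 / 3 := by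
    rw [div_mul_eq_mul_div, div_le_iff₀ (by linarith)]
    linarith
  obtain ⟨C, hC0, hC⟩ := exists_norm_gkern_le_of_norm h1 h2 (σ₁ := 2 / 3)
    (σ₂ := 1 + 2 / (lam - 1) * (ξ.im - b)) (by norm_num)
  refine lineIntegral_sub_eq_residue hbξ (by linarith) hg (fun z hz hz' hne =>
      differentiableAt_gkern_right h1 h2 ht ⟨by linarith, by linarith⟩ hne (by linarith))
    (tendsto_sub_mul_gkern h1 h2 ht hξ)
    (lineIntegrable_gkern h1 h2 ht (by linarith) (by linarith) (by linarith) (by linarith))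
    (lineIntegrable_gkern h1 h2 ht (by linarith) (by linarith) (by linarith) (by linarith))
    fun ε hε => ?_
  obtain ⟨X, hX⟩ := exists_abs_ge_exp_le
    (C := C / 1 * Real.exp (3 / 4 * (Real.pi / (lam - 1)) * |ξ.re|) *
      (t ^ (-(2 / (lam - 1) * (ξ.im - b))) + t ^ (2 / (lam - 1) * g))) (decay_pos h1) hε
  -- Horizontal distance (λ-1)/2 from ξ gives |2i(ξ-y)/(λ-1)| ≥ 1, which is the choice ρ = 1 in the
  -- kernel bound.
  refine ⟨max X (|ξ.re| + (lam - 1) / 2), fun x b' hx hb₁ hb₂ => ?_⟩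
  have hx1 := (le_max_left _ _).trans hx
  have hx2 := (le_max_right _ _).trans hx
  have := hC 1 t ξ (linePt b' x) ht (by constructor <;> rw [linePt_im] <;> linarith) one_pos
    (by
      refine le_trans ?_ (Complex.abs_im_le_norm _)
      rw [gexp_im, linePt_re, abs_mul, abs_of_pos hl, abs_sub_comm]
      have h3 := abs_sub_abs_le_abs_sub x ξ.re
      have h4 : 2 / (lam - 1) * ((lam - 1) / 2) = 1 := by
        have : lam - 1 ≠ 0 := by linarith
        field_simp
      nlinarith)
    (by rw [linePt_im]; nlinarith) (by rw [linePt_im]; gcongr)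
  rw [gexp_linePt_re, linePt_re] at this
  refine this.trans (le_trans ?_ (hX x hx1))
  gcongr
  refine rpow_le_add ht (by gcongr) ?_
  rw [← mul_neg]
  gcongr
  linarith

/-- On a contour above ξ the modulus of the power of t is t^{2g/(λ-1)}, with positive exponent, and
the rest is bounded by an integrable function independent of t. -/
lemma tendsto_gline_above {g : ℝ} {ξ : ℂ} (hξ : ξ ∈ stripS lam) (hg : 0 < g)
    (hgl : 3 * g ≤ (lam - 1) / 2) (hgξ : ξ.im + 3 * g ≤ (3 + lam) / 2) :
    Tendsto (fun t : ℝ => gline lam (ξ.im + g) t ξ) (𝓝[>] 0) (𝓝 0) := by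
  have hl : 0 < 2 / (lam - 1) := div_pos two_pos (by linarith)
  have hlg : 2 / (lam - 1) * g ≤ 1 / 3 := by
    rw [div_mul_eq_mul_div, div_le_iff₀ (by linarith)]
    linarith
  have hu : 0 < 2 / (lam - 1) * g := by positivity
  have hξ1 := hξ.1
  obtain ⟨C, hC0, hC⟩ := exists_norm_gkern_le_of_norm h1 h2 (σ₁ := 2 / 3) (σ₂ := 1) (by norm_num)
  set D := C / (2 / (lam - 1) * g) * Real.exp (3 / 4 * (Real.pi / (lam - 1)) * |ξ.re|) with hD
  have hlim : Tendsto (fun t : ℝ => D * t ^ (2 / (lam - 1) * g) *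
      ∫ x : ℝ, Real.exp (-(1 / 8 * (Real.pi / (lam - 1))) * |x|)) (𝓝[>] 0) (𝓝 0) := by
    have h3 := (Real.continuousAt_rpow_const 0 _ (Or.inr hu.le)).tendsto
    rw [Real.zero_rpow hu.ne'] at h3
    have := ((h3.const_mul D).mul_const
      (∫ x : ℝ, Real.exp (-(1 / 8 * (Real.pi / (lam - 1))) * |x|)))
    rw [mul_zero, zero_mul] at this
    exact this.mono_left nhdsWithin_le_nhds
  refine squeeze_zero_norm' ?_ hlim
  filter_upwards [self_mem_nhdsWithin] with t ht
  have ht : 0 < t := ht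
  rw [← integral_const_mul]
  refine norm_integral_le_of_norm_le ((integrable_exp_neg_mul_abs (decay_pos h1)).const_mul _)
    (ae_of_all _ fun x => ?_)
  have := hC (2 / (lam - 1) * g) t ξ (linePt (ξ.im + g) x) ht
    (by constructor <;> rw [linePt_im] <;> linarith) hu
    (by
      refine le_trans ?_ (Complex.abs_re_le_norm _)
      rw [gexp_linePt_re]
      refine le_trans (le_of_eq ?_) (le_abs_self _)
      ring)
    (by rw [linePt_im]; linarith) (by rw [linePt_im]; linarith)
  rw [gexp_linePt_re, linePt_re, show -(2 / (lam - 1) * (ξ.im - (ξ.im + g))) = 2 / (lam - 1) * g by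
    ring] at this
  exact this

omit h2 in
lemma gconst_mul : gconst lam * (2 * Real.pi * Complex.I * (((lam : ℂ) - 1) / (2 * Complex.I))) =
    1 / (Real.sqrt (2 * Real.pi) : ℂ) := by
  have hl := lam_sub_one_ne_zero h1
  have hpi : (Real.pi : ℂ) ≠ 0 := Complex.ofReal_ne_zero.mpr Real.pi_ne_zero
  have hsp : (Real.sqrt Real.pi : ℂ) ≠ 0 :=
    Complex.ofReal_ne_zero.mpr (Real.sqrt_pos.mpr Real.pi_pos).ne'
  have hs2 : (Real.sqrt 2 : ℂ) ≠ 0 :=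
    Complex.ofReal_ne_zero.mpr (Real.sqrt_pos.mpr two_pos).ne'
  have hsq : (Real.sqrt 2 : ℂ) ^ 2 = 2 := by
    rw [← Complex.ofReal_pow, Real.sq_sqrt two_pos.le]; simp
  rw [Real.sqrt_mul two_pos.le, Complex.ofReal_mul, gconst]
  field_simp
  rw [Complex.I_sq, hsq]
  ring

lemma tendsto_gsol {ξ : ℂ} (hξ : ξ ∈ stripS lam) :
    Tendsto (fun t : ℝ => gsol lam t ξ) (𝓝[>] 0) (𝓝 (1 / (Real.sqrt (2 * Real.pi) : ℂ))) := by
  have h3 := hξ.1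
  have h4 := hξ.2
  set b := (3 / 2 + ξ.im) / 2 with hb
  obtain ⟨g, hg, hgb, hgl, hgξ⟩ : ∃ g : ℝ, 0 < g ∧ 3 / 2 + g < b ∧ 3 * g ≤ (lam - 1) / 2 ∧
      ξ.im + 3 * g ≤ (3 + lam) / 2 := by
    have m0 : 0 < min (min ((3 + lam) / 2 - ξ.im) ((lam - 1) / 2)) (b - 3 / 2) :=
      lt_min (lt_min (by linarith) (by linarith)) (by linarith)
    set m := min (min ((3 + lam) / 2 - ξ.im) ((lam - 1) / 2)) (b - 3 / 2) with hm
    have m1 : m ≤ (3 + lam) / 2 - ξ.im := (min_le_left _ _).trans (min_le_left _ _)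
    have m2 : m ≤ (lam - 1) / 2 := (min_le_left _ _).trans (min_le_right _ _)
    have m3 : m ≤ b - 3 / 2 := min_le_right _ _
    exact ⟨m / 3, by linarith, by linarith, by linarith, by linarith⟩
  have hE := expCauchy_ne_zero lam ξ
  have hlim := (((tendsto_gline_above h1 h2 hξ hg hgl hgξ).add_const (2 * Real.pi * Complex.I *
    ((expCauchy lam ξ)⁻¹ * (((lam : ℂ) - 1) / (2 * Complex.I))))).const_mul
      (expCauchy lam ξ)).const_mul (gconst lam)
  have e : gconst lam * (expCauchy lam ξ * (0 + 2 * Real.pi * Complex.I *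
      ((expCauchy lam ξ)⁻¹ * (((lam : ℂ) - 1) / (2 * Complex.I))))) =
      1 / (Real.sqrt (2 * Real.pi) : ℂ) := by
    rw [← gconst_mul h1, zero_add, mul_left_comm (2 * (Real.pi : ℂ) * Complex.I),
      mul_inv_cancel_left₀ hE]
  rw [e] at hlim
  refine hlim.congr' ?_
  filter_upwards [self_mem_nhdsWithin] with t ht
  have ht : 0 < t := ht
  rw [gsol_eq h1 h2 ht hξ (b := b) (by linarith) (by linarith),
    ← gline_sub_eq h1 h2 ht hξ (by linarith) hg hgb hgl hgξ]
  ring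

end

end WienerHopf

/-! ### Return to the normalisation of the statement. -/

namespace WienerHopf
open MeasureTheory Set

/-- The point with `kern (freq lam) (midPt lam - η) = 1/(1 + e^{-4πη/(λ-1)})`. -/
noncomputable def midPt (lam : ℝ) : ℂ := (((lam - 1) / 4 : ℝ) : ℂ) * Complex.I

lemma midPt_im (lam : ℝ) : (midPt lam).im = (lam - 1) / 4 := by simp [midPt]

/-- The constant relating the two normalisations of the Cauchy integral. -/
noncomputable def normConst (lam b : ℝ) : ℂ :=
  Complex.exp (2 / ((lam - 1) * Complex.I) * ∫ x : ℝ, ell lam (linePt b x) *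
    (kern 1 (refPt - linePt b x) - kern (freq lam) (midPt lam - linePt b x)))

section
variable {lam : ℝ} (h1 : 1 < lam) (h2 : lam < 2)
include h1

lemma kern_midPt_sub (η : ℂ) : kern (freq lam) (midPt lam - η) =
    1 / (1 + Complex.exp (-(4 * Real.pi / (lam - 1) * η))) := by
  have hl := lam_sub_one_ne_zero h1
  have e : (freq lam : ℂ) * (midPt lam - η) =
      -(4 * Real.pi / (lam - 1) * η) + Real.pi * Complex.I := by
    rw [freq, midPt]; push_cast; field_simp; ring
  rw [kern, e, Complex.exp_add, Complex.exp_pi_mul_I, mul_neg_one, sub_neg_eq_add]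

omit h1 in
lemma kern_freq (w : ℂ) : 1 / (1 - Complex.exp (4 * Real.pi / (lam - 1) * w)) = kern (freq lam) w := by
  rw [kern, freq]; push_cast; rfl

lemma cauchyIntegrand_linePt {b : ℝ} (hb : b ∈ Ioo ((2 + lam) / 2) ((3 + lam) / 2)) (ξ : ℂ) (x : ℝ) :
    cauchyIntegrand lam b ξ (linePt b x) = ell lam (linePt b x) *
      (kern (freq lam) (ξ - linePt b x) - kern (freq lam) (midPt lam - linePt b x)) := by
  rw [cauchyIntegrand, linePt_re, logNegPhi_eq hb, kern_freq, kern_midPt_sub h1]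

omit h1 in
lemma quotIntegrand_linePt {b : ℝ} (hb : b ∈ Ioo ((2 + lam) / 2) ((3 + lam) / 2)) (ξ y : ℂ) (x : ℝ) :
    quotIntegrand lam b ξ y (linePt b x) = ell lam (linePt b x) *
      (kern (freq lam) (ξ - linePt b x) - kern (freq lam) (y - linePt b x)) := by
  rw [quotIntegrand, linePt_re, logNegPhi_eq hb, kern_freq, kern_freq]

/-- The poles of the normalising term lie at the odd multiples of i(λ-1)/4, exactly the excluded
heights. -/
lemma sin_midPt_ne_zero {b : ℝ} (hb : ∀ k : ℤ, b ≠ (2 * (k : ℝ) + 1) * (lam - 1) / 4) :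
    Real.sin (freq lam * ((midPt lam).im - b) / 2) ≠ 0 := by
  intro h
  obtain ⟨n, hn⟩ := Real.sin_eq_zero_iff.mp h
  have hl : lam - 1 ≠ 0 := by linarith
  rw [freq_mul h1, midPt_im, mul_comm, mul_right_inj' Real.pi_ne_zero] at hn
  refine hb (-n) ?_
  field_simp at hn
  push_cast
  linarith

include h2

lemma lineIntegrable_cauchyIntegrand {b : ℝ} {ξ : ℂ} (h : Adm lam b ξ)
    (hb : ∀ k : ℤ, b ≠ (2 * (k : ℝ) + 1) * (lam - 1) / 4) :
    LineIntegrable (cauchyIntegrand lam b ξ) b := by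
  rw [LineIntegrable]
  simp only [cauchyIntegrand_linePt h1 h.1]
  exact integrable_ell_mul_kern_sub h.1 (one_le_freq h1 h2) (one_le_freq h1 h2)
    (h.sin_ne_zero h1) (sin_midPt_ne_zero h1 hb)

/-- Exchanging the normalising kernel changes the exponent by an integral that does not involve ξ.
-/
lemma Vpart_eq {b : ℝ} {ξ : ℂ} (h : Adm lam b ξ)
    (hb : ∀ k : ℤ, b ≠ (2 * (k : ℝ) + 1) * (lam - 1) / 4) :
    Vpart lam b ξ = normConst lam b * expCauchy lam ξ := by
  rw [Vpart, normConst, expCauchy, ← Complex.exp_add, ← mul_add, cauchyS_eq h1 h2 h, lineIntegral,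
    lineIntegral, ← integral_add]
  · congr 3
    funext x
    rw [cauchyIntegrand_linePt h1 h.1, cauchyF]
    ring
  · exact integrable_ell_mul_kern_sub h.1 le_rfl (one_le_freq h1 h2) (sin_refPt_ne_zero h1 h2 h.1)
      (sin_midPt_ne_zero h1 hb)
  · exact lineIntegrable_cauchyF_of_sin h1 h2 h.1 (h.sin_ne_zero h1)

lemma lineIntegrable_quotIntegrand {b : ℝ} {ξ y : ℂ} (hξ : Adm lam b ξ) (hy : Adm lam b y) :
    LineIntegrable (quotIntegrand lam b ξ y) b := by
  rw [LineIntegrable]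
  simp only [quotIntegrand_linePt hξ.1]
  exact integrable_ell_mul_kern_sub hξ.1 (one_le_freq h1 h2) (one_le_freq h1 h2)
    (hξ.sin_ne_zero h1) (hy.sin_ne_zero h1)

/-- The normalising terms cancel in a quotient, so no height has to be excluded. -/
lemma expCauchy_div {b : ℝ} {ξ y : ℂ} (hξ : Adm lam b ξ) (hy : Adm lam b y) :
    expCauchy lam ξ / expCauchy lam y = Complex.exp (2 / ((lam - 1) * Complex.I) *
      lineIntegral (quotIntegrand lam b ξ y) b) := by
  rw [expCauchy, expCauchy, ← Complex.exp_sub, ← mul_sub, cauchyS_eq h1 h2 hξ, cauchyS_eq h1 h2 hy,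
    lineIntegral, lineIntegral, lineIntegral, ← integral_sub
      (lineIntegrable_cauchyF_of_sin h1 h2 hξ.1 (hξ.sin_ne_zero h1))
      (lineIntegrable_cauchyF_of_sin h1 h2 hy.1 (hy.sin_ne_zero h1))]
  congr 3
  funext x
  rw [quotIntegrand_linePt hξ.1, cauchyF, cauchyF]
  ring

lemma gammaIntegral_eq {V : ℂ → ℂ} {K : ℂ} (hK : K ≠ 0)
    (hV : ∀ z ∈ stripS lam, V z = K * expCauchy lam z) {b t : ℝ} (ht : 0 < t) {ξ : ℂ}
    (hξ : ξ ∈ stripS lam) (hb : 3 / 2 < b) (hbξ : b < ξ.im) :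
    LineIntegrable (gammaIntegrand lam V t ξ) b ∧ gsol lam t ξ = gammaIntegral lam V b t ξ := by
  have h3 := hξ.2
  have e : ∀ x : ℝ, gammaIntegrand lam V t ξ (linePt b x) =
      expCauchy lam ξ * gkern lam t ξ (linePt b x) := fun x =>
    gammaIntegrand_eq hK hV hξ (by constructor <;> rw [linePt_im] <;> linarith)
  constructor
  · rw [LineIntegrable]
    simp only [e]
    exact (lineIntegrable_gkern h1 h2 ht hb (by linarith) (by linarith) hbξ.ne).const_mul _
  · rw [gsol_eq h1 h2 ht hξ hb hbξ, gammaIntegral, lineIntegral]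
    simp only [e]
    rw [integral_const_mul]
    rfl

end

end WienerHopf

/-! ### Assembly: V is a nonzero constant times the extended exponential of the Cauchy integral. -/

theorem proposition5p1 (lam : ℝ) (hlam1 : 1 < lam) (hlam2 : lam < 2) :
    -- the branch of `log(-Φ)` is well defined on each line used
    (∀ β ∈ Set.Ioo ((2 + lam) / 2) ((3 + lam) / 2), ∃! L : ℝ → ℂ, WienerHopf.IsLogBranch lam β L) ∧
    ∀ β₁ ∈ Set.Ioo ((2 + lam) / 2) ((3 + lam) / 2),
      -- the normalising term has no pole on the contour
      (∀ k : ℤ, β₁ ≠ (2 * (k : ℝ) + 1) * (lam - 1) / 4) →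
      -- the Cauchy-type integral converges
      (∀ ξ : ℂ, β₁ - (lam - 1) / 2 < ξ.im → ξ.im < β₁ →
        WienerHopf.LineIntegrable (WienerHopf.cauchyIntegrand lam β₁ ξ) β₁) ∧
      ∃ V : ℂ → ℂ,
        (∀ ξ : ℂ, β₁ - (lam - 1) / 2 < ξ.im → ξ.im < β₁ → V ξ = WienerHopf.Vpart lam β₁ ξ) ∧
        AnalyticOnNhd ℂ V (WienerHopf.stripS lam) ∧
        (∀ ξ ∈ WienerHopf.stripS lam, V ξ ≠ 0) ∧
        (∀ ξ : ℂ, MeromorphicAt V ξ) ∧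
        -- the difference equation, pointwise and as an identity of meromorphic functions
        (∀ η : ℂ, 3 / 2 < η.im → η.im < 2 →
          V η = -V (η + (lam - 1) / 2 * Complex.I) *
            WienerHopf.Phi lam (η + (lam - 1) / 2 * Complex.I)) ∧
        (∀ᶠ η in codiscrete ℂ,
          V η = -V (η + (lam - 1) / 2 * Complex.I) *
            WienerHopf.Phi lam (η + (lam - 1) / 2 * Complex.I)) ∧
        -- the lower bound
        (∀ δ : ℝ, 0 < δ → ∃ c : ℝ, 0 < c ∧ ∀ ξ ∈ WienerHopf.stripS lam,
          c * Real.exp (-(1 / 2) * (Real.pi / (lam - 1) + δ) * ‖ξ‖) ≤ ‖V ξ‖) ∧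
        -- the upper bound, away from the two boundary points of the strip that are poles
        (∀ δ : ℝ, 0 < δ → ∀ r : ℝ, 0 < r → ∃ C : ℝ, 0 < C ∧ ∀ ξ ∈ WienerHopf.stripS lam,
          r ≤ ‖ξ - 3 / 2 * Complex.I‖ → r ≤ ‖ξ - (3 + lam) / 2 * Complex.I‖ →
          ‖V ξ‖ ≤ C * Real.exp (-(1 / 2) * (Real.pi / (lam - 1) - δ) * ‖ξ‖)) ∧
        -- the representation of the quotient
        (∀ β ∈ Set.Ioo ((2 + lam) / 2) ((3 + lam) / 2), ∀ ξ y : ℂ,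
          β - (lam - 1) / 2 < ξ.im → ξ.im < β → β - (lam - 1) / 2 < y.im → y.im < β →
          WienerHopf.LineIntegrable (WienerHopf.quotIntegrand lam β ξ y) β ∧
          V ξ / V y = Complex.exp (2 / ((lam - 1) * Complex.I) *
            WienerHopf.lineIntegral (WienerHopf.quotIntegrand lam β ξ y) β)) ∧
        -- the solution of the Fourier-transformed problem
        ∃ G : ℝ → ℂ → ℂ,
          (∀ t : ℝ, 0 < t → AnalyticOnNhd ℂ (G t) (WienerHopf.stripS lam)) ∧
          (∀ t : ℝ, 0 < t → ∀ β₀ : ℝ, 3 / 2 < β₀ → β₀ < 2 →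
            ∀ ξ ∈ WienerHopf.stripS lam, β₀ < ξ.im →
              WienerHopf.LineIntegrable (WienerHopf.gammaIntegrand lam V t ξ) β₀ ∧
              G t ξ = WienerHopf.gammaIntegral lam V β₀ t ξ) ∧
          (∀ t : ℝ, 0 < t → ∀ ξ : ℂ, 3 / 2 < ξ.im → ξ.im < 2 →
            HasDerivAt (fun s : ℝ => G s ξ)
              (G t (ξ + (lam - 1) / 2 * Complex.I) *
                WienerHopf.Phi lam (ξ + (lam - 1) / 2 * Complex.I)) t) ∧
          (∀ ξ ∈ WienerHopf.stripS lam,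
            Tendsto (fun t : ℝ => G t ξ) (𝓝[>] 0) (𝓝 (1 / (Real.sqrt (2 * Real.pi) : ℂ)))) := by
  refine ⟨fun β hβ => WienerHopf.existsUnique_isLogBranch hβ, fun β₁ hβ₁ hk =>
    ⟨fun ξ h h' => WienerHopf.lineIntegrable_cauchyIntegrand hlam1 hlam2 ⟨hβ₁, h, h'⟩ hk, ?_⟩⟩
  set K := WienerHopf.normConst lam β₁
  have hK : K ≠ 0 := Complex.exp_ne_zero _
  have hKn : 0 < ‖K‖ := norm_pos_iff.mpr hK
  obtain ⟨V, hVext⟩ : ∃ V : ℂ → ℂ, V = fun ξ => K * WienerHopf.extCauchy lam ξ := ⟨_, rfl⟩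
  have hV : ∀ z ∈ WienerHopf.stripS lam, V z = K * WienerHopf.expCauchy lam z := fun z hz => by
    rw [hVext, ← WienerHopf.extCauchy_eq_expCauchy hlam1 hlam2 hz]
  refine ⟨V, fun ξ h h' => ?_, ?_, fun ξ hξ => ?_, fun ξ => ?_,
    fun η h h' => ?_, ?_, fun δ hδ => ?_, fun δ hδ r hr => ?_, fun β hβ ξ y h₁ h₂ h₃ h₄ => ?_,
    WienerHopf.gsol lam, fun t ht => WienerHopf.analyticOnNhd_gsol hlam1 hlam2 ht,
    fun t ht β₀ h h' ξ hξ hξ' => WienerHopf.gammaIntegral_eq hlam1 hlam2 hK hV ht hξ h hξ',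
    fun t ht ξ h h' => WienerHopf.hasDerivAt_gsol hlam1 hlam2 ht h h',
    fun ξ hξ => WienerHopf.tendsto_gsol hlam1 hlam2 hξ⟩
  · have hA : WienerHopf.Adm lam β₁ ξ := ⟨hβ₁, h, h'⟩
    rw [WienerHopf.Vpart_eq hlam1 hlam2 hA hk, hV ξ hA.mem_stripS]
  · have hd : DifferentiableOn ℂ (fun ξ => K * WienerHopf.expCauchy lam ξ) (WienerHopf.stripS lam) :=
      fun z hz => ((WienerHopf.differentiableAt_expCauchy hlam1 hlam2 hz).const_mul
        K).differentiableWithinAt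
    exact (hd.congr hV).analyticOnNhd (WienerHopf.isOpen_stripS lam)
  · rw [hV ξ hξ]
    exact mul_ne_zero hK (WienerHopf.expCauchy_ne_zero lam ξ)
  · rw [hVext]
    exact (MeromorphicAt.const K ξ).mul (WienerHopf.meromorphicAt_extCauchy hlam1 hlam2 ξ)
  · have him : (η + (lam - 1) / 2 * Complex.I).im = η.im + (lam - 1) / 2 := by
      rw [Complex.add_im, show ((lam : ℂ) - 1) / 2 = (((lam - 1) / 2 : ℝ) : ℂ) by push_cast; ring,
        Complex.im_ofReal_mul]
      simp
    rw [hV η ⟨h, by linarith⟩, hV (η + (lam - 1) / 2 * Complex.I)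
      ⟨by rw [him]; linarith, by rw [him]; linarith⟩, WienerHopf.expCauchy_eq hlam1 hlam2 h h']
    ring
  · filter_upwards [WienerHopf.eventually_extCauchy_eq hlam1 hlam2] with η hη
    simp only [hVext]
    linear_combination K * hη
  · obtain ⟨c, hc0, hc⟩ := WienerHopf.expCauchy_lower hlam1 hlam2 hδ
    refine ⟨‖K‖ * c, by positivity, fun ξ hξ => ?_⟩
    rw [hV ξ hξ, norm_mul, mul_assoc]
    exact mul_le_mul_of_nonneg_left (hc ξ hξ) hKn.le
  · obtain ⟨C, hC0, hC⟩ := WienerHopf.expCauchy_upper hlam1 hlam2 hδ hr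
    refine ⟨‖K‖ * C, by positivity, fun ξ hξ hr₁ hr₂ => ?_⟩
    rw [hV ξ hξ, norm_mul, mul_assoc]
    exact mul_le_mul_of_nonneg_left (hC ξ hξ hr₁ hr₂) hKn.le
  · have hξ : WienerHopf.Adm lam β ξ := ⟨hβ, h₁, h₂⟩
    have hy : WienerHopf.Adm lam β y := ⟨hβ, h₃, h₄⟩
    refine ⟨WienerHopf.lineIntegrable_quotIntegrand hlam1 hlam2 hξ hy, ?_⟩
    rw [hV ξ hξ.mem_stripS, hV y hy.mem_stripS, mul_div_mul_left _ _ hK,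
      WienerHopf.expCauchy_div hlam1 hlam2 hξ hy]
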